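/- **Theorem.** Work in the PL category. Let $D^2=[-1,1]^2$ and let $S^3=\partial[-1,1]^4$ be the PL 3-sphere; let ${\rm pr}:D^2\times S^3\to S^3$ be the projection, and regard $D^2\times S^3\subset\mathbb R^5$ as a (standard PL) tubular neighbourhood of the standard sphere $S^3\times\{0\}\subset\mathbb R^4\times\mathbb R=\mathbb R^5$. Let $M^3$ be a closed PL 3-manifold, not necessarily connected, that is, a compact polyhedron in some finite-dimensional real vector space that is locally PL homeomorphic to $\mathbb R^3$. A PL map $f:M^3\to S^3$ is a *$d$-fold branched covering with branch set $L$* if $L\subset S^3$ is a compact polyhedron of dimension at most $1$ (possibly empty), the restriction $M^3\setminus f^{-1}(L)\to S^3\setminus L$ is a $d$-fold covering map, and $\#f^{-1}(y)<d$ for all $y\in L$. It is *simple* if $\#f^{-1}(y)=d-1$ for all $y\in L$. A *simple embedded 3-dimensional braid of degree $d$* is a PL embedding $g:M^3\to D^2\times S^3\subset\mathbb R^5$ such that ${\rm pr}\circ g$ is a $d$-fold simple branched covering. It is an *embedded lift* of $f$ if ${\rm pr}\circ g=f$. Then every $2$-fold simple branched covering $f:M^3\to S^3$ has an embedded lift: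 there is a PL embedding $g:M^3\to D^2\times S^3\subset\mathbb R^5$ with ${\rm pr}\circ g=f$, so that $g$ is a simple embedded 3-dimensional braid of degree $2$. -/

import Mathlib

namespace PLBraid

section PL

variable {E F : Type*} [NormedAddCommGroup E] [NormedSpace ℝ E]
  [NormedAddCommGroup F] [NormedSpace ℝ F]

/-- A convex cell: a compact set cut out by finitely many affine inequalities. -/
def IsConvexCell (C : Set E) : Prop :=
  IsCompact C ∧ ∃ H : Set (E →ᵃ[ℝ] ℝ), H.Finite ∧ C = {x | ∀ l ∈ H, 0 ≤ l x}

/-- A compact polyhedron: a finite union of convex cells. -/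
def IsCompactPolyhedron (X : Set E) : Prop :=
  ∃ K : Set (Set E), K.Finite ∧ (∀ C ∈ K, IsConvexCell C) ∧ ⋃₀ K = X

/-- A piecewise linear map from a compact polyhedron `X` to a vector space: `X` is a finite union
of convex cells, on each of which the map is affine. Continuity is automatic, since the cells are
finitely many closed sets. A map into a subset `Y` of `F` is PL when it is PL as a map into `F`. -/
def IsPL {X : Set E} (f : X → F) : Prop :=
  ∃ K : Set (Set E), K.Finite ∧ (∀ C ∈ K, IsConvexCell C) ∧ ⋃₀ K = X ∧
    ∀ C ∈ K, ∃ A : E →ᵃ[ℝ] F, ∀ x : X, (x : E) ∈ C → f x = A x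

/-- A PL embedding of the compact polyhedron `X`: an injective PL map. As `X` is compact, it is a
homeomorphism onto its image, and the inverse is PL because the image of a convex cell under an
injective affine map is a convex cell. -/
def IsPLEmbedding {X : Set E} (f : X → F) : Prop :=
  IsPL f ∧ Function.Injective f

/-- The closed PL ball of dimension `n`. The norm of `Fin n → ℝ` is the sup norm, so this is the
cube `[-1, 1]ⁿ`. -/
abbrev Disc (n : ℕ) : Set (Fin n → ℝ) := Metric.closedBall 0 1

/-- The PL sphere of dimension `n`. The norm of `Fin (n + 1) → ℝ` is the sup norm, so this is the
boundary of the cube `[-1, 1]ⁿ⁺¹`. -/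
abbrev Sphere (n : ℕ) : Set (Fin (n + 1) → ℝ) := Metric.sphere 0 1

/-- A closed PL manifold of dimension `n`: a compact polyhedron in which every point `x` has a
neighbourhood `B` with a PL homeomorphism onto the cube `[-1, 1]ⁿ` that takes `x` to the centre. -/
def IsClosedPLManifold (n : ℕ) (M : Set E) : Prop :=
  IsCompactPolyhedron M ∧
    ∀ x ∈ M, ∃ B : Set E, B ⊆ M ∧ B ∈ nhdsWithin x M ∧ ∃ hx : x ∈ B,
      ∃ h : B → (Fin n → ℝ), IsPLEmbedding h ∧ Set.range h = Disc n ∧ h ⟨x, hx⟩ = 0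

end PL

section BranchedCovering

variable {E : Type*} [NormedAddCommGroup E] [NormedSpace ℝ E]

/-- `f` is a `d`-fold branched covering of the `m`-sphere with branch set `L`. -/
structure IsBranchedCovering {m : ℕ} (d : ℕ) {M : Set E} (f : M → Sphere m)
    (L : Set (Sphere m)) : Prop where
  /-- `f` is a PL map. -/
  isPL : IsPL (fun x => (f x : Fin (m + 1) → ℝ))
  /-- `L` is a compact polyhedron of dimension at most `m - 2`. -/
  branchSet : ∃ K : Set (Set (Fin (m + 1) → ℝ)), K.Finite ∧
    (∀ C ∈ K, IsConvexCell C ∧ Module.finrank ℝ (vectorSpan ℝ C) + 2 ≤ m) ∧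
    ⋃₀ K = Subtype.val '' L
  /-- The restriction `M \ f⁻¹(L) → Sᵐ \ L` is a covering map. -/
  isCoveringMap : IsCoveringMap (Lᶜ.restrictPreimage f)
  /-- This covering map is `d`-fold. -/
  degree : ∀ y ∉ L, (f ⁻¹' {y}).encard = d
  /-- `L` is minimum. -/
  minimum : ∀ y ∈ L, (f ⁻¹' {y}).encard < d

/-- A simple `d`-fold branched covering: every point of the branch set has exactly `d - 1`
preimages. -/
def IsSimpleBranchedCovering {m : ℕ} (d : ℕ) {M : Set E} (f : M → Sphere m) : Prop :=
  ∃ L : Set (Sphere m), IsBranchedCovering d f L ∧ ∀ y ∈ L, (f ⁻¹' {y}).encard + 1 = d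

end BranchedCovering

section Braid

/-- The polyhedron `D² × Sᵐ`. -/
abbrev Tube (m : ℕ) : Set ((Fin 2 → ℝ) × (Fin (m + 1) → ℝ)) := Disc 2 ×ˢ Sphere m

/-- The projection `D² × Sᵐ → Sᵐ`. -/
def pr {m : ℕ} (p : Tube m) : Sphere m := ⟨p.1.2, p.2.2⟩

/-- Auxiliary PL function for a bicollar of `Sᵐ`: for `|t| ≤ 1/2` it is odd and strictly increasing
in `x`, with `collar 0 x = x` and `collar t 1 = 1 + t`. -/
noncomputable def collar (t x : ℝ) : ℝ :=
  if 0 ≤ t then x + max (-t) (min t (x / 2)) else x - max t (min (-t) (x / 2))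

/-- The standard inclusion `D² × Sᵐ ⊂ ℝᵐ⁺²`. It takes `(0, x)` to `(x, 0)`, and its image is the
tubular neighbourhood `{y | 1/2 ≤ ‖y‖ ≤ 3/2} × [-1, 1]` of the standard sphere
`Sᵐ × {0}` in `ℝᵐ⁺¹ × ℝ`. The first coordinate of `D²` runs along a PL bicollar of `Sᵐ` in
`ℝᵐ⁺¹`, the second one along the last coordinate of `ℝᵐ⁺²`. -/
noncomputable def tubeInclusion {m : ℕ} (p : Tube m) : Fin (m + 2) → ℝ :=
  Fin.snoc (α := fun _ => ℝ) (fun i => collar (p.1.1 0 / 2) (p.1.2 i)) (p.1.1 1)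

variable {E : Type*} [NormedAddCommGroup E] [NormedSpace ℝ E]

/-- `g : M → D² × Sᵐ ⊂ ℝᵐ⁺²` is a simple embedded `m`-dimensional braid of degree `d`: a PL
embedding, both as a map to `D² × Sᵐ` and as a map to `ℝᵐ⁺²`, whose composition with the projection
to `Sᵐ` is a simple `d`-fold branched covering. -/
structure IsSimpleEmbeddedBraid {m : ℕ} (d : ℕ) {M : Set E} (g : M → Tube m) : Prop where
  isPLEmbedding : IsPLEmbedding (fun x => (g x : (Fin 2 → ℝ) × (Fin (m + 1) → ℝ)))
  isPLEmbedding_inclusion : IsPLEmbedding (fun x => tubeInclusion (g x))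
  isSimpleBranchedCovering : IsSimpleBranchedCovering d (pr ∘ g)

/-- `g` is an embedded lift of the `d`-fold simple branched covering `f`. -/
def IsEmbeddedLift {m : ℕ} (d : ℕ) {M : Set E} (f : M → Sphere m) (g : M → Tube m) : Prop :=
  IsSimpleEmbeddedBraid d g ∧ pr ∘ g = f

end Braid

end PLBraid

/-! Off the branch set `L` the covering is determined by its monodromy, a class in H¹(S³ ∖ L; ℤ/2).
By Alexander duality such a class is a cycle modulo two on the graph `L`. Since H₀ of a graph is
torsion free, the cycle lifts to an integral cycle (`exists_integral_cycle`), so the monodromy is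
the reduction of an integral class, that is, of a map S³ ∖ L → S¹. The covering is then the
pull-back of the connected double covering of the circle. Hence its total space maps to a circle in
the plane with the two points of each fibre antipodal. Multiplying by a function that vanishes
exactly on `L`, and putting 0 over `L`, gives a continuous map `h` to the plane that is injective on
fibres: the two points of a fibre off `L` have opposite nonzero values, and over `L` there is only
one point. After rescaling, `(h, f)` is the lift.

This is made explicit and PL with cones in ℝ⁴. The cone over `L` is the cone over a graph in general
position with respect to a direction `p` (`exists_skeleton`). The complement of the join of `p` with
this cone is star-shaped about `-p`, so the covering has a base section over it. Each edge spans a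
fin together with `p`, and its label in ℤ/2 tells whether the section changes sheets across the fin.

For a further point `q`, the signed indicator functions of the simplicial cones on `q`, `p` and the
edges are summed with coefficients. Off the join of `q` with the cone, this sum jumps at the fins by
the coefficients and at the walls through `q`, `p` and a vertex by the boundary of the chain
(`edge_jump`). Added to the labels modulo two it cancels the fins, and a small loop around the edge
of a wall shows that the fin labels form a cycle (`IsLabelling.degreeMod_eq_zero`). For an integral
lift of that cycle it gives integer heights `N q` that jump only at the fins, by the same amount for
every `q`, and that reduce to the labels (`IsLabelling.exists_height`).

A single `q` controls only the complement of its join, but finitely many joins intersect exactly in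
the cone (`exists_finite_join_points`). With PL weights `t q ≥ 0` vanishing exactly on the joins,
put `T = ∑ t q` and `Φ = ∑ N q * t q`. Crossing a fin changes `Φ` by `n * T` with `n` an integer
congruent to the label, so the planar triangle wave of height `T` at phase `Φ / T` is multiplied by
`(-1) ^ n`, which compensates the change of sheet. Each coordinate of the wave has the form `T - 2 *
|Φ' - 2 * k * T|`, where `Φ'` is `Φ` or `Φ - T / 2` and `k` takes finitely many integer values. So
`h` is continuous with finitely many affine branches, hence PL
(`isPL_of_continuous_of_isFinAffine`). -/

namespace PLBraid

open Filter Topology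

/-! ### Continuous maps with finitely many affine branches are PL. -/

section Toolkit

variable {E F G : Type*} [NormedAddCommGroup E] [NormedSpace ℝ E]
  [NormedAddCommGroup F] [NormedSpace ℝ F] [NormedAddCommGroup G] [NormedSpace ℝ G]

/-- Every value of `g` is the value of one of finitely many affine maps. -/
def IsFinAffine {X : Set E} (g : X → F) : Prop :=
  ∃ 𝓛 : Set (E →ᵃ[ℝ] F), 𝓛.Finite ∧ ∀ x : X, ∃ A ∈ 𝓛, g x = A x

theorem IsPL.isFinAffine {X : Set E} {f : X → F} (hf : IsPL f) : IsFinAffine f := by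
  obtain ⟨K, hK, -, hX, hA⟩ := hf
  choose! A hA using hA
  refine ⟨A '' K, hK.image _, fun x => ?_⟩
  obtain ⟨C, hC, hx⟩ : (x : E) ∈ ⋃₀ K := hX ▸ x.2
  exact ⟨A C, Set.mem_image_of_mem _ hC, hA C hC x hx⟩

theorem IsPL.isCompactPolyhedron {X : Set E} {f : X → F} (hf : IsPL f) :
    IsCompactPolyhedron X := by
  obtain ⟨K, hK, hC, hX, -⟩ := hf
  exact ⟨K, hK, hC, hX⟩

theorem IsCompactPolyhedron.isCompact {X : Set E} (hX : IsCompactPolyhedron X) : IsCompact X := by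
  obtain ⟨K, hK, hC, rfl⟩ := hX
  exact hK.isCompact_sUnion fun C h => (hC C h).1

theorem IsPL.continuous [FiniteDimensional ℝ E] {X : Set E} {f : X → F} (hf : IsPL f) :
    Continuous f := by
  obtain ⟨K, hK, hC, hX, hA⟩ := hf
  have : Finite K := hK
  have hloc : LocallyFinite fun C : K => ((↑) : X → E) ⁻¹' (C : Set E) := locallyFinite_of_finite _
  refine hloc.continuous ?_ (fun C => (hC C C.2).1.isClosed.preimage continuous_subtype_val) ?_
  · rw [Set.eq_univ_iff_forall]
    intro x
    obtain ⟨C, hC, hx⟩ : (x : E) ∈ ⋃₀ K := hX ▸ x.2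
    exact Set.mem_iUnion.2 ⟨⟨C, hC⟩, hx⟩
  · intro C
    obtain ⟨A, hA⟩ := hA C C.2
    exact ((A.continuous_of_finiteDimensional.comp continuous_subtype_val).continuousOn).congr
      fun x hx => hA x hx

theorem IsConvexCell.convex {C : Set E} (hC : IsConvexCell C) : Convex ℝ C := by
  obtain ⟨-, H, -, rfl⟩ := hC
  simp only [Set.ofPred_forall]
  refine convex_iInter₂ fun l _ => ?_
  exact (convex_Ici (0 : ℝ)).affine_preimage l

theorem IsConvexCell.inter_nonneg [FiniteDimensional ℝ E] {C : Set E} (hC : IsConvexCell C)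
    {H : Set (E →ᵃ[ℝ] ℝ)} (hH : H.Finite) : IsConvexCell (C ∩ {x | ∀ l ∈ H, 0 ≤ l x}) := by
  obtain ⟨hc, H', hH', rfl⟩ := hC
  refine ⟨hc.inter_right ?_, H' ∪ H, hH'.union hH, ?_⟩
  · simp only [Set.ofPred_forall]
    exact isClosed_biInter fun l _ =>
      isClosed_le continuous_const l.continuous_of_finiteDimensional
  · ext x
    simp only [Set.mem_inter_iff, Set.mem_ofPred_eq, Set.mem_union, or_imp, forall_and]

/-- Finitely many affine functions that are nonnegative on a convex set are simultaneously
positive at some point, apart from those that vanish identically. -/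
theorem exists_forall_pos_of_nonneg {D : Set E} (hD : Convex ℝ D) (hne : D.Nonempty)
    (H : Finset (E →ᵃ[ℝ] ℝ)) (hH : ∀ l ∈ H, ∀ x ∈ D, 0 ≤ l x) :
    ∃ x ∈ D, ∀ l ∈ H, (∃ z ∈ D, l z ≠ 0) → 0 < l x := by
  classical
  induction H using Finset.induction_on with
  | empty => exact ⟨hne.some, hne.some_mem, by simp⟩
  | insert l H _ ih =>
    obtain ⟨x, hx, hpos⟩ := ih fun m hm => hH m (Finset.mem_insert_of_mem hm)
    by_cases hl : ∃ z ∈ D, l z ≠ 0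
    · obtain ⟨z, hz, hlz⟩ := hl
      have hmid : ∀ m : E →ᵃ[ℝ] ℝ, m (midpoint ℝ x z) = (m x + m z) / 2 := fun m => by
        rw [m.map_midpoint, midpoint_eq_smul_add, smul_eq_mul, invOf_eq_inv]; ring
      refine ⟨midpoint ℝ x z, hD.midpoint_mem hx hz, fun m hm hmz => ?_⟩
      rw [hmid]
      rcases Finset.mem_insert.1 hm with rfl | hm'
      · have h1 := hH m hm x hx
        have h2 := lt_of_le_of_ne (hH m hm z hz) hlz.symm
        linarith
      · have h1 := hpos m hm' hmz
        have h2 := hH m hm z hz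
        linarith
    · refine ⟨x, hx, fun m hm hmz => ?_⟩
      rcases Finset.mem_insert.1 hm with rfl | hm'
      · exact absurd hmz hl
      · exact hpos m hm' hmz

/-- A continuous finitely affine map is affine on a convex set on which the coordinates of the
differences of the affine maps involved do not change sign. -/
theorem exists_affine_of_sign_const [FiniteDimensional ℝ E] [FiniteDimensional ℝ F] {X D : Set E}
    {g : X → F} (hg : Continuous g) {ι : Type*} [Finite ι] (A : ι → E →ᵃ[ℝ] F)
    (hA : ∀ x, ∃ i, g x = A i x) (hD : Convex ℝ D) (hDX : D ⊆ X)
    (σ : ι → ι → Fin (Module.finrank ℝ F) → ℝ) (hσ : ∀ i j k, σ i j k ≠ 0)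
    (hs : ∀ x ∈ D, ∀ i j k, 0 ≤ σ i j k * (Module.finBasis ℝ F).coord k (A i x - A j x)) :
    ∃ B : E →ᵃ[ℝ] F, ∀ x : X, (x : E) ∈ D → g x = B x := by
  classical
  have := Fintype.ofFinite ι
  rcases D.eq_empty_or_nonempty with rfl | hne
  · exact ⟨0, fun x hx => absurd hx (Set.notMem_empty _)⟩
  let l : ι × ι × Fin (Module.finrank ℝ F) → E →ᵃ[ℝ] ℝ := fun t =>
    (σ t.1 t.2.1 t.2.2 • (Module.finBasis ℝ F).coord t.2.2).toAffineMap.comp (A t.1 - A t.2.1)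
  have hl : ∀ t x, l t x = σ t.1 t.2.1 t.2.2 *
      (Module.finBasis ℝ F).coord t.2.2 (A t.1 x - A t.2.1 x) := fun t x => by simp [l]
  obtain ⟨x₀, hx₀, hpos⟩ := exists_forall_pos_of_nonneg hD hne (Finset.univ.image l) (by
    intro m hm x hx
    obtain ⟨t, -, rfl⟩ := Finset.mem_image.1 hm
    rw [hl]; exact hs x hx _ _ _)
  -- `D'` plays the role of the relative interior of `D`: two of the affine maps that agree at one
  -- of its points agree on all of `D`. Hence on the connected set `D'` the locus where `g` equals a
  -- given branch is open and closed.
  let D' : Set E := {x | x ∈ D ∧ ∀ t, (∃ z ∈ D, l t z ≠ 0) → 0 < l t x}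
  have hD' : Convex ℝ D' := by
    have : D' = D ∩ ⋂ t, ⋂ (_ : ∃ z ∈ D, l t z ≠ 0), {x | 0 < l t x} := by
      ext x
      simp only [D', Set.mem_ofPred_eq, Set.mem_inter_iff, Set.mem_iInter]
    rw [this]
    exact hD.inter (convex_iInter₂ fun t _ => (convex_Ioi (0 : ℝ)).affine_preimage (l t))
  have hx₀' : x₀ ∈ D' := ⟨hx₀, fun t ht =>
    hpos _ (Finset.mem_image_of_mem _ (Finset.mem_univ _)) ht⟩
  have hD'X : D' ⊆ X := fun x hx => hDX hx.1
  have key : ∀ i j, ∀ x ∈ D', A i x = A j x → ∀ z ∈ D, A i z = A j z := by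
    intro i j x hx hij z hz
    by_contra hne
    have : ∃ k, (Module.finBasis ℝ F).coord k (A i z - A j z) ≠ 0 := by
      by_contra! h
      exact hne (sub_eq_zero.1 ((Module.finBasis ℝ F).forall_coord_eq_zero_iff.1 h))
    obtain ⟨k, hk⟩ := this
    have h1 := hx.2 (i, j, k) ⟨z, hz, by rw [hl]; exact mul_ne_zero (hσ _ _ _) hk⟩
    rw [hl, hij] at h1
    simp at h1
  obtain ⟨i, hi⟩ := hA ⟨x₀, hD'X hx₀'⟩
  have hgi : ∀ x (hx : x ∈ D'), g ⟨x, hD'X hx⟩ = A i x := by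
    have hpre : PreconnectedSpace D' := Subtype.preconnectedSpace hD'.isPreconnected
    let S : ι → Set D' := fun j => {x | g ⟨x, hD'X x.2⟩ = A j x}
    have hgc : Continuous fun x : D' => g ⟨x, hD'X x.2⟩ := by fun_prop
    have hS : ∀ j, IsClosed (S j) := fun j =>
      isClosed_eq hgc ((A j).continuous_of_finiteDimensional.comp continuous_subtype_val)
    have hSi : IsClopen (S i) := by
      refine ⟨hS i, ?_⟩
      have : (S i)ᶜ = ⋃ j ∈ {j | ¬ ∀ z ∈ D, A i z = A j z}, S j := by
        ext x
        simp only [Set.mem_compl_iff, Set.mem_iUnion, Set.mem_ofPred_eq, S]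
        constructor
        · intro h
          obtain ⟨j, hj⟩ := hA ⟨x, hD'X x.2⟩
          exact ⟨j, fun hz => h (by rw [hj]; exact (hz x x.2.1).symm), hj⟩
        · rintro ⟨j, hj, hx⟩ h
          exact hj (key i j x x.2 (h.symm.trans hx))
      rw [← isClosed_compl_iff, this]
      exact (Set.toFinite _).isClosed_biUnion fun j _ => hS j
    have := hSi.eq_univ ⟨⟨x₀, hx₀'⟩, hi⟩
    intro x hx
    have : (⟨x, hx⟩ : D') ∈ S i := this ▸ Set.mem_univ _
    exact this
  refine ⟨A i, fun x hx => ?_⟩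
  -- A point of `D` outside `D'` is the limit of points of `D'` along the segment towards `x₀`, so
  -- continuity extends the identity to it.
  let c : ℝ → E := fun t => AffineMap.lineMap (x : E) x₀ t
  have hc : ∀ t ∈ Set.Ioc (0 : ℝ) 1, c t ∈ D' := by
    intro t ht
    have hcD : c t ∈ D := hD.lineMap_mem hx hx₀ ⟨ht.1.le, ht.2⟩
    refine ⟨hcD, fun s hs' => ?_⟩
    have h1 := hx₀'.2 s hs'
    have h2 : 0 ≤ l s x := by rw [hl]; exact hs x hx _ _ _
    have : l s (c t) = (1 - t) * l s x + t * l s x₀ := by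
      rw [show l s (c t) = AffineMap.lineMap (l s x) (l s x₀) t from AffineMap.apply_lineMap ..,
        AffineMap.lineMap_apply_module, smul_eq_mul, smul_eq_mul]
    rw [this]
    have := mul_pos ht.1 h1
    have := mul_nonneg (sub_nonneg.2 ht.2) h2
    linarith
  let c' : Set.Icc (0 : ℝ) 1 → X := fun t => ⟨c t, hDX (hD.lineMap_mem hx hx₀ t.2)⟩
  have hcc : Continuous c := AffineMap.lineMap_continuous
  have hc' : Continuous c' := by
    refine Continuous.subtype_mk ?_ _
    exact hcc.comp continuous_subtype_val
  have h0 : (⟨0, by simp⟩ : Set.Icc (0 : ℝ) 1) ∈ closure {t : Set.Icc (0 : ℝ) 1 | g (c' t) = A i (c' t)} := by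
    have hsub : Set.Ioi (⟨0, by simp⟩ : Set.Icc (0 : ℝ) 1) ⊆ {t | g (c' t) = A i (c' t)} := by
      intro t ht
      exact hgi (c t) (hc t ⟨ht, t.2.2⟩)
    refine closure_mono hsub ?_
    rw [closure_Ioi' ⟨⟨1, by simp⟩, by simp [Set.mem_Ioi]⟩]
    exact le_refl (α := Set.Icc (0 : ℝ) 1) _
  have hcl : IsClosed {t : Set.Icc (0 : ℝ) 1 | g (c' t) = A i (c' t)} :=
    isClosed_eq (hg.comp hc')
      ((A i).continuous_of_finiteDimensional.comp (continuous_subtype_val.comp hc'))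
  rw [hcl.closure_eq] at h0
  have hx0 : c' ⟨0, by simp⟩ = x := Subtype.ext (by simp [c', c])
  rw [Set.mem_ofPred_eq, hx0] at h0
  exact h0

/-- Cutting every cell along the zero sets of the coordinates of differences of branches leaves
pieces on which no difference changes sign, and there continuity forces a single branch. Thanks to
this, PL maps can be built below without ever exhibiting their cells. -/
theorem isPL_of_continuous_of_isFinAffine [FiniteDimensional ℝ E] [FiniteDimensional ℝ F]
    {X : Set E} (hX : IsCompactPolyhedron X) {g : X → F} (hg : Continuous g)
    (hA : IsFinAffine g) : IsPL g := by
  classical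
  obtain ⟨K, hK, hC, hKX⟩ := hX
  obtain ⟨𝓛, h𝓛, hA⟩ := hA
  have : Finite 𝓛 := h𝓛
  have := Fintype.ofFinite 𝓛
  let n := Module.finrank ℝ F
  let b := Module.finBasis ℝ F
  let sg : (𝓛 → 𝓛 → Fin n → Bool) → 𝓛 → 𝓛 → Fin n → ℝ := fun σ i j k => if σ i j k then 1 else -1
  let H : (𝓛 → 𝓛 → Fin n → Bool) → Set (E →ᵃ[ℝ] ℝ) := fun σ => Set.range
    fun t : 𝓛 × 𝓛 × Fin n =>
      (sg σ t.1 t.2.1 t.2.2 • b.coord t.2.2).toAffineMap.comp ((t.1 : E →ᵃ[ℝ] F) - t.2.1)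
  have hH : ∀ σ x, (∀ l ∈ H σ, 0 ≤ l x) ↔
      ∀ i j k, 0 ≤ sg σ i j k * b.coord k ((i : E →ᵃ[ℝ] F) x - (j : E →ᵃ[ℝ] F) x) := by
    intro σ x
    constructor
    · intro h i j k
      exact (h _ ⟨(i, j, k), rfl⟩).trans_eq (by simp)
    · rintro h _ ⟨⟨i, j, k⟩, rfl⟩
      exact (h i j k).trans_eq (by simp)
  refine ⟨⋃ σ, (fun C => C ∩ {x | ∀ l ∈ H σ, 0 ≤ l x}) '' K,
    Set.finite_iUnion fun σ => hK.image _, ?_, ?_, ?_⟩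
  · intro D hD
    obtain ⟨σ, C, hCK, rfl⟩ := Set.mem_iUnion.1 hD
    exact (hC C hCK).inter_nonneg (Set.finite_range _)
  · refine Set.Subset.antisymm ?_ ?_
    · rintro x ⟨D, hD, hx⟩
      obtain ⟨σ, C, hCK, rfl⟩ := Set.mem_iUnion.1 hD
      exact hKX ▸ ⟨C, hCK, hx.1⟩
    · intro x hx
      obtain ⟨C, hCK, hxC⟩ : x ∈ ⋃₀ K := hKX ▸ hx
      let σ : 𝓛 → 𝓛 → Fin n → Bool := fun i j k =>
        decide (0 ≤ b.coord k ((i : E →ᵃ[ℝ] F) x - (j : E →ᵃ[ℝ] F) x))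
      refine ⟨C ∩ {x | ∀ l ∈ H σ, 0 ≤ l x}, Set.mem_iUnion.2 ⟨σ, C, hCK, rfl⟩, hxC, ?_⟩
      refine (hH σ x).2 fun i j k => ?_
      by_cases h : 0 ≤ b.coord k ((i : E →ᵃ[ℝ] F) x - (j : E →ᵃ[ℝ] F) x)
      · simp only [sg, σ, h, decide_true, if_true, one_mul]
      · simp only [sg, σ, h, decide_false]
        simp only [Bool.false_eq_true, if_false]
        linarith [not_le.1 h]
  · intro D hD
    obtain ⟨σ, C, hCK, rfl⟩ := Set.mem_iUnion.1 hD
    refine exists_affine_of_sign_const (ι := 𝓛) hg (fun i => i) (fun x => ?_)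
      ((hC C hCK).inter_nonneg (Set.finite_range _)).convex
      (fun x hx => hKX ▸ ⟨C, hCK, hx.1⟩) (sg σ) (fun i j k => ?_) fun x hx => (hH σ x).1 hx.2
    · obtain ⟨A, hA, h⟩ := hA x
      exact ⟨⟨A, hA⟩, h⟩
    · simp only [sg]; split_ifs <;> norm_num

namespace IsFinAffine

variable {X : Set E}

theorem of_finite {ι : Type*} [Finite ι] {g : X → F} (G : ι → X → F)
    (hG : ∀ i, IsFinAffine (G i)) (h : ∀ x, ∃ i, g x = G i x) : IsFinAffine g := by
  choose 𝓛 h𝓛 hA using hG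
  refine ⟨⋃ i, 𝓛 i, Set.finite_iUnion h𝓛, fun x => ?_⟩
  obtain ⟨i, hi⟩ := h x
  obtain ⟨A, hA, hx⟩ := hA i x
  exact ⟨A, Set.mem_iUnion.2 ⟨i, hA⟩, hi.trans hx⟩

theorem of_or {g g₁ g₂ : X → F} (h₁ : IsFinAffine g₁) (h₂ : IsFinAffine g₂)
    (h : ∀ x, g x = g₁ x ∨ g x = g₂ x) : IsFinAffine g :=
  of_finite (fun b : Bool => if b then g₁ else g₂) (fun b => by cases b <;> simpa)
    fun x => (h x).elim (fun h => ⟨true, by simpa⟩) fun h => ⟨false, by simpa⟩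

theorem comp_affine {g : X → F} (h : IsFinAffine g) (B : F →ᵃ[ℝ] G) :
    IsFinAffine fun x => B (g x) := by
  obtain ⟨𝓛, h𝓛, hA⟩ := h
  refine ⟨(fun A => B.comp A) '' 𝓛, h𝓛.image _, fun x => ?_⟩
  obtain ⟨A, hA, hx⟩ := hA x
  exact ⟨_, Set.mem_image_of_mem _ hA, by simp [hx]⟩

theorem comp_linear {g : X → F} (h : IsFinAffine g) (B : F →ₗ[ℝ] G) :
    IsFinAffine fun x => B (g x) := h.comp_affine B.toAffineMap

theorem prodMk {g₁ : X → F} {g₂ : X → G} (h₁ : IsFinAffine g₁) (h₂ : IsFinAffine g₂) :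
    IsFinAffine fun x => (g₁ x, g₂ x) := by
  obtain ⟨𝓛, h𝓛, hA⟩ := h₁
  obtain ⟨𝓛', h𝓛', hA'⟩ := h₂
  refine ⟨Set.image2 (fun A B => A.prod B) 𝓛 𝓛', h𝓛.image2 _ h𝓛', fun x => ?_⟩
  obtain ⟨A, hA, hx⟩ := hA x
  obtain ⟨B, hB, hx'⟩ := hA' x
  exact ⟨_, Set.mem_image2_of_mem hA hB, by simp [hx, hx']⟩

theorem const (c : F) : IsFinAffine fun _ : X => c :=
  ⟨{AffineMap.const ℝ E c}, Set.finite_singleton _, fun x => ⟨_, rfl, by simp⟩⟩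

theorem add {g₁ g₂ : X → F} (h₁ : IsFinAffine g₁) (h₂ : IsFinAffine g₂) :
    IsFinAffine fun x => g₁ x + g₂ x :=
  (h₁.prodMk h₂).comp_linear (LinearMap.fst ℝ F F + LinearMap.snd ℝ F F)

theorem const_smul {g : X → F} (h : IsFinAffine g) (c : ℝ) : IsFinAffine fun x => c • g x :=
  h.comp_linear (c • LinearMap.id)

theorem neg {g : X → F} (h : IsFinAffine g) : IsFinAffine fun x => - g x :=
  h.comp_linear (-LinearMap.id)

theorem sub {g₁ g₂ : X → F} (h₁ : IsFinAffine g₁) (h₂ : IsFinAffine g₂) :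
    IsFinAffine fun x => g₁ x - g₂ x :=
  (h₁.prodMk h₂).comp_linear (LinearMap.fst ℝ F F - LinearMap.snd ℝ F F)

theorem sum {ι : Type*} (s : Finset ι) {g : ι → X → F} (h : ∀ i ∈ s, IsFinAffine (g i)) :
    IsFinAffine fun x => ∑ i ∈ s, g i x := by
  classical
  induction s using Finset.induction_on with
  | empty => simpa using const (0 : F)
  | insert i s hi ih =>
    simp only [Finset.sum_insert hi]
    exact (h i (Finset.mem_insert_self _ _)).add
      (ih fun j hj => h j (Finset.mem_insert_of_mem hj))

theorem pi {n : ℕ} {g : X → Fin n → ℝ} (h : ∀ i, IsFinAffine fun x => g x i) :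
    IsFinAffine g := by
  have := sum Finset.univ (g := fun i x => Pi.single (M := fun _ : Fin n => ℝ) i (g x i))
    fun i _ => (h i).comp_linear (LinearMap.single ℝ (fun _ => ℝ) i)
  refine Eq.mp ?_ this
  congr 1
  funext x
  exact Finset.univ_sum_single (g x)

theorem max {g₁ g₂ : X → ℝ} (h₁ : IsFinAffine g₁) (h₂ : IsFinAffine g₂) :
    IsFinAffine fun x => max (g₁ x) (g₂ x) := of_or h₁ h₂ fun _ => max_choice _ _

theorem min {g₁ g₂ : X → ℝ} (h₁ : IsFinAffine g₁) (h₂ : IsFinAffine g₂) :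
    IsFinAffine fun x => min (g₁ x) (g₂ x) := of_or h₁ h₂ fun _ => min_choice _ _

theorem abs {g : X → ℝ} (h : IsFinAffine g) : IsFinAffine fun x => |g x| :=
  of_or h h.neg fun _ => abs_choice _

end IsFinAffine

end Toolkit

/-! ### Lifting and local injectivity for the covering off the branch set. -/

section Covering

variable {M : Type*} [TopologicalSpace M] {B : Type*} [TopologicalSpace B] {f : M → B} {L : Set B}

/-- Two lifts of the same map into the complement of the branch set that agree at a point of a
preconnected set agree on that set. -/
theorem eqOn_of_lifts (hf : IsCoveringMap (Lᶜ.restrictPreimage f)) {A : Type*} [TopologicalSpace A]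
    {K : Set A} (hK : IsPreconnected K) {g₁ g₂ : A → M} (h₁ : ContinuousOn g₁ K)
    (h₂ : ContinuousOn g₂ K) (hg : ∀ a ∈ K, f (g₁ a) = f (g₂ a)) (hL : ∀ a ∈ K, f (g₁ a) ∉ L)
    {a : A} (ha : a ∈ K) (hag : g₁ a = g₂ a) : K.EqOn g₁ g₂ := by
  have : PreconnectedSpace K := Subtype.preconnectedSpace hK
  let k₁ : K → f ⁻¹' Lᶜ := fun x => ⟨g₁ x, hL x x.2⟩
  let k₂ : K → f ⁻¹' Lᶜ := fun x => ⟨g₂ x, by simpa [hg x x.2] using hL x x.2⟩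
  have hk₁ : Continuous k₁ := (continuousOn_iff_continuous_domRestrict.1 h₁).subtype_mk _
  have hk₂ : Continuous k₂ := (continuousOn_iff_continuous_domRestrict.1 h₂).subtype_mk _
  have := hf.eq_of_comp_eq hk₁ hk₂ (funext fun x => Subtype.ext (hg x x.2)) ⟨a, ha⟩
    (Subtype.ext hag)
  intro x hx
  exact congrArg Subtype.val (congrFun this ⟨x, hx⟩)

theorem exists_injOn_nhds (hf : IsCoveringMap (Lᶜ.restrictPreimage f)) (hfc : Continuous f)
    (hL : IsClosed L) {x : M} (hx : f x ∉ L) : ∃ W ∈ nhds x, Set.InjOn f W := by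
  obtain ⟨W, hW, hinj⟩ := isLocallyInjective_iff_nhds.1 hf.isLocalHomeomorph.isLocallyInjective
    ⟨x, hx⟩
  have ho : IsOpen (f ⁻¹' Lᶜ) := hL.isOpen_compl.preimage hfc
  refine ⟨Subtype.val '' W, ?_, ?_⟩
  · rw [← ho.isOpenEmbedding_subtypeVal.map_nhds_eq ⟨x, hx⟩]
    exact Filter.image_mem_map hW
  · rintro _ ⟨a, ha, rfl⟩ _ ⟨b, hb, rfl⟩ hab
    exact congrArg Subtype.val (hinj ha hb (Subtype.ext hab))

/-- Over a star-shaped open set, a covering has a section. -/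
theorem exists_section (hf : IsCoveringMap (Lᶜ.restrictPreimage f)) {V : Type*}
    [NormedAddCommGroup V] [NormedSpace ℝ V] {U : Set V} (hU : IsOpen U) {c : V} (hc : c ∈ U)
    (hstar : StarConvex ℝ c U) {π : V → B} (hπ : ContinuousOn π U) (hπL : ∀ y ∈ U, π y ∉ L)
    (hsurj : ∀ b ∉ L, ∃ x, f x = b) :
    ∃ F : V → M, ContinuousOn F U ∧ ∀ y ∈ U, f (F y) = π y := by
  classical
  have : ContractibleSpace U := hstar.contractibleSpace ⟨c, hc⟩
  have : LocallyPathConnectedSpace U := hU.locallyPathConnectedSpace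
  obtain ⟨x, hx⟩ := hsurj _ (hπL c hc)
  let π' : C(U, (Lᶜ : Set B)) := ⟨fun y => ⟨π y, hπL y y.2⟩,
    (continuousOn_iff_continuous_domRestrict.1 hπ).subtype_mk _⟩
  have hxL : x ∈ f ⁻¹' Lᶜ := by simpa [hx] using hπL c hc
  obtain ⟨F, ⟨-, hF⟩, -⟩ := hf.existsUnique_continuousMap_lifts π' ⟨c, hc⟩ ⟨x, hxL⟩
    (Subtype.ext hx)
  refine ⟨fun y => if h : y ∈ U then F ⟨y, h⟩ else x, ?_, ?_⟩
  · rw [continuousOn_iff_continuous_domRestrict]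
    refine (continuous_subtype_val.comp F.continuous).congr fun y => ?_
    simp
  · intro y hy
    simp only [hy, dif_pos]
    exact congrArg Subtype.val (congrFun hF ⟨y, hy⟩)

end Covering

/-! ### Cycles of a finite graph, modulo two and integral. -/

section Graph

/-- The degree modulo two of a vertex. -/
def degreeMod {V : Type*} [DecidableEq V] (E : Finset (V × V)) (c : V × V → ZMod 2) (v : V) :
    ZMod 2 := ∑ e ∈ E, c e * ((if e.2 = v then 1 else 0) + (if e.1 = v then 1 else 0))

/-- The boundary of a one-chain. -/
def boundary {V : Type*} [DecidableEq V] (E : Finset (V × V)) (z : V × V → ℤ) (v : V) : ℤ :=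
  ∑ e ∈ E, z e * ((if e.2 = v then 1 else 0) - (if e.1 = v then 1 else 0))

variable {V : Type*} [DecidableEq V] {E : Finset (V × V)}

theorem boundary_add (z z' : V × V → ℤ) (v : V) :
    boundary E (z + z') v = boundary E z v + boundary E z' v := by
  simp [boundary, add_mul, Finset.sum_add_distrib]

theorem boundary_smul (k : ℤ) (z : V × V → ℤ) (v : V) :
    boundary E (k • z) v = k * boundary E z v := by
  simp [boundary, Finset.mul_sum, mul_assoc]

theorem sum_boundary (z : V × V → ℤ) {P : Finset V} (hP : ∀ e ∈ E, e.1 ∈ P ↔ e.2 ∈ P) :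
    ∑ v ∈ P, boundary E z v = 0 := by
  unfold boundary
  rw [Finset.sum_comm]
  refine Finset.sum_eq_zero fun e he => ?_
  rw [← Finset.mul_sum, Finset.sum_sub_distrib, Finset.sum_ite_eq, Finset.sum_ite_eq]
  simp [hP e he]

/-- Vertices in the same component differ by a boundary. -/
theorem exists_boundary_eq_of_eqvGen {u w : V} (h : Relation.EqvGen (fun a b => (a, b) ∈ E) u w) :
    ∃ m : V × V → ℤ, ∀ v, boundary E m v = (if w = v then 1 else 0) - (if u = v then 1 else 0) := by
  induction h with
  | rel a b hab =>
    refine ⟨Pi.single (a, b) 1, fun v => ?_⟩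
    unfold boundary
    rw [Finset.sum_eq_single_of_mem _ hab]
    · simp
    · intro e _ he
      simp [Pi.single_eq_of_ne he]
  | refl a => exact ⟨0, fun v => by simp [boundary]⟩
  | symm a b _ ih =>
    obtain ⟨m, hm⟩ := ih
    refine ⟨(-1 : ℤ) • m, fun v => ?_⟩
    rw [boundary_smul, hm]; ring
  | trans a b c _ _ ih₁ ih₂ =>
    obtain ⟨m, hm⟩ := ih₁
    obtain ⟨m', hm'⟩ := ih₂
    refine ⟨m + m', fun v => ?_⟩
    rw [boundary_add, hm, hm']; ring

/-- The zeroth homology of a finite graph is torsion free. -/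
theorem exists_boundary_eq_of_two_mul {P : Finset V} (hE : ∀ e ∈ E, e.1 ∈ P ∧ e.2 ∈ P)
    (b : V → ℤ) (n : V × V → ℤ) (hb : ∀ v, boundary E n v = 2 * b v) :
    ∃ m : V × V → ℤ, ∀ v, boundary E m v = b v := by
  classical
  let r : Setoid V := Relation.EqvGen.setoid fun a b => (a, b) ∈ E
  let rep : V → V := fun v => (Quotient.mk r v).out
  have hrep : ∀ v, Relation.EqvGen (fun a b => (a, b) ∈ E) (rep v) v := fun v =>
    Quotient.exact (s := r) (Quotient.out_eq (Quotient.mk r v))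
  choose m hm using fun v => exists_boundary_eq_of_eqvGen (hrep v)
  -- The amount `b w` is carried to `w` from the representative of its component. What is left at a
  -- representative is the sum of `b` over the component, and twice this sum is a sum of boundary
  -- values over a component, hence zero.
  refine ⟨∑ w ∈ P, b w • m w, fun v => ?_⟩
  have hsum : ∀ s : Finset V, boundary E (∑ w ∈ s, b w • m w) v =
      ∑ w ∈ s, b w * boundary E (m w) v := by
    intro s
    induction s using Finset.induction_on with
    | empty => simp [boundary]
    | insert a s ha ih => rw [Finset.sum_insert ha, boundary_add, boundary_smul, ih,
        Finset.sum_insert ha]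
  have hrepE : ∀ e ∈ E, rep e.1 = rep e.2 := fun e he => by
    have : Quotient.mk r e.1 = Quotient.mk r e.2 := Quotient.sound (Relation.EqvGen.rel _ _ he)
    simp only [rep, this]
  have hcomp : ∑ w ∈ P with rep w = v, b w = 0 := by
    have h := sum_boundary (E := E) n (P := P.filter fun w => rep w = v) fun e he => by
      simp [hE e he, hrepE e he]
    simp only [hb, ← Finset.mul_sum] at h
    omega
  have hout : v ∉ P → b v = 0 := by
    intro hv
    have : boundary E n v = 0 := Finset.sum_eq_zero fun e he => by
      have h1 : e.1 ≠ v := fun h => hv (h ▸ (hE e he).1)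
      have h2 : e.2 ≠ v := fun h => hv (h ▸ (hE e he).2)
      simp [h1, h2]
    have := hb v
    omega
  rw [hsum]
  simp only [hm, mul_sub, Finset.sum_sub_distrib, mul_ite, mul_one, mul_zero]
  rw [Finset.sum_ite_eq', ← Finset.sum_filter, hcomp]
  by_cases hv : v ∈ P <;> simp [hv, hout]

/-- A cycle modulo two of a finite graph lifts to an integral cycle. -/
theorem exists_integral_cycle {P : Finset V} (hE : ∀ e ∈ E, e.1 ∈ P ∧ e.2 ∈ P)
    (c : V × V → ZMod 2) (hc : ∀ v, degreeMod E c v = 0) :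
    ∃ z : V × V → ℤ, (∀ e, (z e : ZMod 2) = c e) ∧ ∀ v, boundary E z v = 0 := by
  let n : V × V → ℤ := fun e => (c e).val
  have hn : ∀ e, (n e : ZMod 2) = c e := fun e => by simp [n]
  have hdiv : ∀ v, ∃ b, boundary E n v = 2 * b := by
    intro v
    have : ((boundary E n v : ℤ) : ZMod 2) = 0 := by
      rw [← hc v]
      unfold boundary degreeMod
      push_cast
      refine Finset.sum_congr rfl fun e _ => ?_
      rw [hn, CharTwo.sub_eq_add]
    exact (ZMod.intCast_zmod_eq_zero_iff_dvd _ 2).1 this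
  choose b hb using hdiv
  obtain ⟨m, hm⟩ := exists_boundary_eq_of_two_mul hE b n hb
  -- The lift `n` by 0 and 1 has even boundary `2 * b`, and `b` is itself the boundary of `m`.
  -- Subtracting `2 • m` kills the boundary and keeps the residues.
  refine ⟨n + (-2 : ℤ) • m, fun e => ?_, fun v => ?_⟩
  · have h2 : (2 : ZMod 2) = 0 := rfl
    simp [hn, h2]
  · rw [boundary_add, boundary_smul, hm, hb]; ring

end Graph

/-! ### Vectors in general position. -/

section Generic

variable {V : Type*} [NormedAddCommGroup V] [NormedSpace ℝ V]

/-- A real vector space is not a finite union of proper subspaces; this is applied to the traces of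
the members of `𝒮` on `K`. -/
theorem exists_mem_forall_notMem (K : Submodule ℝ V) {𝒮 : Set (Submodule ℝ V)} (h𝒮 : 𝒮.Finite)
    (hK : ∀ S ∈ 𝒮, ¬ K ≤ S) : ∃ d ∈ K, ∀ S ∈ 𝒮, d ∉ S := by
  have hfin := h𝒮.image fun S : Submodule ℝ V => S.comap K.subtype
  have h := Subspace.biUnion_ne_univ_of_top_notMem (k := ℝ) (E := K) (s := hfin.toFinset) (by
    simp only [Set.Finite.mem_toFinset, Set.mem_image, not_exists, not_and]
    intro S hS h
    exact hK S hS (by rwa [Submodule.comap_subtype_eq_top] at h))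
  obtain ⟨d, hd⟩ := (Set.ne_univ_iff_exists_notMem _).1 h
  refine ⟨d, d.2, fun S hS hdS => hd ?_⟩
  refine Set.mem_biUnion (x := S.comap K.subtype) ?_ hdS
  simp only [Set.Finite.coe_toFinset]
  exact ⟨S, hS, rfl⟩

theorem tendsto_add_smul (z d : V) : Tendsto (fun η : ℝ => z + η • d) (𝓝[>] 0) (𝓝 z) := by
  have : Continuous fun η : ℝ => z + η • d := by fun_prop
  simpa using (this.tendsto 0).mono_left nhdsWithin_le_nhds

variable [FiniteDimensional ℝ V]

theorem eventually_add_smul_notMem {S : Submodule ℝ V} {d : V} (hd : d ∉ S) (z : V) :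
    ∀ᶠ η in 𝓝[>] (0 : ℝ), z + η • d ∉ S := by
  by_cases hz : z ∈ S
  · filter_upwards [self_mem_nhdsWithin] with η hη h
    have : η • d ∈ S := by simpa using S.sub_mem h hz
    exact hd ((S.smul_mem_iff (ne_of_gt hη)).1 this)
  · have hc : IsClosed (S : Set V) := S.closed_of_finiteDimensional
    have ht : Tendsto (fun η : ℝ => z + η • d) (𝓝[>] 0) (𝓝 z) := by
      have : Continuous fun η : ℝ => z + η • d := by fun_prop
      simpa using (this.tendsto 0).mono_left nhdsWithin_le_nhds
    exact ht (hc.isOpen_compl.mem_nhds hz)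

theorem exists_mem_open_forall_notMem {𝒮 : Set (Submodule ℝ V)} (h𝒮 : 𝒮.Finite)
    (hS : ∀ S ∈ 𝒮, S ≠ ⊤) {O : Set V} (hO : IsOpen O) (hne : O.Nonempty) :
    ∃ y ∈ O, ∀ S ∈ 𝒮, y ∉ S := by
  obtain ⟨d, -, hd⟩ := exists_mem_forall_notMem ⊤ h𝒮 fun S h h' => hS S h (top_le_iff.1 h')
  obtain ⟨z, hz⟩ := hne
  have h1 : ∀ᶠ η in 𝓝[>] (0 : ℝ), ∀ S ∈ 𝒮, z + η • d ∉ S :=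
    (eventually_all_finite h𝒮).2 fun S hS => eventually_add_smul_notMem (hd S hS) z
  obtain ⟨η, h1, h2⟩ := (h1.and (tendsto_add_smul z d (hO.mem_nhds hz))).exists
  exact ⟨_, h2, h1⟩

end Generic

/-! ### Hyperplane arrangements: chambers, open stars, and wall crossing. -/

section Arrangement

variable {V : Type*} [NormedAddCommGroup V] [NormedSpace ℝ V]

/-- The complement of the arrangement of hyperplanes `ker l`, `l ∈ H`. -/
def Gen (H : Set (V →ₗ[ℝ] ℝ)) : Set V := {y | ∀ l ∈ H, l y ≠ 0}

/-- The open star of the face of the arrangement that contains `y`. -/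
def Star (H : Set (V →ₗ[ℝ] ℝ)) (y : V) : Set V := {y' | ∀ l ∈ H, l y ≠ 0 → 0 < l y * l y'}

/-- `n` is transversal to the hyperplanes of the arrangement that contain `y`. -/
def Transversal (H : Set (V →ₗ[ℝ] ℝ)) (y n : V) : Prop := ∀ l ∈ H, l y = 0 → l n ≠ 0

/-- `g` is constant on the chambers of the arrangement. -/
def ChamberConst {α : Type*} (H : Set (V →ₗ[ℝ] ℝ)) (O : Set V) (g : V → α) : Prop :=
  ∀ y ∈ O ∩ Gen H, ∀ y' ∈ O ∩ Star H y, g y' = g y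

variable {H : Set (V →ₗ[ℝ] ℝ)}

theorem mem_star_self (y : V) : y ∈ Star H y := fun _ _ h => mul_self_pos.2 h

theorem convex_star (y : V) : Convex ℝ (Star H y) := by
  have : Star H y = ⋂ l ∈ H, ⋂ (_ : l y ≠ 0), {y' | 0 < (l y • l) y'} := by
    ext; simp [Star]
  rw [this]
  exact convex_iInter₂ fun l _ => convex_iInter fun _ =>
    (convex_Ioi (0 : ℝ)).linear_preimage (l y • l)

theorem gen_of_mem_star {y y' : V} (hy : y ∈ Gen H) (h : y' ∈ Star H y) : y' ∈ Gen H :=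
  fun l hl h0 => by simpa [h0] using h l hl (hy l hl)

theorem Transversal.neg {y n : V} (h : Transversal H y n) : Transversal H y (-n) :=
  fun l hl h0 => by simpa using h l hl h0

variable [FiniteDimensional ℝ V]

theorem isOpen_star (hH : H.Finite) (y : V) : IsOpen (Star H y) := by
  have : Star H y = ⋂ l ∈ H, {y' | l y ≠ 0 → 0 < l y * l y'} := by ext; simp [Star]
  rw [this]
  refine hH.isOpen_biInter fun l _ => ?_
  by_cases h : l y = 0
  · simp [h]
  · simp only [ne_eq, h, not_false_eq_true, true_imp_iff]
    exact isOpen_lt continuous_const (continuous_const.mul l.continuous_of_finiteDimensional)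

theorem exists_mem_gen (hH : H.Finite) (h0 : ∀ l ∈ H, l ≠ 0) {O : Set V} (hO : IsOpen O)
    (hne : O.Nonempty) : ∃ y ∈ O, y ∈ Gen H := by
  obtain ⟨y, hy, h⟩ := exists_mem_open_forall_notMem (hH.image LinearMap.ker)
    (by rintro _ ⟨l, hl, rfl⟩; rw [Ne, LinearMap.ker_eq_top]; exact h0 l hl) hO hne
  exact ⟨y, hy, fun l hl => h _ ⟨l, hl, rfl⟩⟩

theorem exists_transversal (hH : H.Finite) (h0 : ∀ l ∈ H, l ≠ 0) (y : V) (l : V →ₗ[ℝ] ℝ)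
    (hl : l ≠ 0) : ∃ n, Transversal H y n ∧ 0 < l n := by
  obtain ⟨n, -, hn⟩ := exists_mem_gen (hH.insert l)
    (by rintro m (rfl | hm); exacts [hl, h0 m hm]) isOpen_univ Set.univ_nonempty
  rcases (hn l (Set.mem_insert _ _)).lt_or_gt with h | h
  · refine ⟨-n, fun m hm _ => ?_, by simpa using h⟩
    simpa using hn m (Set.mem_insert_of_mem _ hm)
  · exact ⟨n, fun m hm _ => hn m (Set.mem_insert_of_mem _ hm), h⟩

/-- A short move along `n` keeps the sign of every form that is nonzero at `y` and gives the sign of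
`l n` to every form that vanishes there. So all sufficiently short moves end in one chamber. -/
theorem eventually_sign (hH : H.Finite) {y n : V} (hn : Transversal H y n) :
    ∀ᶠ η in 𝓝[>] (0 : ℝ), ∀ l ∈ H, 0 < l (y + η • n) * (if l y = 0 then l n else l y) := by
  refine (eventually_all_finite hH).2 fun l hl => ?_
  by_cases h : l y = 0
  · filter_upwards [self_mem_nhdsWithin] with η hη
    have : 0 < l n * l n := mul_self_pos.2 (hn l hl h)
    simp only [map_add, h, map_smul, smul_eq_mul, zero_add, if_true, mul_assoc]
    exact mul_pos hη this
  · simp only [h, if_false]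
    have ht : Tendsto (fun η : ℝ => l (y + η • n) * l y) (𝓝[>] 0) (𝓝 (l y * l y)) :=
      ((l.continuous_of_finiteDimensional.tendsto y).comp (tendsto_add_smul y n)).mul_const _
    exact ht.eventually (lt_mem_nhds (mul_self_pos.2 h))

theorem eventually_gen (hH : H.Finite) {y n : V} (hn : Transversal H y n) :
    ∀ᶠ η in 𝓝[>] (0 : ℝ), y + η • n ∈ Gen H := by
  filter_upwards [eventually_sign hH hn] with η h l hl h0
  simpa [h0] using h l hl

/-- A function constant on chambers is eventually constant along a transversal ray. -/
theorem ChamberConst.exists_eventually {α : Type*} {g : V → α} {O : Set V}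
    (hg : ChamberConst H O g) (hH : H.Finite) (hO : IsOpen O) {y n : V} (hy : y ∈ O)
    (hn : Transversal H y n) : ∃ a, ∀ᶠ η in 𝓝[>] (0 : ℝ), g (y + η • n) = a := by
  have h := (eventually_sign hH hn).and
    ((eventually_gen hH hn).and (tendsto_add_smul y n (hO.mem_nhds hy)))
  obtain ⟨η₀, h1, h2, h3⟩ := h.exists
  refine ⟨g (y + η₀ • n), ?_⟩
  filter_upwards [h] with η ⟨h1', h2', h3'⟩
  refine hg _ ⟨h3, h2⟩ _ ⟨h3', fun l hl _ => ?_⟩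
  have ha := h1 l hl
  have hb := h1' l hl
  have := mul_pos ha hb
  by_contra hcon
  nlinarith [mul_self_nonneg (if l y = 0 then l n else l y)]

/-- A function that is constant on chambers and does not jump at hyperplanes, away from finitely
many subspaces of codimension at least two, is constant on a convex open set. -/
theorem gallery {α : Type*} {g : V → α} {O : Set V} (hH : H.Finite) (hO : IsOpen O)
    (hOc : Convex ℝ O) {𝓑 : Set (Submodule ℝ V)} (h𝓑 : 𝓑.Finite)
    (h𝓑d : ∀ B ∈ 𝓑, Module.finrank ℝ B + 1 < Module.finrank ℝ V) (hg : ChamberConst H O g)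
    (hjump : ∀ y ∈ O, (∀ B ∈ 𝓑, y ∉ B) → ∀ n, Transversal H y n →
      ∀ᶠ η in 𝓝[>] (0 : ℝ), g (y + η • n) = g (y - η • n))
    {y₁ y₂ : V} (h₁ : y₁ ∈ O) (h₁' : y₁ ∈ Gen H) (h₂ : y₂ ∈ O) (h₂' : y₂ ∈ Gen H) :
    g y₁ = g y₂ := by
  -- The spans of `y₁` with the exceptional subspaces are proper because of the codimension. An
  -- endpoint `z` in the chamber of `y₂` off these spans makes the segment from `y₁` to `z` miss the
  -- exceptional subspaces, except possibly at `y₁` itself.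
  obtain ⟨z, ⟨hzO, hzS⟩, hz⟩ := exists_mem_open_forall_notMem
    (h𝓑.image fun B => B ⊔ Submodule.span ℝ {y₁}) (by
      rintro _ ⟨B, hB, rfl⟩ h
      have h1 := Submodule.finrank_add_le_finrank_add_finrank B (Submodule.span ℝ {y₁})
      have h2 := finrank_span_le_card (R := ℝ) ({y₁} : Set V)
      simp only [Set.toFinset_singleton, Finset.card_singleton] at h2
      simp only at h
      rw [h, finrank_top] at h1
      have := h𝓑d B hB
      omega) (hO.inter (isOpen_star hH y₂)) ⟨y₂, h₂, mem_star_self y₂⟩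
  have hzg : z ∈ Gen H := gen_of_mem_star h₂' hzS
  rw [← hg y₂ ⟨h₂, h₂'⟩ z ⟨hzO, hzS⟩]
  set n := z - y₁ with hn
  let y : ℝ → V := fun s => y₁ + s • n
  have hyadd : ∀ s η, y (s + η) = y s + η • n := fun s η => by simp [y, add_smul, add_assoc]
  have hysub : ∀ s η, y (s - η) = y s - η • n := fun s η => by
    simp [y, sub_smul, add_sub_assoc]
  have hy0 : y 0 = y₁ := by simp [y]
  have hy1 : y 1 = z := by simp [y, hn]
  have hyO : ∀ s ∈ Set.Icc (0 : ℝ) 1, y s ∈ O := fun s hs =>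
    hOc.add_smul_sub_mem h₁ hzO hs
  have htr : ∀ s, Transversal H (y s) n := by
    intro s l hl h h'
    apply h₁' l hl
    have : l (y s) = l y₁ + s * l n := by simp [y]
    rw [h, h'] at this; linarith
  -- Only punctured germs are compared, since nothing is known about the value of `g` on the
  -- hyperplanes themselves.
  have hloc : ∀ s ∈ Set.Icc (0 : ℝ) 1, ∃ a, ∀ᶠ s' in 𝓝[≠] s, g (y s') = a := by
    intro s hs
    obtain ⟨a, ha⟩ := hg.exists_eventually hH hO (hyO s hs) (htr s)
    have hb : ∀ᶠ η in 𝓝[>] (0 : ℝ), g (y s + η • n) = g (y s - η • n) := by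
      by_cases hgen : y s ∈ Gen H
      · have hop := (hO.inter (isOpen_star hH (y s))).mem_nhds ⟨hyO s hs, mem_star_self _⟩
        have e2 := tendsto_add_smul (y s) (-n) hop
        simp only [smul_neg, ← sub_eq_add_neg] at e2
        filter_upwards [tendsto_add_smul (y s) n hop, e2] with η h1 h2
        rw [hg _ ⟨hyO s hs, hgen⟩ _ h1, hg _ ⟨hyO s hs, hgen⟩ _ h2]
      · refine hjump _ (hyO s hs) (fun B hB hyB => ?_) n (htr s)
        have hs0 : s ≠ 0 := by rintro rfl; exact hgen (hy0 ▸ h₁')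
        refine hz _ ⟨B, hB, rfl⟩ ?_
        have : z = s⁻¹ • y s + (1 - s⁻¹) • y₁ := by
          simp only [y, hn, smul_add, smul_smul, inv_mul_cancel₀ hs0, sub_smul, one_smul]
          abel
        rw [this]
        exact Submodule.add_mem_sup (B.smul_mem _ hyB)
          (Submodule.smul_mem _ _ (Submodule.mem_span_singleton_self _))
    obtain ⟨ε, hε, h⟩ := (mem_nhdsGT_iff_exists_Ioo_subset' (zero_lt_one' ℝ)).1 (ha.and hb)
    refine ⟨a, ?_⟩
    have : Metric.ball s ε ∈ 𝓝 s := Metric.ball_mem_nhds s hε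
    filter_upwards [nhdsWithin_le_nhds this, self_mem_nhdsWithin] with s' hs' hne
    rw [Metric.mem_ball, Real.dist_eq] at hs'
    rcases lt_or_gt_of_ne (show s' ≠ s from hne) with hlt | hlt
    · have hh := h (a := s - s') ⟨by linarith,
        by rw [abs_sub_comm] at hs'; exact (le_abs_self _).trans_lt hs'⟩
      rw [← sub_sub_cancel s s', hysub, ← hh.2]; exact hh.1
    · have hh := h (a := s' - s) ⟨by linarith, (le_abs_self _).trans_lt hs'⟩
      have : s' = s + (s' - s) := by ring
      rw [this, hyadd]; exact hh.1
  have hopen : ∀ p : ℝ → Prop, IsOpen {s | ∀ᶠ s' in 𝓝[≠] s, p s'} := by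
    intro p
    rw [isOpen_iff_mem_nhds]
    intro s hs
    obtain ⟨U, hU, hUo, hsU⟩ := mem_nhds_iff.1 (mem_nhdsWithin_iff_eventually.1 hs)
    filter_upwards [hUo.mem_nhds hsU] with t ht
    by_cases hts : t = s
    · subst hts; exact hs
    · filter_upwards [nhdsWithin_le_nhds (hUo.mem_nhds ht),
        nhdsWithin_le_nhds (isOpen_ne.mem_nhds hts)] with t' h1 h2
      exact hU h1 h2
  have hgen : ∀ s, y s ∈ Gen H → s ∈ Set.Icc (0 : ℝ) 1 →
      ∀ᶠ s' in 𝓝[≠] s, g (y s') = g (y s) := by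
    intro s h hs
    have hc : Continuous y := by fun_prop
    have := hc.continuousAt.preimage_mem_nhds
      ((hO.inter (isOpen_star hH (y s))).mem_nhds ⟨hyO s hs, mem_star_self _⟩)
    filter_upwards [nhdsWithin_le_nhds this] with s' hs'
    exact hg _ ⟨hyO s hs, h⟩ _ hs'
  by_contra hne
  have hpre := isPreconnected_Icc (a := (0 : ℝ)) (b := 1)
    {s | ∀ᶠ s' in 𝓝[≠] s, g (y s') = g y₁} {s | ∀ᶠ s' in 𝓝[≠] s, g (y s') ≠ g y₁}
    (hopen _) (hopen _) (fun s hs => by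
      obtain ⟨a, ha⟩ := hloc s hs
      by_cases h : a = g y₁
      · left; simpa [h] using ha
      · right
        filter_upwards [ha] with s' hs'
        rwa [hs'])
    ⟨0, by simp, by
      have := hgen 0 (hy0 ▸ h₁') (by simp)
      rwa [hy0] at this⟩
    ⟨1, by simp, by
      have := hgen 1 (hy1 ▸ hzg) (by simp)
      rw [hy1] at this
      filter_upwards [this] with s' hs'
      rw [hs']; exact fun h => hne h.symm⟩
  obtain ⟨s, -, h1, h2⟩ := hpre
  rw [Set.mem_ofPred_eq] at h1 h2
  obtain ⟨s', h1, h2⟩ := (h1.and h2).exists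
  exact h2 h1

end Arrangement

/-! ### Simplicial cones and their joins with points in general position. -/

section Cones

variable {V : Type*} [NormedAddCommGroup V] [NormedSpace ℝ V]

/-- The convex cone generated by `s`. -/
def coneOf (s : Set V) : Set V := Submodule.span {c : ℝ // 0 ≤ c} s

theorem zero_mem_coneOf (s : Set V) : (0 : V) ∈ coneOf s := Submodule.zero_mem _

theorem smul_mem_coneOf {s : Set V} {y : V} (hy : y ∈ coneOf s) {c : ℝ} (hc : 0 ≤ c) :
    c • y ∈ coneOf s := Submodule.smul_mem _ (⟨c, hc⟩ : {c : ℝ // 0 ≤ c}) hy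

theorem add_mem_coneOf {s : Set V} {y y' : V} (hy : y ∈ coneOf s) (hy' : y' ∈ coneOf s) :
    y + y' ∈ coneOf s := Submodule.add_mem _ hy hy'

theorem mem_coneOf_insert {s : Set V} {q y : V} :
    y ∈ coneOf (insert q s) ↔ ∃ c : ℝ, 0 ≤ c ∧ ∃ x ∈ coneOf s, y = c • q + x := by
  simp only [coneOf, SetLike.mem_coe, Submodule.mem_span_insert, Subtype.exists]
  exact ⟨fun ⟨c, hc, x, hx, h⟩ => ⟨c, hc, x, hx, h⟩, fun ⟨c, hc, x, hx, h⟩ => ⟨c, hc, x, hx, h⟩⟩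

theorem mem_coneOf_singleton {q y : V} : y ∈ coneOf {q} ↔ ∃ c : ℝ, 0 ≤ c ∧ y = c • q := by
  rw [← insert_empty_eq, mem_coneOf_insert]
  simp [coneOf]

theorem mem_coneOf_empty {y : V} : y ∈ coneOf (∅ : Set V) ↔ y = 0 := by simp [coneOf]

theorem coneOf_subset_span (s : Set V) : coneOf s ⊆ Submodule.span ℝ s := by
  intro y hy
  refine Submodule.span_induction (p := fun y _ => y ∈ Submodule.span ℝ s)
    (fun x hx => Submodule.subset_span hx) (Submodule.zero_mem _)
    (fun _ _ _ _ => Submodule.add_mem _) (fun c x _ hx => ?_) hy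
  exact Submodule.smul_mem _ (c : ℝ) hx

/-- A cone generated by linearly independent vectors is cut out by finitely many linear
inequalities. -/
theorem exists_forms_coneOf [FiniteDimensional ℝ V] {s : Set V} (hs : LinearIndepOn ℝ id s) :
    ∃ H : Set (V →ₗ[ℝ] ℝ), H.Finite ∧ (∀ l ∈ H, l ≠ 0) ∧ coneOf s = {y | ∀ l ∈ H, 0 ≤ l y} ∧
      (Submodule.span ℝ s ≠ ⊤ → ∃ l ∈ H, -l ∈ H) := by
  classical
  let B := Module.Basis.extend hs
  have hB : ∀ i, B i = i := Module.Basis.extend_apply_self hs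
  have hsub : s ⊆ hs.extend (Set.subset_univ s) := Module.Basis.subset_extend hs
  have hfin : Finite (hs.extend (Set.subset_univ s)) := Module.Finite.finite_basis B
  have := Fintype.ofFinite (hs.extend (Set.subset_univ s))
  have hne : ∀ i, B.coord i ≠ 0 := fun i h => by
    have : B.coord i (B i) = 1 := by simp
    rw [h] at this; simp at this
  -- In a basis extending `s` all coordinates are nonnegative on the cone, and those of the added
  -- vectors are also nonpositive. The resulting pairs `l`, `-l` are what later keeps
  -- lower-dimensional cones away from the chambers.
  refine ⟨Set.range B.coord ∪ (fun i => - B.coord i) '' {i | (i : V) ∉ s},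
    (Set.finite_range _).union (Set.toFinite _), ?_, ?_, ?_⟩
  · rintro l (⟨i, rfl⟩ | ⟨i, -, rfl⟩)
    · exact hne i
    · exact neg_ne_zero.2 (hne i)
  · refine Set.Subset.antisymm (fun y hy => ?_) fun y hy => ?_
    · refine Submodule.span_induction (p := fun y _ => y ∈ {y : V | ∀ l ∈ Set.range B.coord ∪
        (fun i => - B.coord i) '' {i | (i : V) ∉ s}, 0 ≤ l y}) (fun x hx => ?_) ?_ ?_ ?_ hy
      · have hx' : B ⟨x, hsub hx⟩ = x := hB _
        rintro l (⟨i, rfl⟩ | ⟨i, hi, rfl⟩)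
        · conv_rhs => rw [← hx']
          rw [Module.Basis.coord_apply, Module.Basis.repr_self, Finsupp.single_apply]
          split_ifs <;> norm_num
        · conv_rhs => rw [← hx']
          rw [LinearMap.neg_apply, Module.Basis.coord_apply, Module.Basis.repr_self,
            Finsupp.single_apply, if_neg]
          · simp
          · rintro rfl; exact hi hx
      · intro l _; simp
      · intro x y _ _ hx hy l hl
        rw [map_add]; exact add_nonneg (hx l hl) (hy l hl)
      · intro c x _ hx l hl
        have : l ((c : ℝ) • x) = c * l x := l.map_smul _ _
        exact (mul_nonneg c.2 (hx l hl)).trans_eq this.symm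
    · rw [← B.sum_repr y]
      refine Submodule.sum_mem _ fun i _ => ?_
      by_cases hi : (i : V) ∈ s
      · refine smul_mem_coneOf ?_ (hy _ (Or.inl ⟨i, rfl⟩))
        rw [hB]; exact Submodule.subset_span hi
      · have h1 : 0 ≤ B.coord i y := hy _ (Or.inl ⟨i, rfl⟩)
        have h2 : 0 ≤ (-B.coord i) y := hy _ (Or.inr ⟨i, hi, rfl⟩)
        have h3 : B.repr y i = 0 := by
          rw [LinearMap.neg_apply] at h2
          exact le_antisymm (by rw [← B.coord_apply]; linarith) h1
        rw [h3, zero_smul]; exact zero_mem_coneOf s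
  · intro hspan
    have : ∃ i : hs.extend (Set.subset_univ s), (i : V) ∉ s := by
      by_contra! h
      apply hspan
      rw [eq_top_iff, ← B.span_eq]
      refine Submodule.span_mono ?_
      rintro _ ⟨i, rfl⟩
      rw [hB]; exact h i
    obtain ⟨i, hi⟩ := this
    exact ⟨B.coord i, Or.inl ⟨i, rfl⟩, Or.inr ⟨i, hi, rfl⟩⟩

/-- Finitely many cones of codimension at least two are an intersection of finitely many joins with
points in general position. -/
theorem exists_finite_join_points [FiniteDimensional ℝ V] {𝒦 : Set (Set V)} (h𝒦 : 𝒦.Finite)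
    (h0 : 𝒦.Nonempty) (hd : ∀ s ∈ 𝒦, Module.finrank ℝ (Submodule.span ℝ s) + 1 < Module.finrank ℝ V)
    {𝒢 : Set (Submodule ℝ V)} (h𝒢 : 𝒢.Finite) (h𝒢' : ∀ S ∈ 𝒢, S ≠ ⊤) :
    ∃ Q : Set V, Q.Finite ∧ (∀ q ∈ Q, ∀ S ∈ 𝒢, q ∉ S) ∧
      ∀ y, (∀ q ∈ Q, ∃ s ∈ 𝒦, y ∈ coneOf (insert q s)) → ∃ s ∈ 𝒦, y ∈ coneOf s := by
  -- The induction is on the dimension of the subspaces in which a point may still lie on all joins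
  -- without lying in one of the cones.
  suffices h : ∀ n : ℕ, ∀ 𝒮 : Set (Submodule ℝ V), 𝒮.Finite →
      (∀ S ∈ 𝒮, Module.finrank ℝ S ≤ n) → ∃ Q : Set V, Q.Finite ∧ (∀ q ∈ Q, ∀ S ∈ 𝒢, q ∉ S) ∧
      ∀ S ∈ 𝒮, ∀ y ∈ S, (∀ q ∈ Q, ∃ s ∈ 𝒦, y ∈ coneOf (insert q s)) → ∃ s ∈ 𝒦, y ∈ coneOf s by
    obtain ⟨Q, h1, h2, h3⟩ := h (Module.finrank ℝ V) {⊤} (Set.finite_singleton _) (by simp)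
    exact ⟨Q, h1, h2, fun y => h3 ⊤ rfl y trivial⟩
  intro n
  induction n with
  | zero =>
    intro 𝒮 _ hS
    refine ⟨∅, Set.finite_empty, by simp, fun S hS' y hy _ => ?_⟩
    have : S = ⊥ := Submodule.finrank_eq_zero.1 (Nat.le_zero.1 (hS S hS'))
    rw [this, Submodule.mem_bot] at hy
    obtain ⟨s, hs⟩ := h0
    exact ⟨s, hs, hy ▸ zero_mem_coneOf s⟩
  | succ n ih =>
    intro 𝒮 h𝒮 hS
    let J : Set (Submodule ℝ V) := Set.image2 (fun S s => S ⊔ Submodule.span ℝ s) 𝒮 𝒦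
    have hJ : J.Finite := h𝒮.image2 _ h𝒦
    obtain ⟨q, -, hq⟩ := exists_mem_open_forall_notMem
      (h𝒢.union (hJ.subset (Set.sep_subset J fun S => S ≠ ⊤)))
      (by rintro S (h | h); exacts [h𝒢' S h, h.2]) isOpen_univ Set.univ_nonempty
    obtain ⟨Q, hQ, hQ𝒢, hQy⟩ := ih
      ((Set.image2 (fun S s => S ⊓ Submodule.span ℝ (insert q s)) 𝒮 𝒦) ∩
        {S | Module.finrank ℝ S ≤ n}) ((h𝒮.image2 _ h𝒦).inter_of_left _) (fun S hS => hS.2)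
    refine ⟨insert q Q, hQ.insert q, ?_, ?_⟩
    · rintro r (rfl | hr) S hS
      · exact hq S (Or.inl hS)
      · exact hQ𝒢 r hr S hS
    · intro S hS' y hy hyQ
      obtain ⟨s, hs, hys⟩ := hyQ q (Set.mem_insert _ _)
      -- If `S` and `s` span everything, then `S` is not contained in the span of `q` and `s`, whose
      -- codimension is positive, and `y` falls into a subspace of smaller dimension. Otherwise `q`
      -- avoids their sum, which forces the coefficient of `q` in `y` to vanish.
      by_cases htop : S ⊔ Submodule.span ℝ s = ⊤
      · refine hQy (S ⊓ Submodule.span ℝ (insert q s)) ⟨⟨S, hS', s, hs, rfl⟩, ?_⟩ y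
          ⟨hy, coneOf_subset_span _ hys⟩ fun r hr => hyQ r (Set.mem_insert_of_mem _ hr)
        have hlt : S ⊓ Submodule.span ℝ (insert q s) < S := by
          refine lt_of_le_of_ne inf_le_left fun h => ?_
          have h1 : S ⊔ Submodule.span ℝ s ≤ Submodule.span ℝ (insert q s) :=
            sup_le (inf_eq_left.1 h) (Submodule.span_mono (Set.subset_insert _ _))
          rw [htop, top_le_iff, Submodule.span_insert] at h1
          have h2 := Submodule.finrank_add_le_finrank_add_finrank (Submodule.span ℝ {q})
            (Submodule.span ℝ s)
          have h3 := finrank_span_le_card (R := ℝ) ({q} : Set V)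
          simp only [Set.toFinset_singleton, Finset.card_singleton] at h3
          rw [h1, finrank_top] at h2
          have := hd s hs
          omega
        have := Submodule.finrank_lt_finrank_of_lt hlt
        have := hS S hS'
        change Module.finrank ℝ _ ≤ n
        omega
      · obtain ⟨c, -, x, hx, rfl⟩ := mem_coneOf_insert.1 hys
        have hc : c = 0 := by
          by_contra hc
          refine hq _ (Or.inr ⟨⟨S, hS', s, hs, rfl⟩, htop⟩) ?_
          have : q = c⁻¹ • (c • q + x) - c⁻¹ • x := by
            rw [smul_add, inv_smul_smul₀ hc, add_sub_cancel_right]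
          rw [this]
          exact Submodule.sub_mem _ (Submodule.mem_sup_left (S.smul_mem _ hy))
            (Submodule.mem_sup_right (Submodule.smul_mem _ _ (coneOf_subset_span _ hx)))
        exact ⟨s, hs, by simpa [hc] using hx⟩

end Cones

/-! ### Jumps of signed indicator functions of simplicial cones. -/

section Jump

variable {V : Type*} [NormedAddCommGroup V] [NormedSpace ℝ V] {ι : Type*}
  [DecidableEq ι] (ω : V [⋀^ι]→ₗ[ℝ] ℝ) (B : Module.Basis ι ℝ V)

open Classical in
/-- The indicator function of an open simplicial cone, signed by the orientation. -/
noncomputable def signedIndicator (y : V) : ℤ :=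
  if ∀ i, 0 < B.coord i y then (SignType.sign (ω B) : ℤ) else 0

/-- Both sides are linear in `n` and agree on the basis. The left side does not involve `B i`, so
the contribution of a facet to a jump depends on the facet and on `n` alone, not on the opposite
generator. -/
theorem map_update_basis (i : ι) (n : V) :
    ω (Function.update B i n) = B.coord i n * ω B := by
  have : ω.toMultilinearMap.toLinearMap B i = ω B • B.coord i := by
    refine B.ext fun j => ?_
    by_cases h : j = i
    · subst h
      simp
    · simp only [MultilinearMap.toLinearMap_apply, AlternatingMap.coe_multilinearMap,
        LinearMap.smul_apply, Module.Basis.coord_apply, Module.Basis.repr_self, smul_eq_mul,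
        Finsupp.single_apply, h, if_false, mul_zero]
      exact ω.map_update_self _ (Ne.symm h)
  have := congrArg (fun l => l n) this
  simpa [mul_comm] using this

/-- The relative interior of the facet opposite to the `i`-th generator of a simplicial cone. -/
def facet (i : ι) : Set V := {y | B.coord i y = 0 ∧ ∀ j, j ≠ i → 0 < B.coord j y}

variable [FiniteDimensional ℝ V] [Fintype ι]

/-- The jump of the signed indicator function of a simplicial cone at a general point of its
boundary. -/
theorem signedIndicator_jump {y n : V}
    (hy : ∀ i j, i ≠ j → B.coord i y = 0 → B.coord j y ≠ 0)
    (hn : Transversal (Set.range B.coord) y n) :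
    ∀ᶠ η in 𝓝[>] (0 : ℝ), signedIndicator ω B (y + η • n) - signedIndicator ω B (y - η • n) =
      ∑ i, (facet B i).indicator
        (fun _ => (SignType.sign (ω (Function.update B i n)) : ℤ)) y := by
  classical
  have e2 := eventually_sign (Set.finite_range B.coord) hn.neg
  simp only [smul_neg, ← sub_eq_add_neg] at e2
  filter_upwards [eventually_sign (Set.finite_range B.coord) hn, e2] with η h1 h2
  have hp : ∀ i, 0 < B.coord i (y + η • n) ↔
      0 < if B.coord i y = 0 then B.coord i n else B.coord i y := fun i =>
    (pos_iff_pos_of_mul_pos (h1 _ ⟨i, rfl⟩))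
  have hm : ∀ i, 0 < B.coord i (y - η • n) ↔
      0 < if B.coord i y = 0 then - B.coord i n else B.coord i y := fun i => by
    have := pos_iff_pos_of_mul_pos (h2 _ ⟨i, rfl⟩)
    rwa [map_neg] at this
  simp only [signedIndicator, hp, hm]
  by_cases hz : ∃ i, B.coord i y = 0
  · obtain ⟨i, hi⟩ := hz
    have hj : ∀ j, j ≠ i → B.coord j y ≠ 0 := fun j hji => hy i j hji.symm hi
    rw [Finset.sum_eq_single i (fun j _ hji =>
      Set.indicator_of_notMem (fun h => hj j hji h.1) _) (by simp)]
    have hall : ∀ c : ℝ, (∀ k, 0 < if B.coord k y = 0 then (if k = i then c else 0)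
        else B.coord k y) ↔ 0 < c ∧ ∀ j, j ≠ i → 0 < B.coord j y := by
      intro c
      constructor
      · intro h
        refine ⟨by simpa [hi] using h i, fun j hji => ?_⟩
        have := h j
        rwa [if_neg (hj j hji)] at this
      · rintro ⟨hc, h⟩ k
        by_cases hk : k = i
        · subst hk; simpa [hi] using hc
        · rw [if_neg (hj k hk)]; exact h k hk
    have h3 : (∀ k, 0 < if B.coord k y = 0 then B.coord k n else B.coord k y) ↔
        0 < B.coord i n ∧ ∀ j, j ≠ i → 0 < B.coord j y := by
      rw [← hall]
      refine forall_congr' fun k => ?_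
      by_cases hk : k = i
      · subst hk; simp [hi]
      · rw [if_neg (hj k hk), if_neg (hj k hk)]
    have h4 : (∀ k, 0 < if B.coord k y = 0 then - B.coord k n else B.coord k y) ↔
        0 < - B.coord i n ∧ ∀ j, j ≠ i → 0 < B.coord j y := by
      rw [← hall]
      refine forall_congr' fun k => ?_
      by_cases hk : k = i
      · subst hk; simp [hi]
      · rw [if_neg (hj k hk), if_neg (hj k hk)]
    rw [if_congr h3 rfl rfl, if_congr h4 rfl rfl]
    have hni : B.coord i n ≠ 0 := hn _ ⟨i, rfl⟩ hi
    by_cases hpos : ∀ j, j ≠ i → 0 < B.coord j y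
    · have hf : y ∈ facet B i := ⟨hi, hpos⟩
      rw [Set.indicator_of_mem hf, map_update_basis, sign_mul]
      rcases hni.lt_or_gt with h | h
      · rw [if_neg fun h' => absurd h'.1 h.not_gt, if_pos ⟨neg_pos.2 h, hpos⟩, sign_neg h]
        simp
      · rw [if_pos ⟨h, hpos⟩, if_neg fun h' => absurd h'.1 (by linarith), sign_pos h]
        simp
    · have hf : y ∉ facet B i := fun h => hpos h.2
      rw [if_neg fun h => hpos h.2, if_neg fun h => hpos h.2, Set.indicator_of_notMem hf]
      simp
  · push Not at hz
    rw [Finset.sum_eq_zero fun i _ => Set.indicator_of_notMem (fun h => hz i h.1) _]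
    simp only [hz, if_false, sub_self]

end Jump

/-! ### The four facets of the cone over a join point, the direction of projection and an edge. -/

section OpenCone

variable {V : Type*} [NormedAddCommGroup V] [NormedSpace ℝ V]

/-- The open convex cone generated by three vectors. -/
def OpenCone (u v w : V) : Set V :=
  {y | ∃ α β γ : ℝ, 0 < α ∧ 0 < β ∧ 0 < γ ∧ y = α • u + β • v + γ • w}

theorem convex_openCone (u v w : V) : Convex ℝ (OpenCone u v w) := by
  rintro _ ⟨α, β, γ, hα, hβ, hγ, rfl⟩ _ ⟨α', β', γ', hα', hβ', hγ', rfl⟩ s t hs ht hst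
  have key : ∀ a b : ℝ, 0 < a → 0 < b → 0 < s * a + t * b := by
    intro a b ha hb
    rcases hs.eq_or_lt with rfl | hs
    · have : t = 1 := by linarith
      subst this; linarith
    · have := mul_pos hs ha
      have := mul_nonneg ht hb.le
      linarith
  refine ⟨_, _, _, key α α' hα hα', key β β' hβ hβ', key γ γ' hγ hγ', ?_⟩
  module

theorem openCone_subset_coneOf (u v w : V) : OpenCone u v w ⊆ coneOf {u, v, w} := by
  rintro _ ⟨α, β, γ, hα, hβ, hγ, rfl⟩
  refine add_mem_coneOf (add_mem_coneOf (smul_mem_coneOf ?_ hα.le) (smul_mem_coneOf ?_ hβ.le))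
    (smul_mem_coneOf ?_ hγ.le) <;> exact Submodule.subset_span (by simp)

theorem mem_coneOf_pair {u v y : V} :
    y ∈ coneOf {u, v} ↔ ∃ α β : ℝ, 0 ≤ α ∧ 0 ≤ β ∧ y = α • u + β • v := by
  simp only [mem_coneOf_insert, mem_coneOf_singleton]
  constructor
  · rintro ⟨α, hα, _, ⟨β, hβ, rfl⟩, rfl⟩; exact ⟨α, β, hα, hβ, rfl⟩
  · rintro ⟨α, β, hα, hβ, rfl⟩; exact ⟨α, hα, _, ⟨β, hβ, rfl⟩, rfl⟩

theorem mem_coneOf_triple {u v w y : V} :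
    y ∈ coneOf {u, v, w} ↔
      ∃ α β γ : ℝ, 0 ≤ α ∧ 0 ≤ β ∧ 0 ≤ γ ∧ y = α • u + β • v + γ • w := by
  rw [mem_coneOf_insert]
  constructor
  · rintro ⟨α, hα, x, hx, rfl⟩
    obtain ⟨β, γ, hβ, hγ, rfl⟩ := mem_coneOf_pair.1 hx
    exact ⟨α, β, γ, hα, hβ, hγ, by module⟩
  · rintro ⟨α, β, γ, hα, hβ, hγ, rfl⟩
    exact ⟨α, hα, _, mem_coneOf_pair.2 ⟨β, γ, hβ, hγ, rfl⟩, by module⟩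

theorem mem_span_pair_of_eq {u v y : V} {α β : ℝ} (h : y = α • u + β • v) :
    y ∈ Submodule.span ℝ {u, v} := Submodule.mem_span_pair.2 ⟨α, β, h.symm⟩

variable {B : Module.Basis (Fin 4) ℝ V} {q p a b : V}

theorem eq_sum_coord (hB : ⇑B = ![q, p, a, b]) (y : V) :
    y = B.coord 0 y • q + B.coord 1 y • p + B.coord 2 y • a + B.coord 3 y • b := by
  conv_lhs => rw [← B.sum_repr y]
  simp [hB, Fin.sum_univ_four]

theorem coord_apply_comb (hB : ⇑B = ![q, p, a, b]) (i : Fin 4) (c₀ c₁ c₂ c₃ : ℝ) :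
    B.coord i (c₀ • q + c₁ • p + c₂ • a + c₃ • b) = ![c₀, c₁, c₂, c₃] i := by
  have h : c₀ • q + c₁ • p + c₂ • a + c₃ • b = ∑ j, ![c₀, c₁, c₂, c₃] j • B j := by
    simp [hB, Fin.sum_univ_four]
  rw [h, B.coord_apply, B.repr_sum_self]

theorem facet_eq (hB : ⇑B = ![q, p, a, b]) (i : Fin 4) :
    facet B i = ![OpenCone p a b, OpenCone q a b, OpenCone q p b, OpenCone q p a] i := by
  ext y
  have hy := eq_sum_coord hB y
  constructor
  · rintro ⟨h, hj⟩
    fin_cases i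
    · refine ⟨_, _, _, hj 1 (by decide), hj 2 (by decide), hj 3 (by decide), ?_⟩
      rw [show B.coord 0 y = 0 from h] at hy
      simpa using hy
    · refine ⟨_, _, _, hj 0 (by decide), hj 2 (by decide), hj 3 (by decide), ?_⟩
      rw [show B.coord 1 y = 0 from h] at hy
      simpa using hy
    · refine ⟨_, _, _, hj 0 (by decide), hj 1 (by decide), hj 3 (by decide), ?_⟩
      rw [show B.coord 2 y = 0 from h] at hy
      simpa using hy
    · refine ⟨_, _, _, hj 0 (by decide), hj 1 (by decide), hj 2 (by decide), ?_⟩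
      rw [show B.coord 3 y = 0 from h] at hy
      simpa using hy
  · intro h
    fin_cases i
    · obtain ⟨α, β, γ, hα, hβ, hγ, h⟩ := h
      have : y = (0 : ℝ) • q + α • p + β • a + γ • b := by rw [h]; module
      refine ⟨by rw [this, coord_apply_comb hB]; rfl, fun j hj => ?_⟩
      rw [this, coord_apply_comb hB]
      fin_cases j <;> simp_all
    · obtain ⟨α, β, γ, hα, hβ, hγ, h⟩ := h
      have : y = α • q + (0 : ℝ) • p + β • a + γ • b := by rw [h]; module
      refine ⟨by rw [this, coord_apply_comb hB]; rfl, fun j hj => ?_⟩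
      rw [this, coord_apply_comb hB]
      fin_cases j <;> simp_all
    · obtain ⟨α, β, γ, hα, hβ, hγ, h⟩ := h
      have : y = α • q + β • p + (0 : ℝ) • a + γ • b := by rw [h]; module
      refine ⟨by rw [this, coord_apply_comb hB]; rfl, fun j hj => ?_⟩
      rw [this, coord_apply_comb hB]
      fin_cases j <;> simp_all
    · obtain ⟨α, β, γ, hα, hβ, hγ, h⟩ := h
      have : y = α • q + β • p + γ • a + (0 : ℝ) • b := by rw [h]; module
      refine ⟨by rw [this, coord_apply_comb hB]; rfl, fun j hj => ?_⟩
      rw [this, coord_apply_comb hB]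
      fin_cases j <;> simp_all

theorem coord_ne_zero_of_notMem_span (hB : ⇑B = ![q, p, a, b]) {y : V}
    (hy : ∀ v ∈ ({q, p, a, b} : Set V), ∀ w ∈ ({q, p, a, b} : Set V),
      y ∉ Submodule.span ℝ {v, w}) (i j : Fin 4) (hij : i ≠ j) (hi : B.coord i y = 0) :
    B.coord j y ≠ 0 := by
  intro hj
  have h := eq_sum_coord hB y
  have key : ∀ v ∈ ({q, p, a, b} : Set V), ∀ w ∈ ({q, p, a, b} : Set V), ∀ α β : ℝ,
      y ≠ α • v + β • w := fun v hv w hw α β h => hy v hv w hw (mem_span_pair_of_eq h)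
  fin_cases i <;> fin_cases j <;> first
    | exact absurd rfl hij
    | (simp only [Fin.mk_zero, Fin.mk_one, Fin.reduceFinMk] at hi hj
       rw [hi, hj] at h
       first
        | exact key q (by simp) p (by simp) _ _ (h.trans (by module))
        | exact key q (by simp) a (by simp) _ _ (h.trans (by module))
        | exact key q (by simp) b (by simp) _ _ (h.trans (by module))
        | exact key p (by simp) a (by simp) _ _ (h.trans (by module))
        | exact key p (by simp) b (by simp) _ _ (h.trans (by module))
        | exact key a (by simp) b (by simp) _ _ (h.trans (by module)))

variable [FiniteDimensional ℝ V] (ω : V [⋀^Fin 4]→ₗ[ℝ] ℝ)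

/-- The contribution of a fin to the jump of the signed indicator function. -/
noncomputable def finJump (p a b y n : V) : ℤ :=
  (OpenCone p a b).indicator (fun _ => (SignType.sign (ω ![n, p, a, b]) : ℤ)) y

/-- The contribution of a vertex to the jump of the signed indicator function. -/
noncomputable def vertexJump (q p v y n : V) : ℤ :=
  (OpenCone q p v).indicator (fun _ => (SignType.sign (ω ![q, p, n, v]) : ℤ)) y

/-- The facet opposite to `q` is the fin, those opposite to `a` and `b` lie in the walls over `b`
and `a`, and the one opposite to `p` lies in the join with `q` and is excluded. Bringing `n` to the
third slot in both wall terms costs a transposition in one of them; the resulting opposite signs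
make the wall terms cancel along a cycle. -/
theorem edge_jump (hB : ⇑B = ![q, p, a, b]) {y n : V}
    (hy : ∀ v ∈ ({q, p, a, b} : Set V), ∀ w ∈ ({q, p, a, b} : Set V),
      y ∉ Submodule.span ℝ {v, w}) (hqab : y ∉ OpenCone q a b)
    (hn : Transversal (Set.range B.coord) y n) :
    ∀ᶠ η in 𝓝[>] (0 : ℝ), signedIndicator ω B (y + η • n) - signedIndicator ω B (y - η • n) =
      finJump ω p a b y n + (vertexJump ω q p b y n - vertexJump ω q p a y n) := by
  filter_upwards [signedIndicator_jump ω B (coord_ne_zero_of_notMem_span hB hy) hn] with η h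
  rw [h]
  simp only [facet_eq hB, Fin.sum_univ_four]
  have h0 : Function.update (⇑B) 0 n = ![n, p, a, b] := by
    rw [hB]; ext i; fin_cases i <;> simp
  have h2 : Function.update (⇑B) 2 n = ![q, p, n, b] := by
    rw [hB]; ext i; fin_cases i <;> simp
  have h3 : ω (Function.update (⇑B) 3 n) = - ω ![q, p, n, a] := by
    rw [← ω.map_swap _ (show (2 : Fin 4) ≠ 3 by decide), hB]
    congr 1
    ext i; fin_cases i <;> simp [Equiv.swap_apply_def]
  rw [h0, h2, h3, Left.sign_neg]
  simp only [Matrix.cons_val_zero, Matrix.cons_val_one, Matrix.cons_val, finJump, vertexJump,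
    Set.indicator_of_notMem hqab, add_zero, add_assoc, SignType.coe_neg]
  have : ∀ (s : Set V) (c : ℤ), s.indicator (fun _ => -c) y = -s.indicator (fun _ => c) y := by
    intro s c
    by_cases h : y ∈ s <;> simp [h]
  rw [sub_eq_add_neg, this]

/-- Modulo two every nonzero sign is 1, so the jump counts the facets through `y`. -/
theorem edge_jump_mod_two (hω : ω B ≠ 0) (hB : ⇑B = ![q, p, a, b]) {y n : V}
    (hy : ∀ v ∈ ({q, p, a, b} : Set V), ∀ w ∈ ({q, p, a, b} : Set V),
      y ∉ Submodule.span ℝ {v, w}) (hqab : y ∉ OpenCone q a b)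
    (hn : Transversal (Set.range B.coord) y n) :
    ∀ᶠ η in 𝓝[>] (0 : ℝ),
      (signedIndicator ω B (y + η • n) : ZMod 2) - (signedIndicator ω B (y - η • n) : ZMod 2) =
      (OpenCone p a b).indicator 1 y +
        ((OpenCone q p b).indicator 1 y + (OpenCone q p a).indicator 1 y) := by
  filter_upwards [signedIndicator_jump ω B (coord_ne_zero_of_notMem_span hB hy) hn] with η h
  have hs : ∀ r : ℝ, r ≠ 0 → (((SignType.sign r : SignType) : ℤ) : ZMod 2) = 1 := by
    intro r hr
    rcases hr.lt_or_gt with h | h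
    · rw [sign_neg h]; decide
    · rw [sign_pos h]; decide
  have hterm : ∀ i, (((facet B i).indicator
      (fun _ => (SignType.sign (ω (Function.update B i n)) : ℤ)) y : ℤ) : ZMod 2) =
      (![OpenCone p a b, OpenCone q a b, OpenCone q p b, OpenCone q p a] i).indicator 1 y := by
    intro i
    rw [← facet_eq hB]
    by_cases hi : y ∈ facet B i
    · rw [Set.indicator_of_mem hi, Set.indicator_of_mem hi, Pi.one_apply]
      refine hs _ ?_
      rw [map_update_basis]
      exact mul_ne_zero (hn _ ⟨i, rfl⟩ hi.1) hω
    · rw [Set.indicator_of_notMem hi, Set.indicator_of_notMem hi, Int.cast_zero]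
  rw [← Int.cast_sub, h, Int.cast_sum]
  simp only [hterm, Fin.sum_univ_four, Matrix.cons_val_zero, Matrix.cons_val_one, Matrix.cons_val,
    Set.indicator_of_notMem hqab, add_zero, add_assoc]

end OpenCone

/-! ### Cells of a graph. -/

section Cells

variable {V : Type*}

/-- The generating sets of the cones over the cells of a graph. -/
def cells (P : Finset V) (E : Finset (V × V)) : Set (Set V) :=
  {∅} ∪ (fun v => {v}) '' (P : Set V) ∪ (fun e => {e.1, e.2}) '' (E : Set (V × V))

theorem finite_cells (P : Finset V) (E : Finset (V × V)) : (cells P E).Finite :=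
  ((Set.finite_singleton _).union (P.finite_toSet.image _)).union (E.finite_toSet.image _)

theorem forall_cells {P : Finset V} {E : Finset (V × V)} {φ : Set V → Prop} :
    (∀ s ∈ cells P E, φ s) ↔ φ ∅ ∧ (∀ v ∈ P, φ {v}) ∧ ∀ e ∈ E, φ {e.1, e.2} := by
  constructor
  · intro h
    exact ⟨h _ (Or.inl (Or.inl rfl)), fun v hv => h _ (Or.inl (Or.inr ⟨v, hv, rfl⟩)),
      fun e he => h _ (Or.inr ⟨e, he, rfl⟩)⟩
  · rintro ⟨h0, h1, h2⟩ s ((rfl | ⟨v, hv, rfl⟩) | ⟨e, he, rfl⟩)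
    exacts [h0, h1 v hv, h2 e he]

end Cells

/-! ### Graphs in general position, fins, and configurations of join points and hyperplanes. -/

section Skeleton

variable {V : Type*} [NormedAddCommGroup V] [NormedSpace ℝ V]

/-- The cone over a graph. -/
def graphCone (P : Finset V) (E : Finset (V × V)) : Set V := {y | ∃ s ∈ cells P E, y ∈ coneOf s}

/-- The join of a point and the cone over a graph. -/
def graphJoin (P : Finset V) (E : Finset (V × V)) (q : V) : Set V :=
  {y | ∃ s ∈ cells P E, y ∈ coneOf (insert q s)}

theorem mem_graphCone_of_edge {P : Finset V} {E : Finset (V × V)} {e : V × V} (he : e ∈ E)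
    {α β : ℝ} (hα : 0 ≤ α) (hβ : 0 ≤ β) : α • e.1 + β • e.2 ∈ graphCone P E :=
  ⟨_, Or.inr ⟨e, he, rfl⟩, mem_coneOf_pair.2 ⟨α, β, hα, hβ, rfl⟩⟩

theorem mem_graphCone_of_vertex {P : Finset V} {E : Finset (V × V)} {v : V} (hv : v ∈ P)
    {α : ℝ} (hα : 0 ≤ α) : α • v ∈ graphCone P E :=
  ⟨_, Or.inl (Or.inr ⟨v, hv, rfl⟩), mem_coneOf_singleton.2 ⟨α, hα, rfl⟩⟩

theorem graphCone_subset_graphJoin (P : Finset V) (E : Finset (V × V)) (q : V) :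
    graphCone P E ⊆ graphJoin P E q := fun _ ⟨s, hs, hy⟩ =>
  ⟨s, hs, mem_coneOf_insert.2 ⟨0, le_rfl, _, hy, by simp⟩⟩

/-- A graph whose cone is in general position with respect to the direction `p`. -/
structure Skeleton (V : Type*) [NormedAddCommGroup V] [NormedSpace ℝ V] where
  /-- vertices -/
  P : Finset V
  /-- oriented edges -/
  E : Finset (V × V)
  /-- the direction of projection -/
  p : V
  left_mem : ∀ e ∈ E, e.1 ∈ P
  right_mem : ∀ e ∈ E, e.2 ∈ P
  ray : ∀ v ∈ P, ∀ w ∈ P, ∀ c : ℝ, 0 < c → w = c • v → w = v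
  p_ne_zero : p ≠ 0
  indep : ∀ v ∈ P, LinearIndependent ℝ ![p, v]
  indep_edge : ∀ e ∈ E, LinearIndependent ℝ ![p, e.1, e.2]
  -- A line in the direction `p` through an interior point of an edge cone meets the cone over the
  -- graph nowhere else. Vertices may still lie above one another, which is why degrees are later
  -- summed over all vertices below a point.
  stack : ∀ e ∈ E, ∀ α β τ : ℝ, 0 < α → 0 < β → α • e.1 + β • e.2 + τ • p ∈ graphCone P E → τ = 0
  disj : ∀ e ∈ E, ∀ e' ∈ E, ∀ α β α' β' : ℝ, 0 < α → 0 < β → 0 < α' → 0 < β' →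
    α • e.1 + β • e.2 = α' • e'.1 + β' • e'.2 → e = e'
  notray : ∀ e ∈ E, ∀ v ∈ P, ∀ α β c : ℝ, 0 < α → 0 < β → 0 ≤ c → α • e.1 + β • e.2 ≠ c • v

theorem Skeleton.p_notMem_span (S : Skeleton V) :
    ∀ s ∈ cells S.P S.E, S.p ∉ Submodule.span ℝ s := by
  rw [forall_cells]
  refine ⟨?_, fun w hw h => ?_, fun e he h => ?_⟩
  · rw [Submodule.span_empty, Submodule.mem_bot]
    exact S.p_ne_zero
  · obtain ⟨r, hr⟩ := Submodule.mem_span_singleton.1 h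
    have := LinearIndependent.pair_iff.1 (S.indep w hw) (-1) r (by rw [hr]; module)
    exact absurd this.1 (by norm_num)
  · obtain ⟨r, t, hr⟩ := Submodule.mem_span_pair.1 h
    have := Fintype.linearIndependent_iff.1 (S.indep_edge e he) ![-1, r, t] (by
      simp [Fin.sum_univ_three, ← hr, add_assoc]) 0
    exact absurd this (by norm_num)

/-- `C` is cut out by inequalities `0 ≤ l y` with `l ∈ H`. -/
def CutBy (H : Set (V →ₗ[ℝ] ℝ)) (C : Set V) : Prop := ∃ H' ⊆ H, C = {y | ∀ l ∈ H', 0 ≤ l y}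

/-- Passing from `y` to a point of its star preserves all nonzero signs, so a form negative at `y`
stays negative. Consequently the complement of `C` contains the open star of each of its points. -/
theorem CutBy.of_mem_star {H : Set (V →ₗ[ℝ] ℝ)} {C : Set V} (h : CutBy H C) {y y' : V}
    (hy' : y' ∈ Star H y) (hC : y' ∈ C) : y ∈ C := by
  obtain ⟨H', hH', rfl⟩ := h
  intro l hl
  by_contra hneg
  have h1 := hy' l (hH' hl) (fun h0 => hneg (by rw [h0]))
  have h2 : 0 ≤ l y' := hC l hl
  nlinarith [not_le.1 hneg]

theorem CutBy.isClosed [FiniteDimensional ℝ V] {H : Set (V →ₗ[ℝ] ℝ)} {C : Set V}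
    (h : CutBy H C) : IsClosed C := by
  obtain ⟨H', -, rfl⟩ := h
  simp only [Set.ofPred_forall]
  exact isClosed_biInter fun l _ => isClosed_le continuous_const l.continuous_of_finiteDimensional

/-- A skeleton with points `Q` for which the joins intersect in the cone, and a hyperplane
arrangement that resolves all joins. -/
structure Config (V : Type*) [NormedAddCommGroup V] [NormedSpace ℝ V] extends Skeleton V where
  /-- join points -/
  Q : Finset V
  /-- hyperplanes -/
  H : Set (V →ₗ[ℝ] ℝ)
  /-- the basis defined by a join point, the direction of projection and an edge -/
  basis : V → V × V → Module.Basis (Fin 4) ℝ V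
  /-- equation of the hyperplane through a fin and the direction of projection -/
  side : V × V → V →ₗ[ℝ] ℝ
  generic : ∀ q ∈ Q, ∀ v ∈ P, ∀ w ∈ P, q ∉ Submodule.span ℝ {p, v, w}
  q_notMem_span : ∀ q ∈ Q, ∀ s ∈ cells P E, q ∉ Submodule.span ℝ s
  joins : ∀ y, (∀ q ∈ Q, y ∈ graphJoin P E q) → y ∈ graphCone P E
  finite_H : H.Finite
  ne_zero : ∀ l ∈ H, l ≠ 0
  cut_p : ∀ s ∈ cells P E, CutBy H (coneOf (insert p s))
  cut_q : ∀ q ∈ Q, ∀ s ∈ cells P E, CutBy H (coneOf (insert q s))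
  thin_p : ∀ y ∈ Gen H, y ∉ graphJoin P E p
  thin_q : ∀ q ∈ Q, ∀ y ∈ Gen H, y ∉ graphJoin P E q
  cut_wall : ∀ q ∈ Q, ∀ w ∈ P, CutBy H (coneOf {q, p, w})
  basis_eq : ∀ q ∈ Q, ∀ e ∈ E, ⇑(basis q e) = ![q, p, e.1, e.2]
  coord_mem : ∀ q ∈ Q, ∀ e ∈ E, ∀ i, (basis q e).coord i ∈ H
  side_mem : ∀ e ∈ E, side e ∈ H
  side_eq : ∀ e ∈ E, side e p = 0 ∧ side e e.1 = 0 ∧ side e e.2 = 0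

namespace Config

variable (D : Config V)

/-- The complement of the join with `q`. -/
def U (q : V) : Set V := (graphJoin D.P D.E q)ᶜ

theorem star_subset_U_p {y : V} (hy : y ∈ D.U D.p) : Star D.H y ⊆ D.U D.p :=
  fun _ hy' ⟨s, hs, h⟩ => hy ⟨s, hs, (D.cut_p s hs).of_mem_star hy' h⟩

theorem star_subset_U {q : V} (hq : q ∈ D.Q) {y : V} (hy : y ∈ D.U q) : Star D.H y ⊆ D.U q :=
  fun _ hy' ⟨s, hs, h⟩ => hy ⟨s, hs, (D.cut_q q hq s hs).of_mem_star hy' h⟩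

theorem isOpen_U_of [FiniteDimensional ℝ V] {q : V} (h : ∀ s ∈ cells D.P D.E, CutBy D.H (coneOf (insert q s))) :
    IsOpen (D.U q) := by
  have : graphJoin D.P D.E q = ⋃ s ∈ cells D.P D.E, coneOf (insert q s) := by
    ext; simp [graphJoin]
  rw [U, isOpen_compl_iff, this]
  exact (finite_cells _ _).isClosed_biUnion fun s hs => (h s hs).isClosed

theorem isOpen_U_p [FiniteDimensional ℝ V] : IsOpen (D.U D.p) := D.isOpen_U_of D.cut_p

theorem isOpen_U [FiniteDimensional ℝ V] {q : V} (hq : q ∈ D.Q) : IsOpen (D.U q) := D.isOpen_U_of (D.cut_q q hq)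

/-- The vertices, the join points, and the direction of projection. -/
def points : Set V := insert D.p (D.P ∪ D.Q)

/-- The planes spanned by two of the points. -/
def planes : Set (Submodule ℝ V) :=
  Set.image2 (fun v w => Submodule.span ℝ {v, w}) D.points D.points

theorem finite_planes : D.planes.Finite := by
  have : D.points.Finite := (D.P.finite_toSet.union D.Q.finite_toSet).insert _
  exact this.image2 _ this

theorem finrank_planes : ∀ B ∈ D.planes, Module.finrank ℝ B ≤ 2 := by
  classical
  rintro _ ⟨v, -, w, -, rfl⟩
  refine (finrank_span_le_card (R := ℝ) ({v, w} : Set V)).trans ?_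
  rw [Set.toFinset_card]
  simp only [Set.toFinset_singleton, Fintype.card_ofFinset]
  exact Finset.card_le_two

theorem notMem_span_pair {y : V} (hy : ∀ B ∈ D.planes, y ∉ B) {v w : V} (hv : v ∈ D.points)
    (hw : w ∈ D.points) : y ∉ Submodule.span ℝ {v, w} := hy _ ⟨v, hv, w, hw, rfl⟩

theorem p_mem_points : D.p ∈ D.points := Set.mem_insert _ _

theorem mem_points_of_mem_P {v : V} (hv : v ∈ D.P) : v ∈ D.points := Or.inr (Or.inl hv)

theorem mem_points_of_mem_Q {v : V} (hv : v ∈ D.Q) : v ∈ D.points := Or.inr (Or.inr hv)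

/-- Off the planes, the join with `p` consists of the interiors of the fins. -/
theorem mem_openCone_of_notMem_planes {y : V} (hy : ∀ B ∈ D.planes, y ∉ B) :
    ∀ s ∈ cells D.P D.E, y ∈ coneOf (insert D.p s) →
      ∃ e ∈ D.E, s = {e.1, e.2} ∧ y ∈ OpenCone D.p e.1 e.2 := by
  have hp := D.p_mem_points
  rw [forall_cells]
  refine ⟨fun h => ?_, fun v hv h => ?_, fun e he h => ⟨e, he, rfl, ?_⟩⟩
  · rw [insert_empty_eq] at h
    obtain ⟨c, -, h⟩ := mem_coneOf_singleton.1 h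
    exact absurd (mem_span_pair_of_eq (v := D.p) (β := 0) (by rw [h]; module))
      (D.notMem_span_pair hy hp hp)
  · obtain ⟨α, β, -, -, h⟩ := mem_coneOf_pair.1 h
    exact absurd (mem_span_pair_of_eq h) (D.notMem_span_pair hy hp (D.mem_points_of_mem_P hv))
  · have h1 := D.mem_points_of_mem_P (D.left_mem e he)
    have h2 := D.mem_points_of_mem_P (D.right_mem e he)
    obtain ⟨α, β, γ, hα, hβ, hγ, h⟩ := mem_coneOf_triple.1 h
    refine ⟨α, β, γ, hα.lt_of_ne ?_, hβ.lt_of_ne ?_, hγ.lt_of_ne ?_, h⟩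
    · rintro rfl
      exact D.notMem_span_pair hy h1 h2 (mem_span_pair_of_eq (h.trans (by module)))
    · rintro rfl
      exact D.notMem_span_pair hy hp h2 (mem_span_pair_of_eq (h.trans (by module)))
    · rintro rfl
      exact D.notMem_span_pair hy hp h1 (mem_span_pair_of_eq (h.trans (by module)))

theorem openCone_fin_subset {e : V × V} (he : e ∈ D.E) :
    OpenCone D.p e.1 e.2 ⊆ graphJoin D.P D.E D.p := fun _ hy =>
  ⟨_, Or.inr ⟨e, he, rfl⟩, openCone_subset_coneOf _ _ _ hy⟩

theorem openCone_join_subset {e : V × V} (he : e ∈ D.E) (q : V) :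
    OpenCone q e.1 e.2 ⊆ graphJoin D.P D.E q := fun _ hy =>
  ⟨_, Or.inr ⟨e, he, rfl⟩, openCone_subset_coneOf _ _ _ hy⟩

/-- Subtracting the `p`-components from two representations of `y` leaves two edge points above one
another. They coincide by `stack`, and then so do the edges by `disj`. -/
theorem fin_unique {e e' : V × V} (he : e ∈ D.E) (he' : e' ∈ D.E) {y : V}
    (h : y ∈ OpenCone D.p e.1 e.2) (h' : y ∈ OpenCone D.p e'.1 e'.2) : e = e' := by
  obtain ⟨α, β, γ, hα, hβ, hγ, rfl⟩ := h
  obtain ⟨α', β', γ', hα', hβ', hγ', h'⟩ := h'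
  have h1 : β • e.1 + γ • e.2 + (α - α') • D.p = β' • e'.1 + γ' • e'.2 := by
    calc β • e.1 + γ • e.2 + (α - α') • D.p
        = α • D.p + β • e.1 + γ • e.2 - α' • D.p := by module
      _ = _ := by rw [h']; module
  have h2 := D.stack e he β γ (α - α') hβ hγ
    (h1 ▸ mem_graphCone_of_edge he' hβ'.le hγ'.le)
  rw [h2, zero_smul, add_zero] at h1
  exact D.disj e he e' he' _ _ _ _ hβ hγ hβ' hγ' h1

theorem side_eq_zero {e : V × V} (he : e ∈ D.E) {y : V} (hy : y ∈ OpenCone D.p e.1 e.2) :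
    D.side e y = 0 := by
  obtain ⟨α, β, γ, -, -, -, rfl⟩ := hy
  obtain ⟨h1, h2, h3⟩ := D.side_eq e he
  simp [h1, h2, h3]

/-- An interior point of a fin is off some join. -/
theorem exists_mem_U_of_notMem {y : V} (hy : y ∉ graphCone D.P D.E) : ∃ q ∈ D.Q, y ∈ D.U q := by
  by_contra! h
  exact hy (D.joins y fun q hq => by simpa [U] using h q hq)

theorem exists_mem_U_of_fin {e : V × V} (he : e ∈ D.E) {y : V}
    (hy : y ∈ OpenCone D.p e.1 e.2) : ∃ q ∈ D.Q, y ∈ D.U q := by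
  refine D.exists_mem_U_of_notMem fun h => ?_
  obtain ⟨α, β, γ, hα, hβ, hγ, rfl⟩ := hy
  exact hα.ne' (D.stack e he β γ α hβ hγ (by convert h using 1; module))

theorem eq_of_mem_fin {e : V × V} (he : e ∈ D.E) {y : V} (hy : y ∈ OpenCone D.p e.1 e.2) :
    ∀ s ∈ cells D.P D.E, y ∈ coneOf (insert D.p s) → s = {e.1, e.2} := by
  have hv : ∀ v ∈ D.P, ∀ τ c : ℝ, 0 ≤ c → y ≠ τ • D.p + c • v := by
    obtain ⟨α, β, γ, hα, hβ, hγ, rfl⟩ := hy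
    intro v hv τ c hc h
    have h1 : β • e.1 + γ • e.2 + (α - τ) • D.p = c • v := by
      calc _ = α • D.p + β • e.1 + γ • e.2 - τ • D.p := by module
        _ = _ := by rw [h]; module
    have h2 := D.stack e he β γ _ hβ hγ (h1 ▸ mem_graphCone_of_vertex hv hc)
    rw [h2, zero_smul, add_zero] at h1
    exact D.notray e he v hv _ _ _ hβ hγ hc h1
  rw [forall_cells]
  refine ⟨fun h => ?_, fun v hvP h => ?_, fun e' he' h => ?_⟩
  · rw [insert_empty_eq] at h
    obtain ⟨c, -, h⟩ := mem_coneOf_singleton.1 h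
    exact absurd (by rw [h]; module) (hv _ (D.left_mem e he) c 0 le_rfl)
  · obtain ⟨α, β, -, hβ, h⟩ := mem_coneOf_pair.1 h
    exact absurd h (hv v hvP _ _ hβ)
  · obtain ⟨α, β, γ, hα, hβ, hγ, h⟩ := mem_coneOf_triple.1 h
    have hβ' : β ≠ 0 := by
      rintro rfl
      exact hv _ (D.right_mem e' he') α γ hγ (h.trans (by module))
    have hγ' : γ ≠ 0 := by
      rintro rfl
      exact hv _ (D.left_mem e' he') α β hβ (h.trans (by module))
    obtain ⟨α₁, β₁, γ₁, hα₁, hβ₁, hγ₁, rfl⟩ := hy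
    have h1 : β₁ • e.1 + γ₁ • e.2 + (α₁ - α) • D.p = β • e'.1 + γ • e'.2 := by
      calc _ = α₁ • D.p + β₁ • e.1 + γ₁ • e.2 - α • D.p := by module
        _ = _ := by rw [h]; module
    have h2 := D.stack e he β₁ γ₁ _ hβ₁ hγ₁ (h1 ▸ mem_graphCone_of_edge he' hβ hγ)
    rw [h2, zero_smul, add_zero] at h1
    rw [D.disj e he e' he' _ _ _ _ hβ₁ hγ₁ (hβ.lt_of_ne' hβ') (hγ.lt_of_ne' hγ') h1]

/-- Near an interior point of a fin, the join with `p` is the fin. -/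
theorem eventually_side_eq_zero [FiniteDimensional ℝ V] {e : V × V} (he : e ∈ D.E) {y : V}
    (hy : y ∈ OpenCone D.p e.1 e.2) :
    ∀ᶠ y' in 𝓝 y, y' ∈ graphJoin D.P D.E D.p → D.side e y' = 0 := by
  have h1 : ∀ s ∈ cells D.P D.E, ∀ᶠ y' in 𝓝 y, y' ∈ coneOf (insert D.p s) → D.side e y' = 0 := by
    intro s hs
    by_cases hys : y ∈ coneOf (insert D.p s)
    · obtain rfl := D.eq_of_mem_fin he hy s hs hys
      refine Eventually.of_forall fun y' h => ?_
      obtain ⟨α, β, γ, -, -, -, rfl⟩ := mem_coneOf_triple.1 h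
      obtain ⟨h1, h2, h3⟩ := D.side_eq e he
      simp [h1, h2, h3]
    · filter_upwards [(D.cut_p s hs).isClosed.isOpen_compl.mem_nhds hys] with y' h h'
      exact absurd h' h
  filter_upwards [(eventually_all_finite (finite_cells D.P D.E)).2 h1] with y' h ⟨s, hs, h'⟩
  exact h s hs h'

end Config

end Skeleton

/-! ### Jumps of the labels across the fins. -/

namespace Config

variable {V : Type*} [NormedAddCommGroup V] [NormedSpace ℝ V] (D : Config V)

/-- Labels that compare local sections over the complements of the joins. -/
structure IsLabelling (ε : V → V → ZMod 2) : Prop where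
  const : ∀ q ∈ D.Q, ∀ K : Set V, IsPreconnected K → K ⊆ D.U D.p → K ⊆ D.U q →
    ∀ a ∈ K, ∀ b ∈ K, ε q a = ε q b
  -- The sum of two labels compares the sections of `q` and `q'` with each other, and the base
  -- section drops out. So `K` may cross the fins; only `a` and `b` have to avoid them.
  const_add : ∀ q ∈ D.Q, ∀ q' ∈ D.Q, ∀ K : Set V, IsPreconnected K → K ⊆ D.U q → K ⊆ D.U q' →
    ∀ a ∈ K, a ∈ D.U D.p → ∀ b ∈ K, b ∈ D.U D.p → ε q a + ε q' a = ε q b + ε q' b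

/-- Across the fin of the edge `e` near `y`, the label changes by `s`. -/
def IsJump (ε : V → V → ZMod 2) (e : V × V) (q y : V) (s : ZMod 2) : Prop :=
  ∃ O ∈ 𝓝 y, ∀ y₁ ∈ O, ∀ y₂ ∈ O, 0 < D.side e y₁ → D.side e y₂ < 0 → ε q y₁ + ε q y₂ = s

variable {D} [FiniteDimensional ℝ V] {ε : V → V → ZMod 2}

theorem exists_side_points {e : V × V} (he : e ∈ D.E) {y : V} (hy : D.side e y = 0)
    {O : Set V} (hO : O ∈ 𝓝 y) : (∃ y₁ ∈ O, 0 < D.side e y₁) ∧ ∃ y₂ ∈ O, D.side e y₂ < 0 := by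
  obtain ⟨n, -, hn⟩ := exists_transversal D.finite_H D.ne_zero y (D.side e)
    (D.ne_zero _ (D.side_mem e he))
  have hpos : ∀ᶠ η in 𝓝[>] (0 : ℝ), 0 < η := self_mem_nhdsWithin
  obtain ⟨η, h1, hη⟩ := (((tendsto_add_smul y n).eventually_mem hO).and hpos).exists
  obtain ⟨η', h2, hη'⟩ := (((tendsto_add_smul y (-n)).eventually_mem hO).and hpos).exists
  refine ⟨⟨_, h1, ?_⟩, _, h2, ?_⟩
  · simpa [hy] using mul_pos hη hn
  · simpa [hy] using mul_pos hη' hn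

theorem IsJump.unique {e : V × V} (he : e ∈ D.E) {q y : V} (hy : D.side e y = 0) {s s' : ZMod 2}
    (h : D.IsJump ε e q y s) (h' : D.IsJump ε e q y s') : s = s' := by
  obtain ⟨O, hO, h⟩ := h
  obtain ⟨O', hO', h'⟩ := h'
  obtain ⟨⟨y₁, ⟨h1, h1'⟩, hs1⟩, y₂, ⟨h2, h2'⟩, hs2⟩ :=
    exists_side_points he hy (inter_mem hO hO')
  rw [← h y₁ h1 y₂ h2 hs1 hs2, h' y₁ h1' y₂ h2' hs1 hs2]

theorem exists_ball {e : V × V} (he : e ∈ D.E) {y : V} (hy : y ∈ OpenCone D.p e.1 e.2)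
    {W : Set V} (hW : W ∈ 𝓝 y) :
    ∃ r > 0, Metric.ball y r ⊆ W ∧ ∀ y' ∈ Metric.ball y r, D.side e y' ≠ 0 → y' ∈ D.U D.p := by
  obtain ⟨r, hr, h⟩ := Metric.mem_nhds_iff.1 (inter_mem hW (D.eventually_side_eq_zero he hy))
  exact ⟨r, hr, fun y' h' => (h h').1, fun y' h' hs hy' => hs ((h h').2 hy')⟩

/-- In a small ball around an interior point of a fin, the two open sides of the hyperplane `side e`
are convex and miss the join with `p`, so the label is constant on each. -/
theorem IsLabelling.exists_isJump (hε : D.IsLabelling ε) {e : V × V} (he : e ∈ D.E) {q y : V}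
    (hq : q ∈ D.Q) (hy : y ∈ OpenCone D.p e.1 e.2) (hyq : y ∈ D.U q) :
    ∃ s, ∀ᶠ y' in 𝓝 y, D.IsJump ε e q y' s := by
  obtain ⟨r, hr, h1, h2⟩ := exists_ball he hy ((D.isOpen_U hq).mem_nhds hyq)
  obtain ⟨⟨z₁, hz₁, hs₁⟩, z₂, hz₂, hs₂⟩ :=
    exists_side_points he (D.side_eq_zero he hy) (Metric.ball_mem_nhds y hr)
  refine ⟨ε q z₁ + ε q z₂, ?_⟩
  filter_upwards [Metric.ball_mem_nhds y hr] with y' hy'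
  refine ⟨_, Metric.isOpen_ball.mem_nhds hy', fun y₁ hy₁ y₂ hy₂ hs₁' hs₂' => ?_⟩
  have hpos : Convex ℝ (Metric.ball y r ∩ {y' | 0 < D.side e y'}) :=
    (convex_ball y r).inter ((convex_Ioi (0 : ℝ)).linear_preimage (D.side e))
  have hneg : Convex ℝ (Metric.ball y r ∩ {y' | D.side e y' < 0}) :=
    (convex_ball y r).inter ((convex_Iio (0 : ℝ)).linear_preimage (D.side e))
  rw [hε.const q hq _ hpos.isPreconnected (fun w hw => h2 w hw.1 (ne_of_gt hw.2))
      (fun w hw => h1 hw.1) y₁ ⟨hy₁, hs₁'⟩ z₁ ⟨hz₁, hs₁⟩,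
    hε.const q hq _ hneg.isPreconnected (fun w hw => h2 w hw.1 (ne_of_lt hw.2))
      (fun w hw => h1 hw.1) y₂ ⟨hy₂, hs₂'⟩ z₂ ⟨hz₂, hs₂⟩]

/-- The sum of the labels of `q` and `q'` does not change across the fin, so both labels change by
the same amount. -/
theorem IsJump.congr_point (hε : D.IsLabelling ε) {e : V × V} (he : e ∈ D.E) {q q' y : V}
    (hq : q ∈ D.Q) (hq' : q' ∈ D.Q) (hy : y ∈ OpenCone D.p e.1 e.2) (hyq : y ∈ D.U q)
    (hyq' : y ∈ D.U q') {s : ZMod 2} (h : D.IsJump ε e q y s) : D.IsJump ε e q' y s := by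
  obtain ⟨O, hO, hs⟩ := h
  obtain ⟨r, hr, h1, h2⟩ := exists_ball he hy (inter_mem hO
    (inter_mem ((D.isOpen_U hq).mem_nhds hyq) ((D.isOpen_U hq').mem_nhds hyq')))
  refine ⟨_, Metric.ball_mem_nhds y hr, fun y₁ hy₁ y₂ hy₂ hs₁ hs₂ => ?_⟩
  rw [← hs y₁ (h1 hy₁).1 y₂ (h1 hy₂).1 hs₁ hs₂]
  have h3 := hε.const_add q hq q' hq' _ (convex_ball y r).isPreconnected (fun w hw => (h1 hw).2.1)
    (fun w hw => (h1 hw).2.2) y₁ hy₁ (h2 _ hy₁ hs₁.ne') y₂ hy₂ (h2 _ hy₂ hs₂.ne)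
  generalize ε q y₁ = a₁, ε q y₂ = a₂, ε q' y₁ = a₃, ε q' y₂ = a₄ at h3 ⊢
  revert a₁ a₂ a₃ a₄
  decide

/-- The change of the labels across a fin is constant along the fin. -/
theorem IsLabelling.exists_finLabel (hε : D.IsLabelling ε) :
    ∃ c : V × V → ZMod 2, ∀ e ∈ D.E, ∀ q ∈ D.Q, ∀ y ∈ OpenCone D.p e.1 e.2, y ∈ D.U q →
      D.IsJump ε e q y (c e) := by
  have key : ∀ e ∈ D.E, ∃ c : ZMod 2, ∀ q ∈ D.Q, ∀ y ∈ OpenCone D.p e.1 e.2, y ∈ D.U q →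
      D.IsJump ε e q y c := by
    intro e he
    have hex : ∀ y ∈ OpenCone D.p e.1 e.2, ∃ s, ∀ q ∈ D.Q, y ∈ D.U q → D.IsJump ε e q y s := by
      intro y hy
      obtain ⟨q, hq, hyq⟩ := D.exists_mem_U_of_fin he hy
      obtain ⟨s, hs⟩ := hε.exists_isJump he hq hy hyq
      exact ⟨s, fun q' hq' hyq' => IsJump.congr_point hε he hq hq' hy hyq hyq' hs.self_of_nhds⟩
    choose! σ hσ using hex
    let _ : TopologicalSpace (ZMod 2) := ⊥
    have : DiscreteTopology (ZMod 2) := ⟨rfl⟩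
    have hcont : ContinuousOn σ (OpenCone D.p e.1 e.2) := by
      intro y hy
      obtain ⟨q, hq, hyq⟩ := D.exists_mem_U_of_fin he hy
      obtain ⟨s, hs⟩ := hε.exists_isJump he hq hy hyq
      have hev : ∀ᶠ y' in 𝓝[OpenCone D.p e.1 e.2] y, σ y' = s := by
        filter_upwards [mem_nhdsWithin_of_mem_nhds hs,
          mem_nhdsWithin_of_mem_nhds ((D.isOpen_U hq).mem_nhds hyq), self_mem_nhdsWithin]
          with y' h1 h2 h3
        exact (hσ y' h3 q hq h2).unique he (D.side_eq_zero he h3) h1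
      have h0 : σ y = s := hev.self_of_nhdsWithin hy
      exact Tendsto.congr' (EventuallyEq.symm hev) (h0 ▸ tendsto_const_nhds)
    have hconst := fun y hy y' hy' =>
      (convex_openCone D.p e.1 e.2).isPreconnected.constant hcont (x := y) (y := y') hy hy'
    have hy₀ : D.p + e.1 + e.2 ∈ OpenCone D.p e.1 e.2 :=
      ⟨1, 1, 1, one_pos, one_pos, one_pos, by simp⟩
    exact ⟨σ (D.p + e.1 + e.2), fun q hq y hy hyq => hconst y hy _ hy₀ ▸ hσ y hy q hq hyq⟩
  choose! c hc using key
  exact ⟨c, hc⟩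

/-- The jump of a label across a general point of a wall. -/
theorem IsLabelling.jump (hε : D.IsLabelling ε) {c : V × V → ZMod 2}
    (hc : ∀ e ∈ D.E, ∀ q ∈ D.Q, ∀ y ∈ OpenCone D.p e.1 e.2, y ∈ D.U q → D.IsJump ε e q y (c e))
    {q y n : V} (hq : q ∈ D.Q) (hyq : y ∈ D.U q) (hy : ∀ B ∈ D.planes, y ∉ B)
    (hn : Transversal D.H y n) :
    ∀ᶠ η in 𝓝[>] (0 : ℝ), ε q (y + η • n) - ε q (y - η • n) =
      ∑ e ∈ D.E, c e * (OpenCone D.p e.1 e.2).indicator 1 y := by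
  have ht : ∀ {W : Set V}, W ∈ 𝓝 y → ∀ᶠ η in 𝓝[>] (0 : ℝ), y + η • n ∈ W ∧ y - η • n ∈ W := by
    intro W hW
    filter_upwards [tendsto_add_smul y n hW, tendsto_add_smul y (-n) hW] with η h1 h2
    exact ⟨h1, by simpa [sub_eq_add_neg] using h2⟩
  by_cases hp : y ∈ D.U D.p
  · rw [Finset.sum_eq_zero fun e he => by
      have : y ∉ OpenCone D.p e.1 e.2 := fun h => hp (D.openCone_fin_subset he h)
      rw [Set.indicator_of_notMem this, mul_zero]]
    obtain ⟨r, hr, h⟩ := Metric.mem_nhds_iff.1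
      (inter_mem (D.isOpen_U_p.mem_nhds hp) ((D.isOpen_U hq).mem_nhds hyq))
    filter_upwards [ht (Metric.ball_mem_nhds y hr)] with η ⟨h1, h2⟩
    rw [hε.const q hq _ (convex_ball y r).isPreconnected (fun w hw => (h hw).1)
      (fun w hw => (h hw).2) _ h1 _ h2, sub_self]
  · rw [U, Set.mem_compl_iff, not_not] at hp
    obtain ⟨s, hs, hys⟩ := hp
    obtain ⟨e, he, -, hye⟩ := D.mem_openCone_of_notMem_planes hy s hs hys
    rw [Finset.sum_eq_single_of_mem e he fun e' he' hne => by
      have : y ∉ OpenCone D.p e'.1 e'.2 := fun h => hne (D.fin_unique he' he h hye)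
      rw [Set.indicator_of_notMem this, mul_zero], Set.indicator_of_mem hye, Pi.one_apply, mul_one]
    obtain ⟨O, hO, hjump⟩ := hc e he q hq y hye hyq
    have h0 := D.side_eq_zero he hye
    have hpos : ∀ᶠ η in 𝓝[>] (0 : ℝ), 0 < η := self_mem_nhdsWithin
    filter_upwards [ht hO, hpos] with η ⟨h1, h2⟩ hη
    have e1 : D.side e (y + η • n) = η * D.side e n := by simp [h0]
    have e2 : D.side e (y - η • n) = - (η * D.side e n) := by simp [h0]
    rw [CharTwo.sub_eq_add]
    rcases (hn _ (D.side_mem e he) h0).lt_or_gt with h | h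
    · rw [add_comm]
      refine hjump _ h2 _ h1 (e2 ▸ ?_) (e1 ▸ ?_) <;> nlinarith [mul_pos hη (neg_pos.2 h)]
    · refine hjump _ h1 _ h2 (e1 ▸ ?_) (e2 ▸ ?_) <;> nlinarith [mul_pos hη h]

end Config

/-! ### Summation by parts on a graph. -/

section Sums

variable {V : Type*} [DecidableEq V] {P : Finset V} {E : Finset (V × V)}

/-- Exchanging the sums, each edge contributes at its two endpoints. This collects the wall terms of
all edges into one term per vertex, weighted by the degree of the chain there. -/
theorem sum_degreeMod_mul (h₁ : ∀ e ∈ E, e.1 ∈ P) (h₂ : ∀ e ∈ E, e.2 ∈ P) (c : V × V → ZMod 2)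
    (φ : V → ZMod 2) :
    ∑ w ∈ P, degreeMod E c w * φ w = ∑ e ∈ E, c e * (φ e.2 + φ e.1) := by
  simp only [degreeMod, Finset.sum_mul]
  rw [Finset.sum_comm]
  refine Finset.sum_congr rfl fun e he => ?_
  simp only [mul_assoc, add_mul, ite_mul, one_mul, zero_mul]
  rw [← Finset.mul_sum, Finset.sum_add_distrib, Finset.sum_ite_eq, Finset.sum_ite_eq,
    if_pos (h₁ e he), if_pos (h₂ e he)]

theorem sum_boundary_mul (h₁ : ∀ e ∈ E, e.1 ∈ P) (h₂ : ∀ e ∈ E, e.2 ∈ P) (z : V × V → ℤ)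
    (φ : V → ℤ) :
    ∑ w ∈ P, boundary E z w * φ w = ∑ e ∈ E, z e * (φ e.2 - φ e.1) := by
  simp only [boundary, Finset.sum_mul]
  rw [Finset.sum_comm]
  refine Finset.sum_congr rfl fun e he => ?_
  simp only [mul_assoc, sub_mul, ite_mul, one_mul, zero_mul]
  rw [← Finset.mul_sum, Finset.sum_sub_distrib, Finset.sum_ite_eq, Finset.sum_ite_eq,
    if_pos (h₁ e he), if_pos (h₂ e he)]

end Sums

theorem eventually_pos_add_mul {a : ℝ} (ha : 0 < a) (x : ℝ) :
    ∀ᶠ δ in 𝓝[>] (0 : ℝ), 0 < a + δ * x := by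
  have := tendsto_add_smul a x
  exact this (lt_mem_nhds ha)

/-! ### Heights and corrected labels, and their jumps at the walls. -/

namespace Config

variable {V : Type*} [NormedAddCommGroup V] [NormedSpace ℝ V] {D : Config V}
  {ε : V → V → ZMod 2} (ω : V [⋀^Fin 4]→ₗ[ℝ] ℝ)

variable (D) in
/-- The integral height function of a chain with respect to a join point. -/
noncomputable def height (z : V × V → ℤ) (q y : V) : ℤ :=
  ∑ e ∈ D.E, z e * signedIndicator ω (D.basis q e) y

variable (D) in
/-- The label corrected by the height modulo two. -/
noncomputable def corrected (ε : V → V → ZMod 2) (c : V × V → ZMod 2) (q y : V) : ZMod 2 :=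
  ε q y + ∑ e ∈ D.E, c e * (signedIndicator ω (D.basis q e) y : ZMod 2)

/-- The open planar cone of the points above the ray of `w`. -/
def shadow (p w : V) : Set V := {y | ∃ β γ : ℝ, 0 < β ∧ 0 < γ ∧ y = β • p + γ • w}

theorem signedIndicator_eq_of_mem_star {q : V} (hq : q ∈ D.Q) {e : V × V} (he : e ∈ D.E)
    {y y' : V} (hy : y ∈ Gen D.H) (hy' : y' ∈ Star D.H y) :
    signedIndicator ω (D.basis q e) y' = signedIndicator ω (D.basis q e) y := by
  have : ∀ i, 0 < (D.basis q e).coord i y' ↔ 0 < (D.basis q e).coord i y := fun i =>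
    (pos_iff_pos_of_mul_pos (hy' _ (D.coord_mem q hq e he i) (hy _ (D.coord_mem q hq e he i)))).symm
  rw [signedIndicator, signedIndicator]
  by_cases h : ∀ i, 0 < (D.basis q e).coord i y
  · rw [if_pos h, if_pos fun i => (this i).2 (h i)]
  · rw [if_neg h, if_neg fun h' => h fun i => (this i).1 (h' i)]

theorem height_eq_of_mem_star (z : V × V → ℤ) {q : V} (hq : q ∈ D.Q)
    {y y' : V} (hy : y ∈ Gen D.H) (hy' : y' ∈ Star D.H y) :
    D.height ω z q y' = D.height ω z q y :=
  Finset.sum_congr rfl fun e he => by rw [signedIndicator_eq_of_mem_star ω hq he hy hy']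

theorem IsLabelling.eq_of_mem_star (hε : D.IsLabelling ε) {q : V} (hq : q ∈ D.Q) {y y' : V}
    (hy : y ∈ Gen D.H) (hy' : y' ∈ Star D.H y) : ε q y' = ε q y :=
  hε.const q hq _ (convex_star y).isPreconnected (D.star_subset_U_p (D.thin_p y hy))
    (D.star_subset_U hq (D.thin_q q hq y hy)) _ hy' _ (mem_star_self y)

theorem IsLabelling.corrected_eq_of_mem_star (hε : D.IsLabelling ε) (c : V × V → ZMod 2) {q : V}
    (hq : q ∈ D.Q) {y y' : V} (hy : y ∈ Gen D.H) (hy' : y' ∈ Star D.H y) :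
    D.corrected ω ε c q y' = D.corrected ω ε c q y := by
  rw [corrected, corrected, hε.eq_of_mem_star hq hy hy']
  congr 1
  exact Finset.sum_congr rfl fun e he => by rw [signedIndicator_eq_of_mem_star ω hq he hy hy']

theorem notMem_span_of_edge {y : V} (hy : ∀ B ∈ D.planes, y ∉ B) {q : V} (hq : q ∈ D.Q)
    {e : V × V} (he : e ∈ D.E) : ∀ v ∈ ({q, D.p, e.1, e.2} : Set V),
      ∀ w ∈ ({q, D.p, e.1, e.2} : Set V), y ∉ Submodule.span ℝ {v, w} := by
  have key : ∀ v ∈ ({q, D.p, e.1, e.2} : Set V), v ∈ D.points := by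
    rintro v (rfl | rfl | rfl | rfl)
    exacts [D.mem_points_of_mem_Q hq, D.p_mem_points, D.mem_points_of_mem_P (D.left_mem e he),
      D.mem_points_of_mem_P (D.right_mem e he)]
  exact fun v hv w hw => D.notMem_span_pair hy (key v hv) (key w hw)

theorem transversal_coord {y n : V} (hn : Transversal D.H y n) {q : V} (hq : q ∈ D.Q)
    {e : V × V} (he : e ∈ D.E) : Transversal (Set.range (D.basis q e).coord) y n := by
  rintro _ ⟨i, rfl⟩
  exact hn _ (D.coord_mem q hq e he i)

theorem finrank_eq (D : Config V) : Module.finrank ℝ V = 4 := by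
  simpa using Module.finrank_eq_card_basis (D.basis 0 (0, 0))

/-- A wall through `q` and the direction of projection that contains a point above `w₀` is the wall
of a vertex below that point. -/
theorem mem_shadow_of_mem_wall {y q w w₀ : V} (hq : q ∈ D.Q) (hw : w ∈ D.P) (hw₀ : w₀ ∈ D.P)
    (hy₀ : y ∈ shadow D.p w₀) (hy : y ∉ graphCone D.P D.E) (hyw : y ∈ coneOf {q, D.p, w}) :
    y ∈ shadow D.p w := by
  obtain ⟨β, γ, hβ, hγ, h₀⟩ := hy₀
  obtain ⟨α', β', γ', hα', hβ', hγ', h⟩ := mem_coneOf_triple.1 hyw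
  have hα : α' = 0 := by
    by_contra hne
    refine D.generic q hq w₀ hw₀ w hw ((Submodule.smul_mem_iff _ hne).1 ?_)
    refine Submodule.mem_span_triple.2 ⟨β - β', γ, -γ', ?_⟩
    calc _ = (β • D.p + γ • w₀) - β' • D.p - γ' • w := by module
      _ = _ := by rw [← h₀, h]; module
  subst hα
  rw [zero_smul, zero_add] at h
  refine ⟨β', γ', hβ'.lt_of_ne ?_, hγ'.lt_of_ne ?_, h⟩
  · rintro rfl
    rw [zero_smul, zero_add] at h
    exact hy (h ▸ mem_graphCone_of_vertex hw hγ')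
  · rintro rfl
    have h1 : (β - β') • D.p + γ • w₀ = 0 := by
      calc _ = (β • D.p + γ • w₀) - (β' • D.p + (0 : ℝ) • w) := by module
        _ = 0 := by rw [← h₀, ← h, sub_self]
    exact hγ.ne' (LinearIndependent.pair_iff.1 (D.indep w₀ hw₀) _ _ h1).2

/-- Lying above both `w` and `w₀`, the point `y` makes `w` a combination of `p` and `w₀`, so the
walls of `w` and of `w₀` span the same hyperplane. -/
theorem openCone_subset_of_mem_shadow {y q w w₀ : V} (hy₀ : y ∈ shadow D.p w₀)
    (hy : y ∈ shadow D.p w) : OpenCone q D.p w ⊆ Submodule.span ℝ {q, D.p, w₀} := by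
  obtain ⟨β, γ, hβ, hγ, h₀⟩ := hy₀
  obtain ⟨β', γ', hβ', hγ', h⟩ := hy
  rintro _ ⟨a, b, c, -, -, -, rfl⟩
  refine Submodule.mem_span_triple.2 ⟨a, b + c * (β - β') / γ', c * γ / γ', ?_⟩
  have h1 : γ' • w = (β • D.p + γ • w₀) - β' • D.p := by rw [← h₀, h]; module
  have h2 : w = γ'⁻¹ • ((β • D.p + γ • w₀) - β' • D.p) := by
    rw [← h1, inv_smul_smul₀ hγ'.ne']
  rw [h2]
  module

theorem finrank_planes_lt (D : Config V) : ∀ B ∈ D.planes, Module.finrank ℝ B + 1 < Module.finrank ℝ V := by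
  intro B hB
  have := D.finrank_planes B hB
  rw [D.finrank_eq]
  omega

variable [FiniteDimensional ℝ V]

/-- The jump of the height function of a cycle does not depend on the join point. -/
theorem height_jump [DecidableEq V] {z : V × V → ℤ} (hz : ∀ v, boundary D.E z v = 0) {q y n : V}
    (hq : q ∈ D.Q) (hyq : y ∈ D.U q) (hy : ∀ B ∈ D.planes, y ∉ B) (hn : Transversal D.H y n) :
    ∀ᶠ η in 𝓝[>] (0 : ℝ), D.height ω z q (y + η • n) - D.height ω z q (y - η • n) =
      ∑ e ∈ D.E, z e * finJump ω D.p e.1 e.2 y n := by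
  have h : ∀ e ∈ D.E, _ := fun e he => edge_jump ω (D.basis_eq q hq e he)
    (notMem_span_of_edge hy hq he) (fun h => hyq (D.openCone_join_subset he q h))
    (transversal_coord hn hq he)
  filter_upwards [(eventually_all_finset _).2 h] with η h
  rw [height, height, ← Finset.sum_sub_distrib]
  have h1 := sum_boundary_mul D.left_mem D.right_mem z fun v => vertexJump ω q D.p v y n
  simp only [hz, zero_mul, Finset.sum_const_zero] at h1
  rw [← add_zero (∑ e ∈ D.E, _ * finJump _ _ _ _ _ _), h1, ← Finset.sum_add_distrib]
  refine Finset.sum_congr rfl fun e he => ?_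
  rw [← mul_sub, h e he, mul_add]

/-- The jump of the corrected label across a general point of a wall. -/
theorem IsLabelling.corrected_jump [DecidableEq V] (hω : ω ≠ 0) (hε : D.IsLabelling ε)
    {c : V × V → ZMod 2}
    (hc : ∀ e ∈ D.E, ∀ q ∈ D.Q, ∀ y ∈ OpenCone D.p e.1 e.2, y ∈ D.U q → D.IsJump ε e q y (c e))
    {q y n : V} (hq : q ∈ D.Q) (hyq : y ∈ D.U q) (hy : ∀ B ∈ D.planes, y ∉ B)
    (hn : Transversal D.H y n) :
    ∀ᶠ η in 𝓝[>] (0 : ℝ),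
      D.corrected ω ε c q (y + η • n) - D.corrected ω ε c q (y - η • n) =
        ∑ w ∈ D.P, degreeMod D.E c w * (OpenCone q D.p w).indicator 1 y := by
  have h : ∀ e ∈ D.E, _ := fun e he => edge_jump_mod_two ω
    ((ω.map_basis_ne_zero_iff (D.basis q e)).2 hω) (D.basis_eq q hq e he)
    (notMem_span_of_edge hy hq he) (fun h => hyq (D.openCone_join_subset he q h))
    (transversal_coord hn hq he)
  filter_upwards [(eventually_all_finset _).2 h, hε.jump hc hq hyq hy hn] with η h h'
  rw [sum_degreeMod_mul D.left_mem D.right_mem c fun w => (OpenCone q D.p w).indicator 1 y,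
    corrected, corrected, add_sub_add_comm, h', ← Finset.sum_sub_distrib, ← Finset.sum_add_distrib]
  refine Finset.sum_congr rfl fun e he => ?_
  rw [← mul_sub, h e he, ← mul_add, ← add_assoc, CharTwo.add_self_eq_zero, zero_add]

/-- The direction `d` has positive `q`-component. From `y` it leads into exactly those walls through
`q` and `p` whose edge contains `y`, while `-d` leads out of all of them; genericity of `q` excludes
any other wall. -/
theorem eventually_mem_openCone_iff {y q w w₀ d : V} {d₁ d₂ d₃ : ℝ} (hd : 0 < d₁)
    (hde : d = d₁ • q + d₂ • D.p + d₃ • w₀)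
    (hq : q ∈ D.Q) (hw : w ∈ D.P) (hw₀ : w₀ ∈ D.P)
    (hy₀ : y ∈ shadow D.p w₀) (hy : y ∉ graphCone D.P D.E) :
    ∀ᶠ δ in 𝓝[>] (0 : ℝ), (y + δ • d ∈ OpenCone q D.p w ↔ y ∈ shadow D.p w) ∧
      y - δ • d ∉ OpenCone q D.p w := by
  have hpos : ∀ᶠ δ in 𝓝[>] (0 : ℝ), 0 < δ := self_mem_nhdsWithin
  have hstar := (tendsto_add_smul y d).eventually_mem
    ((isOpen_star D.finite_H y).mem_nhds (mem_star_self y))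
  obtain ⟨β, γ, hβ, hγ, h₀⟩ := id hy₀
  refine Eventually.and ?_ ?_
  · by_cases hyw : y ∈ shadow D.p w
    · obtain ⟨β', γ', hβ', hγ', h⟩ := id hyw
      filter_upwards [hpos, eventually_pos_add_mul hβ' (d₂ + d₃ * (β' - β) / γ),
        eventually_pos_add_mul hγ' (d₃ * γ' / γ)] with δ h1 h2 h3
      refine iff_of_true ⟨δ * d₁, _, _, mul_pos h1 hd, h2, h3, ?_⟩ hyw
      have h4 : w₀ = γ⁻¹ • ((β' • D.p + γ' • w) - β • D.p) := by
        rw [← h, h₀, add_sub_cancel_left, inv_smul_smul₀ hγ.ne']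
      rw [hde, h4, h]
      module
    · filter_upwards [hstar] with δ h1
      refine iff_of_false (fun h2 => hyw (mem_shadow_of_mem_wall hq hw hw₀ hy₀ hy ?_)) hyw
      exact (D.cut_wall q hq w hw).of_mem_star h1 (openCone_subset_coneOf _ _ _ h2)
  · filter_upwards [hpos] with δ hδ
    rintro ⟨a, b, c, ha, hb, hc, h⟩
    have hne : a + δ * d₁ ≠ 0 := by have := mul_pos hδ hd; positivity
    refine D.generic q hq w₀ hw₀ w hw ((Submodule.smul_mem_iff _ hne).1 ?_)
    refine Submodule.mem_span_triple.2 ⟨β - b - δ * d₂, γ - δ * d₃, -c, ?_⟩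
    calc _ = (β • D.p + γ • w₀) - δ • (d₁ • q + d₂ • D.p + d₃ • w₀) + (δ * d₁) • q
          - b • D.p - c • w := by module
      _ = _ := by rw [← h₀, ← hde, h]; module

/-- In the open star of a point above `w₀`, the corrected label is constant on either side of the
wall of `w₀`. -/
theorem IsLabelling.corrected_eq_of_side [DecidableEq V] (hω : ω ≠ 0) (hε : D.IsLabelling ε)
    {c : V × V → ZMod 2}
    (hc : ∀ e ∈ D.E, ∀ q ∈ D.Q, ∀ y ∈ OpenCone D.p e.1 e.2, y ∈ D.U q → D.IsJump ε e q y (c e))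
    {q y w₀ : V} (hq : q ∈ D.Q) (hyq : y ∈ D.U q) (hw₀ : w₀ ∈ D.P)
    (hy₀ : y ∈ shadow D.p w₀) (hy : y ∉ graphCone D.P D.E) (k : V →ₗ[ℝ] ℝ)
    (hk : ∀ v ∈ Submodule.span ℝ {q, D.p, w₀}, k v = 0) {y₁ y₂ : V} (h₁ : y₁ ∈ Star D.H y)
    (h₁' : y₁ ∈ Gen D.H) (hk₁ : 0 < k y₁) (h₂ : y₂ ∈ Star D.H y) (h₂' : y₂ ∈ Gen D.H)
    (hk₂ : 0 < k y₂) : D.corrected ω ε c q y₁ = D.corrected ω ε c q y₂ := by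
  refine gallery (O := Star D.H y ∩ {v | 0 < k v}) D.finite_H
    ((isOpen_star D.finite_H y).inter
      (isOpen_lt continuous_const k.continuous_of_finiteDimensional))
    ((convex_star y).inter ((convex_Ioi (0 : ℝ)).linear_preimage k)) D.finite_planes
    D.finrank_planes_lt (fun z hz z' hz' => hε.corrected_eq_of_mem_star ω c hq hz.2 hz'.2)
    (fun z hz hzp n hn => ?_) ⟨h₁, hk₁⟩ h₁' ⟨h₂, hk₂⟩ h₂'
  filter_upwards [hε.corrected_jump ω hω hc hq (D.star_subset_U hq hyq hz.1) hzp hn] with η h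
  rw [← sub_eq_zero, h]
  refine Finset.sum_eq_zero fun w hw => ?_
  have : z ∉ OpenCone q D.p w := by
    intro hzw
    have h1 := mem_shadow_of_mem_wall hq hw hw₀ hy₀ hy
      ((D.cut_wall q hq w hw).of_mem_star hz.1 (openCone_subset_coneOf _ _ _ hzw))
    have h2 := hk z (openCone_subset_of_mem_shadow hy₀ h1 hzw)
    exact absurd hz.2 (by rw [Set.mem_ofPred_eq, h2]; exact lt_irrefl _)
  rw [Set.indicator_of_notMem this, mul_zero]

end Config

/-! ### The fin labels form a cycle; integral heights. -/

namespace Config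

theorem finrank_wall {V : Type*} [NormedAddCommGroup V] [NormedSpace ℝ V] {D : Config V} {q w₀ : V} (hq : q ∈ D.Q) (hw₀ : w₀ ∈ D.P) :
    Module.finrank ℝ (Submodule.span ℝ {q, D.p, w₀}) = 3 := by
  have h2 : Set.range ![D.p, w₀] = {D.p, w₀} := by
    ext x; simp; tauto
  have h3 : Set.range ![q, D.p, w₀] = {q, D.p, w₀} := by
    ext x; simp; tauto
  have h : LinearIndependent ℝ ![q, D.p, w₀] := by
    refine (D.indep w₀ hw₀).finCons ?_
    rw [h2]
    simpa using D.generic q hq w₀ hw₀ w₀ hw₀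
  have := finrank_span_eq_card h
  rwa [h3, Fintype.card_fin] at this

variable {V : Type*} [NormedAddCommGroup V] [NormedSpace ℝ V] [FiniteDimensional ℝ V]
  {D : Config V} {ε : V → V → ZMod 2} (ω : V [⋀^Fin 4]→ₗ[ℝ] ℝ) [DecidableEq V]

/-- The degrees of the vertices below a point outside the cone sum up to zero. -/
theorem IsLabelling.sum_degreeMod_eq_zero (hω : ω ≠ 0) (hε : D.IsLabelling ε)
    {c : V × V → ZMod 2}
    (hc : ∀ e ∈ D.E, ∀ q ∈ D.Q, ∀ y ∈ OpenCone D.p e.1 e.2, y ∈ D.U q → D.IsJump ε e q y (c e))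
    {y : V} (hy : y ∉ graphCone D.P D.E) :
    ∑ w ∈ D.P, degreeMod D.E c w * (shadow D.p w).indicator 1 y = 0 := by
  by_cases hex : ∃ w₀ ∈ D.P, y ∈ shadow D.p w₀
  swap
  · push Not at hex
    exact Finset.sum_eq_zero fun w hw => by rw [Set.indicator_of_notMem (hex w hw), mul_zero]
  obtain ⟨w₀, hw₀, hy₀⟩ := hex
  obtain ⟨q, hq, hyq⟩ := D.exists_mem_U_of_notMem hy
  -- A small loop around the plane of `p` and `w₀` crosses the hyperplane `K` near `y + δ • d` and
  -- near `y - δ • d`. On either side of `K` within the star the corrected label is constant, so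
  -- both crossings have the same jump. At the first it is the wanted sum of degrees, at the second
  -- it is zero.
  set K := Submodule.span ℝ {q, D.p, w₀} with hK
  have hK3 : Module.finrank ℝ K = 3 := finrank_wall hq hw₀
  obtain ⟨d, hdK, hd⟩ : ∃ d ∈ K, ∀ S ∈ D.planes, d ∉ S :=
    exists_mem_forall_notMem K D.finite_planes fun S hS hKS => by
      have := Submodule.finrank_mono hKS
      have := D.finrank_planes S hS
      omega
  obtain ⟨d, d₁, d₂, d₃, hd₁, hde, hd⟩ : ∃ d : V, ∃ d₁ d₂ d₃ : ℝ, 0 < d₁ ∧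
      d = d₁ • q + d₂ • D.p + d₃ • w₀ ∧ ∀ S ∈ D.planes, d ∉ S := by
    obtain ⟨d₁, d₂, d₃, hde⟩ := Submodule.mem_span_triple.1 hdK
    rcases lt_trichotomy d₁ 0 with h | rfl | h
    · exact ⟨-d, -d₁, -d₂, -d₃, neg_pos.2 h, by rw [← hde]; module,
        fun S hS h => hd S hS (S.neg_mem_iff.1 h)⟩
    · exact absurd (mem_span_pair_of_eq (by rw [← hde]; module))
        (D.notMem_span_pair hd D.p_mem_points (D.mem_points_of_mem_P hw₀))
    · exact ⟨d, d₁, d₂, d₃, h, hde.symm, hd⟩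
  have hdK : d ∈ K := Submodule.mem_span_triple.2 ⟨_, _, _, hde.symm⟩
  have hyK : y ∈ K := by
    obtain ⟨β, γ, -, -, h⟩ := hy₀
    exact Submodule.mem_span_triple.2 ⟨0, β, γ, by rw [h]; module⟩
  obtain ⟨k, hk0, hk⟩ := Submodule.exists_le_ker_of_lt_top K (lt_top_iff_ne_top.2 fun h => by
    rw [h, finrank_top, D.finrank_eq] at hK3; omega)
  replace hk : ∀ v ∈ K, k v = 0 := fun v hv => hk hv
  have hstar := (isOpen_star D.finite_H y).mem_nhds (mem_star_self y)
  have hgood : ∀ᶠ δ in 𝓝[>] (0 : ℝ), ∀ w ∈ D.P, _ := (eventually_all_finset _).2 fun w hw =>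
    eventually_mem_openCone_iff hd₁ hde hq hw hw₀ hy₀ hy
  have hpl : ∀ᶠ δ in 𝓝[>] (0 : ℝ), ∀ S ∈ D.planes, y + δ • d ∉ S :=
    (eventually_all_finite D.finite_planes).2 fun S hS => eventually_add_smul_notMem (hd S hS) y
  have hpl' : ∀ᶠ δ in 𝓝[>] (0 : ℝ), ∀ S ∈ D.planes, y + δ • -d ∉ S :=
    (eventually_all_finite D.finite_planes).2 fun S hS =>
      eventually_add_smul_notMem (fun h => hd S hS (S.neg_mem_iff.1 h)) y
  obtain ⟨δ, hgood, hpl, hpl', hs, hs'⟩ := (hgood.and (hpl.and (hpl'.and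
    (((tendsto_add_smul y d).eventually_mem hstar).and
      ((tendsto_add_smul y (-d)).eventually_mem hstar))))).exists
  have key : ∀ x ∈ K, x ∈ Star D.H y → (∀ S ∈ D.planes, x ∉ S) → ∃ x₁ x₂,
      x₁ ∈ Star D.H y ∧ x₁ ∈ Gen D.H ∧ 0 < k x₁ ∧ x₂ ∈ Star D.H y ∧ x₂ ∈ Gen D.H ∧ k x₂ < 0 ∧
      D.corrected ω ε c q x₁ - D.corrected ω ε c q x₂ =
        ∑ w ∈ D.P, degreeMod D.E c w * (OpenCone q D.p w).indicator 1 x := by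
    intro x hxK hxS hxp
    obtain ⟨n, hn, hkn⟩ := exists_transversal D.finite_H D.ne_zero x k hk0
    have hpos : ∀ᶠ η in 𝓝[>] (0 : ℝ), 0 < η := self_mem_nhdsWithin
    have hst := (isOpen_star D.finite_H y).mem_nhds hxS
    obtain ⟨η, hη, h1, h2, h3, h4, h5⟩ := (hpos.and
      (((tendsto_add_smul x n).eventually_mem hst).and ((eventually_gen D.finite_H hn).and
      (((tendsto_add_smul x (-n)).eventually_mem hst).and ((eventually_gen D.finite_H hn.neg).and
      (hε.corrected_jump ω hω hc hq (D.star_subset_U hq hyq hxS) hxp hn)))))).exists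
    have hx0 := hk x hxK
    refine ⟨_, _, h1, h2, ?_, h3, h4, ?_, ?_⟩
    · simpa [hx0] using mul_pos hη hkn
    · simpa [hx0] using mul_pos hη hkn
    · rw [← h5, smul_neg, ← sub_eq_add_neg]
  obtain ⟨x₁, x₂, a1, a2, a3, a4, a5, a6, a7⟩ := key _ (K.add_mem hyK (K.smul_mem δ hdK)) hs hpl
  obtain ⟨x₁', x₂', b1, b2, b3, b4, b5, b6, b7⟩ :=
    key _ (K.add_mem hyK (K.smul_mem δ (K.neg_mem hdK))) hs' hpl'
  have e1 := hε.corrected_eq_of_side ω hω hc hq hyq hw₀ hy₀ hy k hk a1 a2 a3 b1 b2 b3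
  have e2 := hε.corrected_eq_of_side ω hω hc hq hyq hw₀ hy₀ hy (-k)
    (fun v hv => by simp [hk v hv]) a4 a5 (by simpa using a6) b4 b5 (by simpa using b6)
  rw [e1, e2, b7] at a7
  rw [Finset.sum_eq_zero (s := D.P) (f := fun w => degreeMod D.E c w *
    (OpenCone q D.p w).indicator 1 (y + δ • -d))] at a7
  · rw [a7]
    refine Finset.sum_congr rfl fun w hw => ?_
    congr 1
    exact Set.indicator_const_eq_indicator_const (hgood w hw).1.symm
  · intro w hw
    have : y + δ • -d ∉ OpenCone q D.p w := by
      rw [smul_neg, ← sub_eq_add_neg]; exact (hgood w hw).2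
    rw [Set.indicator_of_notMem this, mul_zero]

/-- The fin labels form a cycle modulo two. -/
theorem IsLabelling.degreeMod_eq_zero (hω : ω ≠ 0) (hε : D.IsLabelling ε)
    {c : V × V → ZMod 2}
    (hc : ∀ e ∈ D.E, ∀ q ∈ D.Q, ∀ y ∈ OpenCone D.p e.1 e.2, y ∈ D.U q → D.IsJump ε e q y (c e))
    (v : V) : degreeMod D.E c v = 0 := by
  by_cases hv : v ∈ D.P
  swap
  · refine Finset.sum_eq_zero fun e he => ?_
    rw [if_neg (fun h : e.2 = v => hv (h ▸ D.right_mem e he)),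
      if_neg (fun h : e.1 = v => hv (h ▸ D.left_mem e he))]
    simp
  have hpv := LinearIndependent.pair_iff.1 (D.indep v hv)
  -- Slightly above and slightly below `v` the points lie outside the cone and over the same
  -- vertices, except that only the upper one lies over `v`. Comparing the two vanishing sums of
  -- degrees isolates the degree of `v`.
  have hout : ∀ d : V, (d = D.p ∨ d = -D.p) → ∀ᶠ δ in 𝓝[>] (0 : ℝ),
      v + δ • d ∉ graphCone D.P D.E := by
    intro d hd
    have h : ∀ s ∈ cells D.P D.E, ∀ᶠ δ in 𝓝[>] (0 : ℝ), v + δ • d ∉ coneOf s := by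
      intro s hs
      have h1 : d ∉ Submodule.span ℝ s := by
        have h2 := D.p_notMem_span s hs
        rcases hd with rfl | rfl
        · exact h2
        · rwa [Submodule.neg_mem_iff]
      filter_upwards [eventually_add_smul_notMem h1 v] with δ h3 h4
      exact h3 (coneOf_subset_span _ h4)
    filter_upwards [(eventually_all_finite (finite_cells D.P D.E)).2 h] with δ h3 ⟨s, hs, h4⟩
    exact h3 s hs h4
  have hsame : ∀ w ∈ D.P, w ≠ v → ∀ᶠ δ in 𝓝[>] (0 : ℝ),
      (v + δ • D.p ∈ shadow D.p w ↔ v + δ • -D.p ∈ shadow D.p w) := by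
    intro w hw hne
    have hpw := LinearIndependent.pair_iff.1 (D.indep w hw)
    by_cases hspan : ∃ β γ : ℝ, 0 < γ ∧ v = β • D.p + γ • w
    · obtain ⟨β, γ, hγ, h⟩ := hspan
      have hβ : β ≠ 0 := by
        rintro rfl
        exact hne (D.ray w hw v hv γ hγ (by rw [h]; module)).symm
      rcases hβ.lt_or_gt with hβ | hβ
      · have hno : ∀ t : ℝ, β + t < 0 → v + t • D.p ∉ shadow D.p w := by
          rintro t ht ⟨b, g, hb, hg, h'⟩
          have := hpw (β + t - b) (γ - g) (by
            calc _ = (β • D.p + γ • w) + t • D.p - (b • D.p + g • w) := by module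
              _ = 0 := by rw [← h, ← h', sub_self])
          linarith [this.1]
        have hpos : ∀ᶠ η in 𝓝[>] (0 : ℝ), 0 < η := self_mem_nhdsWithin
        filter_upwards [hpos, eventually_pos_add_mul (neg_pos.2 hβ) (-1)] with δ h1 h2
        refine iff_of_false (hno δ (by linarith)) ?_
        rw [smul_neg, ← neg_smul]
        exact hno _ (by linarith)
      · have hpos : ∀ᶠ η in 𝓝[>] (0 : ℝ), 0 < η := self_mem_nhdsWithin
        filter_upwards [hpos, eventually_pos_add_mul hβ (-1)] with δ h1 h2
        exact iff_of_true ⟨β + δ, γ, by linarith, hγ, by rw [h]; module⟩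
          ⟨β - δ, γ, by linarith, hγ, by rw [h]; module⟩
    · refine Eventually.of_forall fun δ => iff_of_false ?_ ?_ <;> rintro ⟨b, g, -, hg, h⟩
      · refine hspan ⟨b - δ, g, hg, ?_⟩
        calc v = (v + δ • D.p) - δ • D.p := by module
          _ = _ := by rw [h]; module
      · refine hspan ⟨b + δ, g, hg, ?_⟩
        calc v = (v + δ • -D.p) + δ • D.p := by module
          _ = _ := by rw [h]; module
  have hpos : ∀ᶠ η in 𝓝[>] (0 : ℝ), 0 < η := self_mem_nhdsWithin
  have hsame' : ∀ᶠ δ in 𝓝[>] (0 : ℝ), ∀ w ∈ D.P, w ≠ v → _ :=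
    (eventually_all_finset _).2 fun w hw => eventually_imp_distrib_left.2 (hsame w hw)
  obtain ⟨δ, hδ, h1, h2, h3⟩ := (hpos.and ((hout _ (Or.inl rfl)).and
    ((hout _ (Or.inr rfl)).and hsame'))).exists
  have s1 := hε.sum_degreeMod_eq_zero ω hω hc h1
  have s2 := hε.sum_degreeMod_eq_zero ω hω hc h2
  have hv1 : v + δ • D.p ∈ shadow D.p v := ⟨δ, 1, hδ, one_pos, by module⟩
  have hv2 : v + δ • -D.p ∉ shadow D.p v := by
    rintro ⟨b, g, hb, -, h⟩
    have := hpv (-δ - b) (1 - g) (by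
      calc _ = (v + δ • -D.p) - (b • D.p + g • v) := by module
        _ = 0 := by rw [← h, sub_self])
    linarith [this.1]
  rw [← Finset.add_sum_erase _ _ hv] at s1 s2
  rw [Set.indicator_of_mem hv1, Pi.one_apply, mul_one] at s1
  rw [Set.indicator_of_notMem hv2, mul_zero, zero_add] at s2
  have s3 : ∑ w ∈ D.P.erase v, degreeMod D.E c w * (shadow D.p w).indicator 1 (v + δ • D.p) =
      ∑ w ∈ D.P.erase v, degreeMod D.E c w * (shadow D.p w).indicator 1 (v + δ • -D.p) :=
    Finset.sum_congr rfl fun w hw => congrArg (degreeMod D.E c w * ·)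
      (Set.indicator_const_eq_indicator_const
        (h3 w (Finset.mem_of_mem_erase hw) (Finset.ne_of_mem_erase hw)))
  rw [s3, s2, add_zero] at s1
  exact s1

/-- Integral height functions that lift the labels. -/
theorem IsLabelling.exists_height (hω : ω ≠ 0) (hε : D.IsLabelling ε) :
    ∃ N : V → V → ℤ,
      (∀ q ∈ D.Q, ∀ y ∈ Gen D.H, ∀ y' ∈ Star D.H y, N q y' = N q y) ∧
      (∀ q ∈ D.Q, ∀ q' ∈ D.Q, ∀ y, y ∈ D.U q → y ∈ D.U q' → ∀ z ∈ Star D.H y, z ∈ Gen D.H →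
        ∀ z' ∈ Star D.H y, z' ∈ Gen D.H → N q z - N q' z = N q z' - N q' z') ∧
      (∀ q ∈ D.Q, ∀ y, y ∈ D.U q → ∀ z ∈ Star D.H y, z ∈ Gen D.H →
        ∀ z' ∈ Star D.H y, z' ∈ Gen D.H → ε q z + N q z = ε q z' + N q z') ∧
      ∃ R : ℤ, ∀ q y, |N q y| ≤ R := by
  obtain ⟨c, hc⟩ := hε.exists_finLabel
  have hdeg := hε.degreeMod_eq_zero ω hω hc
  obtain ⟨z, hz, hz0⟩ := exists_integral_cycle (P := D.P)
    (fun e he => ⟨D.left_mem e he, D.right_mem e he⟩) c hdeg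
  refine ⟨D.height ω z, fun q hq y hy y' hy' => height_eq_of_mem_star ω z hq hy hy', ?_, ?_,
    ∑ e ∈ D.E, |z e|, fun q y => ?_⟩
  · intro q hq q' hq' y hyq hyq' x hx hx' w hw hw'
    refine gallery (g := fun x => D.height ω z q x - D.height ω z q' x) D.finite_H
      (isOpen_star D.finite_H y) (convex_star y) D.finite_planes D.finrank_planes_lt
      (fun a ha b hb => ?_) (fun a ha hap n hn => ?_) hx hx' hw hw'
    · simp only [height_eq_of_mem_star ω z hq ha.2 hb.2, height_eq_of_mem_star ω z hq' ha.2 hb.2]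
    · filter_upwards [height_jump ω hz0 hq (D.star_subset_U hq hyq ha) hap hn,
        height_jump ω hz0 hq' (D.star_subset_U hq' hyq' ha) hap hn] with η h1 h2
      linarith
  · intro q hq y hyq x hx hx' w hw hw'
    have hcast : ∀ x, ((D.height ω z q x : ℤ) : ZMod 2) =
        ∑ e ∈ D.E, c e * (signedIndicator ω (D.basis q e) x : ZMod 2) := fun x => by
      simp [height, hz]
    rw [hcast, hcast]
    refine gallery (g := D.corrected ω ε c q) D.finite_H
      (isOpen_star D.finite_H y) (convex_star y) D.finite_planes D.finrank_planes_lt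
      (fun a ha b hb => hε.corrected_eq_of_mem_star ω c hq ha.2 hb.2)
      (fun a ha hap n hn => ?_) hx hx' hw hw'
    filter_upwards [hε.corrected_jump ω hω hc hq (D.star_subset_U hq hyq ha) hap hn] with η h
    rw [← sub_eq_zero, h]
    exact Finset.sum_eq_zero fun w _ => by rw [hdeg w, zero_mul]
  · refine (Finset.abs_sum_le_sum_abs _ _).trans (Finset.sum_le_sum fun e _ => ?_)
    rw [abs_mul]
    refine mul_le_of_le_one_right (abs_nonneg _) ?_
    rw [signedIndicator]
    split_ifs
    · rcases SignType.sign (ω (D.basis q e)) with _ | _ | _ <;> decide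
    · simp

end Config

/-! ### Existence of join points and of a resolving arrangement. -/

section Bipyramid

variable {V : Type*} [NormedAddCommGroup V] [NormedSpace ℝ V]

theorem range_pair {V : Type*} (a b : V) : Set.range ![a, b] = {a, b} := by
  ext x; simp; tauto

theorem range_triple {V : Type*} (a b c : V) : Set.range ![a, b, c] = {a, b, c} := by
  ext x; simp; tauto

theorem finrank_span_pair_le (a b : V) : Module.finrank ℝ (Submodule.span ℝ {a, b}) ≤ 2 := by
  rw [← range_pair]
  exact finrank_range_le_card ![a, b]

theorem finrank_span_triple_le (a b c : V) :
    Module.finrank ℝ (Submodule.span ℝ {a, b, c}) ≤ 3 := by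
  rw [← range_triple]
  exact finrank_range_le_card ![a, b, c]

theorem finrank_span_cell_le {P : Finset V} {E : Finset (V × V)} :
    ∀ s ∈ cells P E, Module.finrank ℝ (Submodule.span ℝ s) ≤ 2 := by
  rw [forall_cells]
  refine ⟨?_, fun v _ => ?_, fun e _ => finrank_span_pair_le _ _⟩
  · rw [Submodule.span_empty, finrank_bot]
    exact Nat.zero_le _
  · rw [← Set.pair_eq_singleton]
    exact finrank_span_pair_le v v

theorem finrank_span_insert_cell_le {P : Finset V} {E : Finset (V × V)} (q : V) :
    ∀ s ∈ cells P E, Module.finrank ℝ (Submodule.span ℝ (insert q s)) ≤ 3 := by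
  rw [forall_cells]
  refine ⟨?_, fun v _ => (finrank_span_pair_le q v).trans (by norm_num),
    fun e _ => finrank_span_triple_le _ _ _⟩
  rw [insert_empty_eq, ← Set.pair_eq_singleton]
  exact (finrank_span_pair_le q q).trans (by norm_num)

namespace Skeleton

variable (S : Skeleton V)

theorem indep_insert_p : ∀ s ∈ cells S.P S.E, LinearIndepOn ℝ id (insert S.p s) := by
  rw [forall_cells]
  refine ⟨?_, fun v hv => ?_, fun e he => ?_⟩
  · simpa using S.p_ne_zero
  · rw [← range_pair]; exact (S.indep v hv).linearIndepOn_id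
  · rw [← range_triple]; exact (S.indep_edge e he).linearIndepOn_id

/-- Spans that a join point has to avoid. -/
def walls : Set (Submodule ℝ V) :=
  Set.image2 (fun v w => Submodule.span ℝ {S.p, v, w}) (insert 0 S.P) (insert 0 S.P)

theorem finite_walls : S.walls.Finite :=
  (S.P.finite_toSet.insert 0).image2 _ (S.P.finite_toSet.insert 0)

variable {S} {q : V}

theorem notMem_span_of_walls (hq : ∀ W ∈ S.walls, q ∉ W) {v w : V} (hv : v ∈ S.P) (hw : w ∈ S.P) :
    q ∉ Submodule.span ℝ {S.p, v, w} := hq _ ⟨v, Or.inr hv, w, Or.inr hw, rfl⟩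

theorem q_notMem_span (hq : ∀ W ∈ S.walls, q ∉ W) :
    ∀ s ∈ cells S.P S.E, q ∉ Submodule.span ℝ s := by
  rw [forall_cells]
  refine ⟨?_, fun v hv h => ?_, fun e he h => ?_⟩
  · intro h
    rw [Submodule.span_empty, Submodule.mem_bot] at h
    subst h
    -- Zero is admitted in place of a vertex in `walls` precisely so that `q ≠ 0` even if the graph
    -- has no vertices.
    exact hq _ ⟨0, Or.inl rfl, 0, Or.inl rfl, rfl⟩ (Submodule.zero_mem _)
  · exact notMem_span_of_walls hq hv hv (Submodule.span_mono (by simp) h)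
  · exact notMem_span_of_walls hq (S.left_mem e he) (S.right_mem e he)
      (Submodule.span_mono (by simp) h)

theorem indep_insert_q (hq : ∀ W ∈ S.walls, q ∉ W) (s : Set V) (hs : s ∈ cells S.P S.E) :
    LinearIndepOn ℝ id (insert q s) :=
  ((S.indep_insert_p s hs).mono (Set.subset_insert _ _)).id_insert (q_notMem_span hq s hs)

theorem indep_wall (hq : ∀ W ∈ S.walls, q ∉ W) {w : V} (hw : w ∈ S.P) : LinearIndepOn ℝ id {q, S.p, w} := by
  refine (S.indep_insert_p {w} (Or.inl (Or.inr ⟨w, hw, rfl⟩))).id_insert fun h => ?_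
  exact notMem_span_of_walls hq hw hw (by simpa using h)

theorem exists_basis (hq : ∀ W ∈ S.walls, q ∉ W) (hV : Module.finrank ℝ V = 4) {e : V × V} (he : e ∈ S.E) :
    ∃ B : Module.Basis (Fin 4) ℝ V, ⇑B = ![q, S.p, e.1, e.2] := by
  have : LinearIndependent ℝ ![q, S.p, e.1, e.2] := by
    refine (S.indep_edge e he).finCons ?_
    rw [range_triple]
    exact notMem_span_of_walls hq (S.left_mem e he) (S.right_mem e he)
  exact ⟨basisOfLinearIndependentOfCardEqFinrank this (by simp [hV]), by simp⟩

end Skeleton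

/-- The join points avoid all spans of `p` with two vertices. The arrangement collects the forms
cutting out all joins and walls, the coordinate forms of the bases and the equations of the fins.
Joins have dimension at most three, so each piece is cut out by some pair `l`, `-l` and misses the
chambers. -/
theorem Skeleton.exists_config [FiniteDimensional ℝ V] (hV : Module.finrank ℝ V = 4)
    (S : Skeleton V) : ∃ D : Config V, D.toSkeleton = S := by
  classical
  obtain ⟨Q, hQ, hQW, hjoin⟩ := exists_finite_join_points (finite_cells S.P S.E)
    ⟨∅, Or.inl (Or.inl rfl)⟩ (fun s hs => by have := finrank_span_cell_le s hs; omega)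
    S.finite_walls (by
      rintro _ ⟨v, -, w, -, rfl⟩ (h : Submodule.span ℝ {S.p, v, w} = ⊤)
      have h' : Module.finrank ℝ (Submodule.span ℝ {S.p, v, w}) ≤ 3 := finrank_span_triple_le _ _ _
      rw [h, finrank_top] at h'
      omega)
  obtain ⟨Q, rfl⟩ := hQ.exists_finset_coe
  have hforms : ∀ s : Set V, LinearIndepOn ℝ id s → ∃ H : Set (V →ₗ[ℝ] ℝ), H.Finite ∧
      (∀ l ∈ H, l ≠ 0) ∧ coneOf s = {y | ∀ l ∈ H, 0 ≤ l y} ∧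
      (Submodule.span ℝ s ≠ ⊤ → ∃ l ∈ H, -l ∈ H) := fun s => exists_forms_coneOf
  choose! F hFfin hFne hFcone hFthin using hforms
  -- Irrelevant pairs receive an arbitrary basis, so that a basis, and with it the dimension and a
  -- determinant form, is available even for an empty graph.
  have hbasis : ∀ q : V, ∀ e : V × V, ∃ B : Module.Basis (Fin 4) ℝ V,
      q ∈ Q → e ∈ S.E → ⇑B = ![q, S.p, e.1, e.2] := by
    intro q e
    by_cases h : q ∈ Q ∧ e ∈ S.E
    · obtain ⟨B, hB⟩ := S.exists_basis (hQW q h.1) hV h.2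
      exact ⟨B, fun _ _ => hB⟩
    · exact ⟨(Module.finBasisOfFinrankEq ℝ V hV), fun h1 h2 => absurd ⟨h1, h2⟩ h⟩
  choose basis hbasis using hbasis
  have hside : ∀ e : V × V, ∃ l : V →ₗ[ℝ] ℝ, l ≠ 0 ∧ l S.p = 0 ∧ l e.1 = 0 ∧ l e.2 = 0 := by
    intro e
    obtain ⟨l, hl, h⟩ := Submodule.exists_le_ker_of_lt_top (Submodule.span ℝ {S.p, e.1, e.2})
      (lt_top_iff_ne_top.2 fun h => by
        have h' : Module.finrank ℝ (Submodule.span ℝ {S.p, e.1, e.2}) ≤ 3 :=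
          finrank_span_triple_le _ _ _
        rw [h, finrank_top] at h'
        omega)
    refine ⟨l, hl, ?_, ?_, ?_⟩ <;> exact h (Submodule.subset_span (by simp))
  choose side hside0 hside using hside
  let J : Set (Set V) := Set.image2 (fun q s => insert q s) (insert S.p Q) (cells S.P S.E) ∪
    Set.image2 (fun q w => {q, S.p, w}) Q S.P
  have hJfin : J.Finite := ((Q.finite_toSet.insert _).image2 _ (finite_cells _ _)).union
    (Q.finite_toSet.image2 _ S.P.finite_toSet)
  have hJp : ∀ s ∈ cells S.P S.E, insert S.p s ∈ J := fun s hs =>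
    Or.inl ⟨_, Or.inl rfl, s, hs, rfl⟩
  have hJq : ∀ q ∈ Q, ∀ s ∈ cells S.P S.E, insert q s ∈ J := fun q hq s hs =>
    Or.inl ⟨q, Or.inr hq, s, hs, rfl⟩
  have hJw : ∀ q ∈ Q, ∀ w ∈ S.P, {q, S.p, w} ∈ J := fun q hq w hw => Or.inr ⟨q, hq, w, hw, rfl⟩
  have hJ : ∀ s ∈ J, LinearIndepOn ℝ id s := by
    rintro _ (⟨q, rfl | hq, s, hs, rfl⟩ | ⟨q, hq, w, hw, rfl⟩)
    · exact S.indep_insert_p s hs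
    · exact S.indep_insert_q (hQW q hq) s hs
    · exact S.indep_wall (hQW q hq) hw
  let H : Set (V →ₗ[ℝ] ℝ) := (⋃ s ∈ J, F s) ∪ (⋃ q ∈ Q, ⋃ e ∈ S.E, Set.range (basis q e).coord) ∪
    side '' S.E
  have hFH : ∀ s ∈ J, F s ⊆ H := fun s hs l hl =>
    Or.inl (Or.inl (Set.mem_biUnion hs hl))
  have hcut : ∀ s ∈ J, CutBy H (coneOf s) := fun s hs => ⟨F s, hFH s hs, hFcone s (hJ s hs)⟩
  have hthin : ∀ q : V, ∀ s ∈ cells S.P S.E, insert q s ∈ J → ∀ y ∈ Gen H,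
      y ∉ coneOf (insert q s) := by
    intro q s hs hqs y hy hyc
    obtain ⟨l, hl, hl'⟩ := hFthin _ (hJ _ hqs) fun h => by
      have h' := finrank_span_insert_cell_le q s hs
      rw [h, finrank_top] at h'
      omega
    rw [hFcone _ (hJ _ hqs)] at hyc
    have h1 := hyc l hl
    have h2 := hyc _ hl'
    rw [LinearMap.neg_apply] at h2
    exact hy l (hFH _ hqs hl) (by linarith)
  exact ⟨{ S with
    Q := Q, H := H, basis := basis, side := side
    generic := fun q hq v hv w hw => S.notMem_span_of_walls (hQW q hq) hv hw
    q_notMem_span := fun q hq => S.q_notMem_span (hQW q hq)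
    joins := hjoin
    finite_H := ((hJfin.biUnion fun s hs => hFfin s (hJ s hs)).union
      (Q.finite_toSet.biUnion fun q _ => S.E.finite_toSet.biUnion fun e _ =>
        Set.finite_range _)).union (S.E.finite_toSet.image _)
    ne_zero := by
      rintro l ((hl | hl) | ⟨e, -, rfl⟩)
      · obtain ⟨s, hs, hl⟩ := Set.mem_iUnion₂.1 hl
        exact hFne s (hJ s hs) l hl
      · simp only [Set.mem_iUnion] at hl
        obtain ⟨q, -, e, -, i, rfl⟩ := hl
        intro h
        have : (basis q e).coord i (basis q e i) = 1 := by simp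
        rw [h] at this
        simp at this
      · exact hside0 e
    cut_p := fun s hs => hcut _ (hJp s hs)
    cut_q := fun q hq s hs => hcut _ (hJq q hq s hs)
    thin_p := fun y hy ⟨s, hs, h⟩ => hthin _ s hs (hJp s hs) y hy h
    thin_q := fun q hq y hy ⟨s, hs, h⟩ => hthin _ s hs (hJq q hq s hs) y hy h
    cut_wall := fun q hq w hw => hcut _ (hJw q hq w hw)
    basis_eq := fun q hq e he => hbasis q e hq he
    coord_mem := fun q hq e he i => by
      refine Or.inl (Or.inr ?_)
      simp only [Set.mem_iUnion]
      exact ⟨q, hq, e, he, i, rfl⟩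
    side_mem := fun e he => Or.inr ⟨e, he, rfl⟩
    side_eq := fun e _ => hside e }, rfl⟩

end Bipyramid

/-! ### Segments on the unit sphere. -/

section Segments

variable {V : Type*} [NormedAddCommGroup V] [NormedSpace ℝ V]

theorem mem_span_of_mem_segment {a b x : V} (hx : x ∈ segment ℝ a b) :
    x ∈ Submodule.span ℝ {a, b} := by
  obtain ⟨s, t, -, -, -, rfl⟩ := hx
  exact Submodule.mem_span_pair.2 ⟨s, t, rfl⟩

theorem endpoints_mem_span {a b x y : V} (hx : x ∈ segment ℝ a b) (hy : y ∈ segment ℝ a b)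
    (hxy : x ≠ y) : a ∈ Submodule.span ℝ {x, y} ∧ b ∈ Submodule.span ℝ {x, y} := by
  rw [segment_eq_image'] at hx hy
  obtain ⟨s, -, rfl⟩ := hx
  obtain ⟨t, -, rfl⟩ := hy
  have hst : t - s ≠ 0 := by
    intro h
    exact hxy (by rw [sub_eq_zero.1 h])
  set S := Submodule.span ℝ {a + s • (b - a), a + t • (b - a)}
  have h1 : a + s • (b - a) ∈ S := Submodule.subset_span (by simp)
  have h2 : a + t • (b - a) ∈ S := Submodule.subset_span (by simp)
  have h3 : b - a ∈ S := by
    rw [← Submodule.smul_mem_iff S hst]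
    convert S.sub_mem h2 h1 using 1
    module
  have h4 : a ∈ S := by
    convert S.sub_mem h1 (S.smul_mem s h3) using 1
    module
  exact ⟨h4, by simpa using S.add_mem h3 h4⟩

/-- The point divided by `α + β` lies on the segment, hence on the sphere. This linearity on flat
parts of the sphere stands in for strict convexity, which the sup norm lacks. -/
theorem norm_comb_of_unit {x y : V} (h : ∀ z ∈ segment ℝ x y, ‖z‖ = 1) {α β : ℝ} (hα : 0 ≤ α)
    (hβ : 0 ≤ β) : ‖α • x + β • y‖ = α + β := by
  rcases (add_nonneg hα hβ).eq_or_lt with h0 | h0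
  · obtain rfl : α = 0 := by linarith
    obtain rfl : β = 0 := by linarith
    simp
  · have h1 : (α / (α + β)) • x + (β / (α + β)) • y ∈ segment ℝ x y :=
      ⟨_, _, by positivity, by positivity, by field_simp, rfl⟩
    have h2 : α • x + β • y = (α + β) • ((α / (α + β)) • x + (β / (α + β)) • y) := by
      rw [smul_add, smul_smul, smul_smul, mul_div_cancel₀ _ h0.ne', mul_div_cancel₀ _ h0.ne']
    rw [h2, norm_smul, h _ h1, mul_one, Real.norm_of_nonneg h0.le]

theorem exists_unit_of_comb {x y : V} {α β : ℝ} (hα : 0 < α) (hβ : 0 < β) :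
    ∃ u ∈ openSegment ℝ x y, α • x + β • y = (α + β) • u := by
  have h0 : 0 < α + β := by positivity
  refine ⟨_, ⟨α / (α + β), β / (α + β), by positivity, by positivity, by field_simp, rfl⟩, ?_⟩
  rw [smul_add, smul_smul, smul_smul, mul_div_cancel₀ _ h0.ne', mul_div_cancel₀ _ h0.ne']

theorem eq_of_smul_eq_smul_of_norm {u u' : V} (h : ‖u‖ = 1) (h' : ‖u'‖ = 1) {s s' : ℝ} (hs : 0 < s)
    (hs' : 0 ≤ s') (he : s • u = s' • u') : u = u' := by
  have := congrArg norm he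
  rw [norm_smul, norm_smul, h, h', Real.norm_of_nonneg hs.le, Real.norm_of_nonneg hs', mul_one,
    mul_one] at this
  rw [← this] at he
  exact smul_right_injective _ hs.ne' he

theorem linearIndependent_of_unit {x y : V} (h : ∀ z ∈ segment ℝ x y, ‖z‖ = 1) (hxy : x ≠ y) :
    LinearIndependent ℝ ![x, y] := by
  have hx := h x (left_mem_segment _ _ _)
  have hy := h y (right_mem_segment _ _ _)
  rw [LinearIndependent.pair_iff]
  intro s t hst
  have h1 : s • x = (-t) • y := by rw [neg_smul]; exact eq_neg_of_add_eq_zero_left hst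
  have h2 := congrArg norm h1
  rw [norm_smul, norm_smul, hx, hy, mul_one, mul_one, norm_neg, Real.norm_eq_abs,
    Real.norm_eq_abs, abs_eq_abs] at h2
  have h3 : s = 0 := by
    rcases h2 with rfl | rfl
    · rw [← smul_add] at hst
      have h4 := norm_comb_of_unit h zero_le_one zero_le_one
      rw [one_smul, one_smul] at h4
      have h5 := congrArg norm hst
      rw [norm_smul, h4, norm_zero] at h5
      simpa using h5
    · by_contra hne
      exact hxy (smul_right_injective _ hne (by simpa using h1))
  subst h3
  simpa [eq_comm] using h2

/-- Two segments on the unit sphere of a plane that cross in an interior point are collinear. -/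
theorem sum_eq_one_of_cross {x y x' y' : V} (h : ∀ z ∈ segment ℝ x y, ‖z‖ = 1)
    (h' : ∀ z ∈ segment ℝ x' y', ‖z‖ = 1) {u : V}
    (hu : u ∈ openSegment ℝ x y) (hu' : u ∈ openSegment ℝ x' y') {α₁ β₁ : ℝ}
    (h₁ : x' = α₁ • x + β₁ • y) : α₁ + β₁ = 1 := by
  obtain ⟨s, t, hs, ht, hst, rfl⟩ := hu
  -- A point slightly off `u` towards `x'` still has positive coordinates with respect to `x` and
  -- `y`, so its norm is the sum of these coordinates. As it lies on the second segment, that norm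
  -- is 1, which gives the equation.
  have hev : ∀ᶠ η in 𝓝[>] (0 : ℝ), 0 < η ∧ 0 < 1 + η * (-1) ∧ 0 < s + η * (α₁ - s) ∧
      0 < t + η * (β₁ - t) :=
    (eventually_mem_nhdsWithin (s := Set.Ioi (0 : ℝ))).and
      ((eventually_pos_add_mul one_pos _).and
        ((eventually_pos_add_mul hs _).and (eventually_pos_add_mul ht _)))
  obtain ⟨η, hη, hη1, h1, h2⟩ := hev.exists
  have h3 : η • x' + (1 - η) • (s • x + t • y) ∈ segment ℝ x' y' :=
    (convex_segment x' y') (left_mem_segment _ _ _) (openSegment_subset_segment _ _ _ hu') hη.le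
      (by linarith) (by ring)
  have h4 : η • x' + (1 - η) • (s • x + t • y) =
      (s + η * (α₁ - s)) • x + (t + η * (β₁ - t)) • y := by rw [h₁]; module
  have h5 := h' _ h3
  rw [h4, norm_comb_of_unit h h1.le h2.le] at h5
  have h6 : η * (α₁ + β₁ - 1) = 0 := by linear_combination h5 - (1 - η) * hst
  rcases mul_eq_zero.1 h6 with h7 | h7
  · exact absurd h7 (ne_of_gt hη)
  · linarith

theorem smul_sub_injective {x y : V} (hxy : x ≠ y) {s t : ℝ}
    (h : x + s • (y - x) = x + t • (y - x)) : s = t :=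
  smul_left_injective ℝ (sub_ne_zero.2 hxy.symm) (add_left_cancel h)

/-- Two crossing segments of a line that contain none of each other's endpoints in the interior
are equal. -/
theorem eq_or_swap_of_collinear {x y x' y' u : V} (hxy : x ≠ y)
    (hu : u ∈ openSegment ℝ x y) (hu' : u ∈ openSegment ℝ x' y') {r r' : ℝ}
    (h₁ : x' = x + r • (y - x)) (h₂ : y' = x + r' • (y - x))
    (hx' : x' ∉ openSegment ℝ x y) (hy' : y' ∉ openSegment ℝ x y)
    (hx : x ∉ openSegment ℝ x' y') (hy : y ∉ openSegment ℝ x' y') :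
    (x' = x ∧ y' = y) ∨ (x' = y ∧ y' = x) := by
  have key : ∀ w ∈ Set.Ioo (0 : ℝ) 1, ∀ z, z = x + w • (y - x) → z ∈ openSegment ℝ x y := by
    rintro w ⟨h0, h1⟩ z rfl
    exact ⟨1 - w, w, by linarith, h0, by ring, by module⟩
  have key' : ∀ w, (r < w ∧ w < r' ∨ r' < w ∧ w < r) → ∀ z, z = x + w • (y - x) →
      z ∈ openSegment ℝ x' y' := by
    rintro w hw z rfl
    rw [h₁, h₂]
    have hne : r' - r ≠ 0 := by rintro h; rcases hw with h | h <;> linarith [h.1, h.2]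
    refine ⟨(r' - w) / (r' - r), (w - r) / (r' - r), ?_, ?_, by field_simp; ring, ?_⟩
    · rcases hw with h | h
      · exact div_pos (by linarith [h.2]) (by linarith [h.1, h.2])
      · exact div_pos_of_neg_of_neg (by linarith [h.1]) (by linarith [h.1, h.2])
    · rcases hw with h | h
      · exact div_pos (by linarith [h.1]) (by linarith [h.1, h.2])
      · exact div_pos_of_neg_of_neg (by linarith [h.2]) (by linarith [h.1, h.2])
    · have e1 : (r' - w) / (r' - r) + (w - r) / (r' - r) = 1 := by field_simp; ring
      have e2 : (r' - w) / (r' - r) * r + (w - r) / (r' - r) * r' = w := by field_simp; ring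
      calc _ = ((r' - w) / (r' - r) + (w - r) / (r' - r)) • x +
            ((r' - w) / (r' - r) * r + (w - r) / (r' - r) * r') • (y - x) := by module
        _ = _ := by rw [e1, e2, one_smul]
  obtain ⟨ρ, hρ, rfl⟩ : ∃ ρ ∈ Set.Ioo (0 : ℝ) 1, x + ρ • (y - x) = u := by
    rw [openSegment_eq_image'] at hu
    exact hu
  obtain ⟨s, t, hs, ht, hst, he⟩ := hu'
  have hρe : s * r + t * r' = ρ := by
    refine smul_sub_injective hxy ?_
    rw [← he, h₁, h₂]
    calc _ = (1 : ℝ) • x + (s * r + t * r') • (y - x) := by rw [one_smul]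
      _ = _ := by rw [← hst]; module
  have hr : r ≤ 0 ∨ 1 ≤ r := by
    by_contra! h; exact hx' (key r h _ h₁)
  have hr' : r' ≤ 0 ∨ 1 ≤ r' := by
    by_contra! h; exact hy' (key r' h _ h₂)
  have h0 : ¬ (r < 0 ∧ 0 < r' ∨ r' < 0 ∧ 0 < r) := fun h => hx (key' 0 h _ (by simp))
  have h1 : ¬ (r < 1 ∧ 1 < r' ∨ r' < 1 ∧ 1 < r) := fun h => hy (key' 1 h _ (by simp))
  have hs' : s = 1 - t := by linarith
  subst hs'
  obtain ⟨hρ0, hρ1⟩ := hρ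
  rcases hr with hr | hr <;> rcases hr' with hr' | hr'
  · nlinarith [mul_nonneg hs.le (neg_nonneg.2 hr), mul_nonneg ht.le (neg_nonneg.2 hr')]
  · left
    have e1 : r = 0 := by
      by_contra hne; exact h0 (Or.inl ⟨hr.lt_of_ne hne, by linarith⟩)
    have e2 : r' = 1 := by
      by_contra hne; exact h1 (Or.inl ⟨by linarith, hr'.lt_of_ne' hne⟩)
    rw [h₁, h₂, e1, e2]
    simp
  · right
    have e1 : r' = 0 := by
      by_contra hne; exact h0 (Or.inr ⟨hr'.lt_of_ne hne, by linarith⟩)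
    have e2 : r = 1 := by
      by_contra hne; exact h1 (Or.inr ⟨by linarith, hr.lt_of_ne' hne⟩)
    rw [h₁, h₂, e1, e2]
    simp
  · nlinarith [mul_nonneg hs.le (sub_nonneg.2 hr), mul_nonneg ht.le (sub_nonneg.2 hr')]

/-- A point of a segment that is not one of finitely many marked points lies between two consecutive
marked points. -/
theorem exists_consecutive {a b : V} (hab : a ≠ b) {P : Set V} (hP : P.Finite) (ha : a ∈ P)
    (hb : b ∈ P) {u : V} (hu : u ∈ segment ℝ a b) (huP : u ∉ P) :
    ∃ x ∈ P, ∃ y ∈ P, x ∈ segment ℝ a b ∧ y ∈ segment ℝ a b ∧ x ≠ y ∧ u ∈ openSegment ℝ x y ∧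
      ∀ z ∈ P, z ∉ openSegment ℝ x y := by
  rw [segment_eq_image'] at hu
  obtain ⟨t, ⟨ht0, ht1⟩, rfl⟩ := hu
  let g : ℝ → V := fun t => a + t • (b - a)
  have hg : Function.Injective g := fun s t h => smul_sub_injective hab h
  have hT : (g ⁻¹' P).Finite := hP.preimage hg.injOn
  have ht : g t ∉ P := huP
  have hb' : g 1 ∈ P := by simpa [g] using hb
  have ha' : g 0 ∈ P := by simpa [g] using ha
  have ht0' : 0 < t := ht0.lt_of_ne fun h => ht (h ▸ ha')
  have ht1' : t < 1 := ht1.lt_of_ne fun h => ht (h ▸ hb')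
  obtain ⟨s, ⟨hsP, hst⟩, hsmax⟩ := Set.exists_max_image (g ⁻¹' P ∩ Set.Iio t) id
    (hT.inter_of_left _) ⟨0, ha', ht0'⟩
  obtain ⟨r, ⟨hrP, hrt⟩, hrmin⟩ := Set.exists_min_image (g ⁻¹' P ∩ Set.Ioi t) id
    (hT.inter_of_left _) ⟨1, hb', ht1'⟩
  have hs0 : 0 ≤ s := hsmax 0 ⟨ha', ht0'⟩
  have hr1 : r ≤ 1 := hrmin 1 ⟨hb', ht1'⟩
  simp only [Set.mem_Iio, Set.mem_Ioi] at hst hrt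
  have hseg : ∀ w ∈ Set.Icc (0 : ℝ) 1, g w ∈ segment ℝ a b := fun w hw => by
    rw [segment_eq_image']; exact ⟨w, hw, rfl⟩
  refine ⟨g s, hsP, g r, hrP, hseg s ⟨hs0, by linarith⟩, hseg r ⟨by linarith, hr1⟩,
    fun h => by have := hg h; linarith, ?_, ?_⟩
  · have hrs : 0 < r - s := by linarith
    refine ⟨(r - t) / (r - s), (t - s) / (r - s), div_pos (by linarith) hrs,
      div_pos (by linarith) hrs, by field_simp; ring, ?_⟩
    have e1 : (r - t) / (r - s) + (t - s) / (r - s) = 1 := by field_simp; ring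
    have e2 : (r - t) / (r - s) * s + (t - s) / (r - s) * r = t := by field_simp; ring
    calc _ = ((r - t) / (r - s) + (t - s) / (r - s)) • a +
          ((r - t) / (r - s) * s + (t - s) / (r - s) * r) • (b - a) := by simp only [g]; module
      _ = _ := by rw [e1, e2, one_smul]
  · rintro z hz ⟨c, d, hc, hd, hcd, rfl⟩
    have he : c • g s + d • g r = g (c * s + d * r) := by
      simp only [g]
      calc _ = (c + d) • a + (c * s + d * r) • (b - a) := by module
        _ = _ := by rw [hcd, one_smul]
    rw [he] at hz
    have hc' : c = 1 - d := by linarith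
    subst hc'
    have h1 : s < (1 - d) * s + d * r := by nlinarith
    have h2 : (1 - d) * s + d * r < r := by nlinarith
    rcases lt_trichotomy ((1 - d) * s + d * r) t with h | h | h
    · have := hsmax _ ⟨hz, h⟩
      simp only [id] at this; linarith
    · exact ht (h ▸ hz)
    · have := hrmin _ ⟨hz, h⟩
      simp only [id] at this; linarith

/-- A compact convex set of dimension at most one is empty or a segment. -/
theorem exists_eq_segment {C : Set V} (hC : IsCompact C) (hconv : Convex ℝ C)
    (hd : Collinear ℝ C) (hne : C.Nonempty) : ∃ a b, C = segment ℝ a b := by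
  obtain ⟨p₀, hp₀⟩ := hne
  obtain ⟨v, hv⟩ := (collinear_iff_of_mem hp₀).1 hd
  by_cases hv0 : v = 0
  · refine ⟨p₀, p₀, ?_⟩
    rw [segment_same]
    refine Set.Subset.antisymm (fun x hx => ?_) (by simpa using hp₀)
    obtain ⟨r, hr⟩ := hv x hx
    simpa [hv0] using hr
  · obtain ⟨φ, -, hφ⟩ := exists_dual_vector ℝ v (norm_ne_zero_iff.2 hv0)
    have hφv : 0 < φ v := by rw [hφ]; simpa using hv0
    obtain ⟨a, ha, hamin⟩ := hC.exists_isMinOn ⟨p₀, hp₀⟩ φ.continuous.continuousOn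
    obtain ⟨b, hb, hbmax⟩ := hC.exists_isMaxOn ⟨p₀, hp₀⟩ φ.continuous.continuousOn
    refine ⟨a, b, Set.Subset.antisymm (fun x hx => ?_) (hconv.segment_subset ha hb)⟩
    have h1 : φ a ≤ φ x := hamin hx
    have h2 : φ x ≤ φ b := hbmax hx
    obtain ⟨ra, rfl⟩ := hv a ha
    obtain ⟨rb, rfl⟩ := hv b hb
    obtain ⟨r, rfl⟩ := hv x hx
    simp only [vadd_eq_add, map_add, map_smul, smul_eq_mul, add_le_add_iff_right] at h1 h2
    have h1 := le_of_mul_le_mul_right h1 hφv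
    have h2 := le_of_mul_le_mul_right h2 hφv
    rcases (h1.trans h2).eq_or_lt with h | h
    · have : r = ra := by linarith
      subst this
      exact left_mem_segment _ _ _
    · have hrs : 0 < rb - ra := by linarith
      refine ⟨(rb - r) / (rb - ra), (r - ra) / (rb - ra), div_nonneg (by linarith) hrs.le,
        div_nonneg (by linarith) hrs.le, by field_simp; ring, ?_⟩
      have e1 : (rb - r) / (rb - ra) + (r - ra) / (rb - ra) = 1 := by field_simp; ring
      have e2 : (rb - r) / (rb - ra) * ra + (r - ra) / (rb - ra) * rb = r := by field_simp; ring
      calc _ = ((rb - r) / (rb - ra) + (r - ra) / (rb - ra)) • p₀ +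
            ((rb - r) / (rb - ra) * ra + (r - ra) / (rb - ra) * rb) • v := by
              simp only [vadd_eq_add]; module
        _ = _ := by rw [e1, e2, one_smul, add_comm, vadd_eq_add]

end Segments

/-! ### Subdividing the branch set into a graph in general position. -/

section Build

variable {V : Type*} [NormedAddCommGroup V] [NormedSpace ℝ V]

/-- The endpoints of a family of segments. -/
def endpoints (I : Finset (V × V)) : Set V :=
  Prod.fst '' (I : Set (V × V)) ∪ Prod.snd '' (I : Set (V × V))

/-- The points of a family of segments that lie above another segment. -/
def crossings (I : Finset (V × V)) (p : V) : Set V :=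
  {x | ∃ i ∈ I, ∃ j ∈ I, x ∈ segment ℝ i.1 i.2 ∧ x ∈ Submodule.span ℝ {p, j.1, j.2} ∧
    ¬ (i.1 ∈ Submodule.span ℝ {p, j.1, j.2} ∧ i.2 ∈ Submodule.span ℝ {p, j.1, j.2})}

theorem finite_crossings (I : Finset (V × V)) (p : V) : (crossings I p).Finite := by
  have : crossings I p ⊆ ⋃ i ∈ I, ⋃ j ∈ I, {x | x ∈ segment ℝ i.1 i.2 ∧
      x ∈ Submodule.span ℝ {p, j.1, j.2} ∧
      ¬ (i.1 ∈ Submodule.span ℝ {p, j.1, j.2} ∧ i.2 ∈ Submodule.span ℝ {p, j.1, j.2})} := by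
    rintro x ⟨i, hi, j, hj, h⟩
    exact Set.mem_biUnion hi (Set.mem_biUnion hj h)
  refine Set.Finite.subset (I.finite_toSet.biUnion fun i _ => I.finite_toSet.biUnion fun j _ =>
    Set.Subsingleton.finite ?_) this
  rintro x ⟨hx, hx', hn⟩ y ⟨hy, hy', -⟩
  by_contra hne
  have h : Submodule.span ℝ {x, y} ≤ Submodule.span ℝ {p, j.1, j.2} := by
    rw [Submodule.span_le]
    rintro _ (rfl | rfl)
    exacts [hx', hy']
  exact hn ⟨h (endpoints_mem_span hx hy hne).1, h (endpoints_mem_span hx hy hne).2⟩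

/-- Segments on the unit sphere in general position with respect to the direction `p`. -/
theorem exists_skeleton [FiniteDimensional ℝ V] (hV : Module.finrank ℝ V = 4)
    (I : Finset (V × V)) (hI : ∀ i ∈ I, ∀ x ∈ segment ℝ i.1 i.2, ‖x‖ = 1) :
    ∃ S : Skeleton V, ∀ y, y ∈ graphCone S.P S.E ↔
      y = 0 ∨ ∃ c : ℝ, 0 < c ∧ ∃ i ∈ I, ∃ x ∈ segment ℝ i.1 i.2, y = c • x := by
  classical
  let sp : V × V → Submodule ℝ V := fun i => Submodule.span ℝ {i.1, i.2}
  -- Two planes `sp i`, `sp j` may span everything, and then `p` cannot avoid their sum; in that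
  -- case only isolated points of one segment lie above the other, and these become vertices. The
  -- subspace `⊥` is included to get `p ≠ 0`.
  obtain ⟨p, -, hp⟩ := exists_mem_open_forall_notMem
    (((I.finite_toSet.image2 (fun i j => sp i ⊔ sp j) I.finite_toSet).inter_of_left
      {S | S ≠ ⊤}).insert ⊥) (by
      rintro S (rfl | h)
      · intro h
        have := finrank_bot ℝ V
        rw [h, finrank_top] at this
        omega
      · exact h.2) isOpen_univ Set.univ_nonempty
  have hp0 : p ≠ 0 := fun h => hp ⊥ (Or.inl rfl) (by rw [h]; exact Submodule.zero_mem _)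
  have hpair : ∀ i ∈ I, ∀ j ∈ I, sp i ⊔ sp j ≠ ⊤ → p ∉ sp i ⊔ sp j := fun i hi j hj h =>
    hp _ (Or.inr ⟨⟨i, hi, j, hj, rfl⟩, h⟩)
  have hpi : ∀ i ∈ I, p ∉ sp i := by
    intro i hi
    rw [← sup_idem (sp i)]
    refine hpair i hi i hi fun h => ?_
    have h2 : Module.finrank ℝ (sp i) ≤ 2 := finrank_span_pair_le _ _
    rw [sup_idem] at h
    rw [h, finrank_top] at h2
    omega
  have hle : ∀ j : V × V, sp j ≤ Submodule.span ℝ {p, j.1, j.2} := fun j =>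
    Submodule.span_mono (Set.subset_insert _ _)
  -- If all of `i` lies over `j`, both planes lie in a space of dimension at most three. So their
  -- sum is proper and avoids `p`, and nothing is left of the `p`-components.
  have hover : ∀ i ∈ I, ∀ j ∈ I, i.1 ∈ Submodule.span ℝ {p, j.1, j.2} →
      i.2 ∈ Submodule.span ℝ {p, j.1, j.2} → sp i ≤ sp j := by
    intro i hi j hj h1 h2
    have hpW : p ∉ sp i ⊔ sp j := by
      refine hpair i hi j hj fun h => ?_
      have h3 : sp i ⊔ sp j ≤ Submodule.span ℝ {p, j.1, j.2} := by
        refine sup_le ?_ (hle j)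
        rw [Submodule.span_le]
        rintro _ (rfl | rfl)
        exacts [h1, h2]
      rw [h, top_le_iff] at h3
      have h4 : Module.finrank ℝ (Submodule.span ℝ {p, j.1, j.2}) ≤ 3 := finrank_span_triple_le _ _ _
      rw [h3, finrank_top] at h4
      omega
    have key : ∀ x ∈ sp i, x ∈ Submodule.span ℝ {p, j.1, j.2} → x ∈ sp j := by
      intro x hx hx'
      obtain ⟨τ, u, hu, rfl⟩ := Submodule.mem_span_insert.1 hx'
      by_cases hτ : τ = 0
      · simpa [hτ] using hu
      · refine absurd ((Submodule.smul_mem_iff _ hτ).1 ?_) hpW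
        have := (sp i ⊔ sp j).sub_mem (Submodule.mem_sup_left hx) (Submodule.mem_sup_right hu)
        simpa using this
    change Submodule.span ℝ _ ≤ _
    rw [Submodule.span_le]
    rintro _ (rfl | rfl)
    exacts [key _ (Submodule.subset_span (by simp)) h1, key _ (Submodule.subset_span (by simp)) h2]
  have hPfin : (endpoints I ∪ crossings I p).Finite :=
    ((I.finite_toSet.image _).union (I.finite_toSet.image _)).union (finite_crossings I p)
  let P : Finset V := hPfin.toFinset
  have hPmem : ∀ x, x ∈ P ↔ x ∈ endpoints I ∪ crossings I p := fun x => hPfin.mem_toFinset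
  have hPseg : ∀ x ∈ P, ∃ i ∈ I, x ∈ segment ℝ i.1 i.2 := by
    intro x hx
    rcases (hPmem x).1 hx with (⟨i, hi, rfl⟩ | ⟨i, hi, rfl⟩) | ⟨i, hi, -, -, h, -⟩
    exacts [⟨i, hi, left_mem_segment _ _ _⟩, ⟨i, hi, right_mem_segment _ _ _⟩, ⟨i, hi, h⟩]
  have hleft : ∀ i ∈ I, i.1 ∈ P := fun i hi => (hPmem _).2 (Or.inl (Or.inl ⟨i, hi, rfl⟩))
  have hright : ∀ i ∈ I, i.2 ∈ P := fun i hi => (hPmem _).2 (Or.inl (Or.inr ⟨i, hi, rfl⟩))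
  have hspan : ∀ i ∈ I, ∀ j ∈ I, ∀ u ∈ segment ℝ i.1 i.2, u ∉ P →
      u ∈ Submodule.span ℝ {p, j.1, j.2} → sp i ≤ sp j := by
    intro i hi j hj u hu huP hus
    by_contra h
    refine huP ((hPmem u).2 (Or.inr ⟨i, hi, j, hj, hu, hus, fun h' => h (hover i hi j hj h'.1 h'.2)⟩))
  -- Edges join consecutive vertices of a segment; the well-ordering selects one of the two
  -- orientations, as `disj` requires.
  let E : Finset (V × V) := (P ×ˢ P).filter fun e => WellOrderingRel e.1 e.2 ∧
    (∃ i ∈ I, e.1 ∈ segment ℝ i.1 i.2 ∧ e.2 ∈ segment ℝ i.1 i.2) ∧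
    ∀ z ∈ P, z ∉ openSegment ℝ e.1 e.2
  have hE : ∀ e, e ∈ E ↔ (e.1 ∈ P ∧ e.2 ∈ P) ∧ WellOrderingRel e.1 e.2 ∧
      (∃ i ∈ I, e.1 ∈ segment ℝ i.1 i.2 ∧ e.2 ∈ segment ℝ i.1 i.2) ∧
      ∀ z ∈ P, z ∉ openSegment ℝ e.1 e.2 := fun e => by
    simp only [E, Finset.mem_filter, Finset.mem_product]
  have hEne : ∀ e ∈ E, e.1 ≠ e.2 := fun e he h => by
    have := ((hE e).1 he).2.1
    rw [h] at this
    exact irrefl_of WellOrderingRel _ this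
  have hEseg : ∀ e ∈ E, ∃ i ∈ I, segment ℝ e.1 e.2 ⊆ segment ℝ i.1 i.2 ∧
      sp i ≤ Submodule.span ℝ {e.1, e.2} := by
    intro e he
    obtain ⟨i, hi, h1, h2⟩ := ((hE e).1 he).2.2.1
    refine ⟨i, hi, (convex_segment _ _).segment_subset h1 h2, ?_⟩
    change Submodule.span ℝ _ ≤ _
    rw [Submodule.span_le]
    have := endpoints_mem_span h1 h2 (hEne e he)
    rintro _ (rfl | rfl)
    exacts [this.1, this.2]
  have hEunit : ∀ e ∈ E, ∀ z ∈ segment ℝ e.1 e.2, ‖z‖ = 1 := fun e he z hz => by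
    obtain ⟨i, hi, h, -⟩ := hEseg e he
    exact hI i hi z (h hz)
  have hEP : ∀ e ∈ E, ∀ z ∈ openSegment ℝ e.1 e.2, z ∉ P := fun e he z hz hzP =>
    ((hE e).1 he).2.2.2 z hzP hz
  have hPunit : ∀ x ∈ P, ‖x‖ = 1 := fun x hx => by
    obtain ⟨i, hi, h⟩ := hPseg x hx
    exact hI i hi x h
  have hcone : ∀ y, y ∈ graphCone P E ↔
      y = 0 ∨ ∃ c : ℝ, 0 < c ∧ ∃ i ∈ I, ∃ x ∈ segment ℝ i.1 i.2, y = c • x := by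
    intro y
    constructor
    · have : ∀ s ∈ cells P E, y ∈ coneOf s →
          y = 0 ∨ ∃ c : ℝ, 0 < c ∧ ∃ i ∈ I, ∃ x ∈ segment ℝ i.1 i.2, y = c • x := by
        rw [forall_cells]
        refine ⟨fun h => Or.inl (mem_coneOf_empty.1 h), fun v hv h => ?_, fun e he h => ?_⟩
        · obtain ⟨c, hc, h⟩ := mem_coneOf_singleton.1 h
          rcases hc.eq_or_lt with rfl | hc
          · exact Or.inl (by simpa using h)
          · obtain ⟨i, hi, hvi⟩ := hPseg v hv
            exact Or.inr ⟨c, hc, i, hi, v, hvi, h⟩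
        · obtain ⟨α, β, hα, hβ, h⟩ := mem_coneOf_pair.1 h
          rcases (add_nonneg hα hβ).eq_or_lt with h0 | h0
          · left
            rw [h, show α = 0 by linarith, show β = 0 by linarith]
            simp
          · obtain ⟨i, hi, hsub, -⟩ := hEseg e he
            refine Or.inr ⟨α + β, h0, i, hi, (α / (α + β)) • e.1 + (β / (α + β)) • e.2,
              hsub ⟨_, _, by positivity, by positivity, by field_simp, rfl⟩, ?_⟩
            rw [h, smul_add, smul_smul, smul_smul, mul_div_cancel₀ _ h0.ne',
              mul_div_cancel₀ _ h0.ne']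
      rintro ⟨s, hs, h⟩
      exact this s hs h
    · rintro (rfl | ⟨c, hc, i, hi, x, hx, rfl⟩)
      · exact ⟨∅, Or.inl (Or.inl rfl), zero_mem_coneOf _⟩
      · by_cases hxP : x ∈ P
        · exact mem_graphCone_of_vertex hxP hc.le
        · have hab : i.1 ≠ i.2 := by
            intro h
            rw [← h, segment_same, Set.mem_singleton_iff] at hx
            exact hxP (hx ▸ hleft i hi)
          obtain ⟨a, ha, b, hb, ha', hb', hne, ⟨s, t, hs, ht, -, hst⟩, hcons⟩ :=
            exists_consecutive hab P.finite_toSet (hleft i hi) (hright i hi) hx hxP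
          rw [← hst, smul_add, smul_smul, smul_smul]
          rcases trichotomous_of WellOrderingRel a b with h | h | h
          · have he : (a, b) ∈ E := (hE _).2 ⟨⟨ha, hb⟩, h, ⟨i, hi, ha', hb'⟩, hcons⟩
            exact mem_graphCone_of_edge he (by positivity) (by positivity)
          · exact absurd h hne
          · have he : (b, a) ∈ E := (hE _).2 ⟨⟨hb, ha⟩, h, ⟨i, hi, hb', ha'⟩, fun z hz => by
              rw [openSegment_symm]; exact hcons z hz⟩
            rw [add_comm]
            exact mem_graphCone_of_edge he (by positivity) (by positivity)
  refine ⟨{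
    P := P, E := E, p := p
    left_mem := fun e he => ((hE e).1 he).1.1
    right_mem := fun e he => ((hE e).1 he).1.2
    ray := fun v hv w hw c hc h => ?_
    p_ne_zero := hp0
    indep := fun v hv => ?_
    indep_edge := fun e he => ?_
    stack := fun e he α β τ hα hβ h => ?_
    disj := fun e he e' he' α β α' β' hα hβ hα' hβ' h => ?_
    notray := fun e he v hv α β c hα hβ hc h => ?_ }, hcone⟩
  · exact eq_of_smul_eq_smul_of_norm (hPunit w hw) (hPunit v hv) one_pos hc.le (by simpa using h)
  · obtain ⟨i, hi, hvi⟩ := hPseg v hv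
    have hv0 : v ≠ 0 := by
      rintro rfl
      simpa using hPunit 0 hv
    rw [LinearIndependent.pair_iff]
    intro s t h
    have hs : s = 0 := by
      by_contra hs
      refine hpi i hi ((Submodule.smul_mem_iff _ hs).1 ?_)
      rw [eq_neg_of_add_eq_zero_left h]
      exact Submodule.neg_mem _ (Submodule.smul_mem _ _ (mem_span_of_mem_segment hvi))
    subst hs
    simpa [hv0] using h
  · refine (linearIndependent_of_unit (hEunit e he) (hEne e he)).finCons ?_
    rw [range_pair]
    intro h
    obtain ⟨i, hi, hsub, -⟩ := hEseg e he
    have h1 : Submodule.span ℝ {e.1, e.2} ≤ sp i := by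
      rw [Submodule.span_le]
      rintro _ (rfl | rfl)
      exacts [mem_span_of_mem_segment (hsub (left_mem_segment _ _ _)),
        mem_span_of_mem_segment (hsub (right_mem_segment _ _ _))]
    exact hpi i hi (h1 h)
  · obtain ⟨u, hu, hsu⟩ := exists_unit_of_comb (x := e.1) (y := e.2) hα hβ
    obtain ⟨i, hi, hsub, -⟩ := hEseg e he
    have hui := hsub (openSegment_subset_segment _ _ _ hu)
    have h0 : 0 < α + β := by positivity
    rw [hsu] at h
    by_contra hτ
    rcases (hcone _).1 h with h | ⟨c, hc, j, hj, x, hx, h⟩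
    · refine hpi i hi ((Submodule.smul_mem_iff _ hτ).1 ?_)
      rw [eq_neg_of_add_eq_zero_right h]
      exact Submodule.neg_mem _ (Submodule.smul_mem _ _ (mem_span_of_mem_segment hui))
    -- If `τ` were nonzero, the interior point `u` would lie over the segment `j`. Not being a
    -- vertex, it is no isolated crossing, so `sp i ≤ sp j`, which puts `p` into `sp j`.
    · have hτp : τ • p = c • x - (α + β) • u := by rw [← h]; module
      have h1 : u ∈ Submodule.span ℝ {p, j.1, j.2} := by
        rw [← Submodule.smul_mem_iff _ h0.ne']
        have : (α + β) • u = c • x - τ • p := by rw [hτp]; module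
        rw [this]
        exact Submodule.sub_mem _ (Submodule.smul_mem _ _ (hle j (mem_span_of_mem_segment hx)))
          (Submodule.smul_mem _ _ (Submodule.subset_span (by simp)))
      have h2 := hspan i hi j hj u hui (hEP e he u hu) h1
      refine hpi j hj ((Submodule.smul_mem_iff _ hτ).1 ?_)
      rw [hτp]
      exact Submodule.sub_mem _ (Submodule.smul_mem _ _ (mem_span_of_mem_segment hx))
        (Submodule.smul_mem _ _ (h2 (mem_span_of_mem_segment hui)))
  -- Edges meeting in an interior ray share a point `u` of the sphere. As `u` is no vertex, their
  -- planes coincide, and additivity of the norm puts them on one line. Since neither contains a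
  -- vertex in its interior, they agree up to orientation, which the well-ordering fixes.
  · obtain ⟨u, hu, hsu⟩ := exists_unit_of_comb (x := e.1) (y := e.2) hα hβ
    obtain ⟨u', hu', hsu'⟩ := exists_unit_of_comb (x := e'.1) (y := e'.2) hα' hβ'
    have hus := openSegment_subset_segment _ _ _ hu
    have hus' := openSegment_subset_segment _ _ _ hu'
    rw [hsu, hsu'] at h
    obtain rfl := eq_of_smul_eq_smul_of_norm (hEunit e he u hus) (hEunit e' he' u' hus')
      (by positivity) (by positivity) h
    obtain ⟨i, hi, hsub, hspi⟩ := hEseg e he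
    obtain ⟨j, hj, hsub', hspj⟩ := hEseg e' he'
    have hji := hspan j hj i hi u (hsub' hus') (hEP e he u hu)
      (hle i (mem_span_of_mem_segment (hsub hus)))
    have hcoord : ∀ x ∈ segment ℝ j.1 j.2, ∃ a b : ℝ, x = a • e.1 + b • e.2 := by
      intro x hx
      obtain ⟨a, b, h⟩ := Submodule.mem_span_pair.1 (hspi (hji (mem_span_of_mem_segment hx)))
      exact ⟨a, b, h.symm⟩
    have hline : ∀ x y, segment ℝ x y ⊆ segment ℝ j.1 j.2 → u ∈ openSegment ℝ x y →
        ∃ r : ℝ, x = e.1 + r • (e.2 - e.1) := by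
      intro x y hxy huxy
      obtain ⟨a, b, hab⟩ := hcoord x (hxy (left_mem_segment _ _ _))
      have h1 := sum_eq_one_of_cross (hEunit e he) (fun z hz => hI j hj z (hxy hz)) hu huxy hab
      refine ⟨b, ?_⟩
      rw [hab, show a = 1 - b by linarith]
      module
    obtain ⟨r, hr⟩ := hline _ _ hsub' hu'
    obtain ⟨r', hr'⟩ := hline e'.2 e'.1 (by rwa [segment_symm]) (by rwa [openSegment_symm])
    have hEmem := (hE e).1 he
    have hEmem' := (hE e').1 he'
    rcases eq_or_swap_of_collinear (hEne e he) hu hu' hr hr'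
      (hEmem.2.2.2 _ hEmem'.1.1) (hEmem.2.2.2 _ hEmem'.1.2)
      (hEmem'.2.2.2 _ hEmem.1.1) (hEmem'.2.2.2 _ hEmem.1.2) with ⟨h1, h2⟩ | ⟨h1, h2⟩
    · exact Prod.ext h1.symm h2.symm
    · have h3 := hEmem'.2.1
      rw [h1, h2] at h3
      exact absurd h3 (asymm_of WellOrderingRel hEmem.2.1)
  · obtain ⟨u, hu, hsu⟩ := exists_unit_of_comb (x := e.1) (y := e.2) hα hβ
    rw [hsu] at h
    have := eq_of_smul_eq_smul_of_norm (hEunit e he u (openSegment_subset_segment _ _ _ hu))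
      (hPunit v hv) (by positivity) hc h
    exact hEP e he u hu (this ▸ hv)

end Build

/-! ### The triangle wave. -/

section TriangleWave

/-- The triangle wave of period two with `tri 0 = 1` and `tri 1 = -1`. -/
noncomputable def tri (s : ℝ) : ℝ := 1 - 2 / Real.pi * Real.arccos (Real.cos (Real.pi * s))

/-- The sign character. -/
def sg (a : ZMod 2) : ℝ := if a = 0 then 1 else -1

theorem zmod_two_cases (a : ZMod 2) : a = 0 ∨ a = 1 := by
  revert a; decide

theorem sg_add (a b : ZMod 2) : sg (a + b) = sg a * sg b := by
  have h : (1 : ZMod 2) + 1 = 0 := by decide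
  rcases zmod_two_cases a with rfl | rfl <;> rcases zmod_two_cases b with rfl | rfl <;>
    simp [sg, h]

theorem abs_sg (a : ZMod 2) : |sg a| = 1 := by
  rcases zmod_two_cases a with rfl | rfl <;> simp [sg]

theorem sg_eq_or (a : ZMod 2) : sg a = 1 ∨ sg a = -1 := by
  rcases zmod_two_cases a with rfl | rfl <;> simp [sg]

theorem tri_add_one (s : ℝ) : tri (s + 1) = - tri s := by
  have h : Real.cos (Real.pi * (s + 1)) = - Real.cos (Real.pi * s) := by
    rw [mul_add, mul_one, Real.cos_add_pi]
  rw [tri, tri, h, Real.arccos_neg]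
  field_simp
  ring

theorem tri_add_int (s : ℝ) (n : ℤ) : tri (s + n) = sg n * tri s := by
  have h1 : ∀ m : ℤ, sg ((m + 1 : ℤ) : ZMod 2) = - sg m := fun m => by
    rw [Int.cast_add, sg_add]; simp [sg]
  induction n using Int.induction_on with
  | zero => simp [sg]
  | succ n ih =>
    rw [h1, Int.cast_add, ← add_assoc, Int.cast_one, tri_add_one, ih, neg_mul]
  | pred n ih =>
    have h2 := h1 (-n - 1)
    have h3 := tri_add_one (s + ((-n - 1 : ℤ) : ℝ))
    rw [sub_add_cancel] at h2
    rw [show s + ((-n - 1 : ℤ) : ℝ) + 1 = s + ((-n : ℤ) : ℝ) by push_cast; ring, ih, h2] at h3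
    linarith

theorem continuous_tri : Continuous tri := by
  unfold tri
  have := Real.continuous_arccos
  fun_prop

theorem abs_tri_le (s : ℝ) : |tri s| ≤ 1 := by
  have h0 := Real.arccos_nonneg (Real.cos (Real.pi * s))
  have h1 := Real.arccos_le_pi (Real.cos (Real.pi * s))
  have hpi := Real.pi_pos
  have h2 : 2 / Real.pi * Real.arccos (Real.cos (Real.pi * s)) ≤ 2 := by
    rw [div_mul_eq_mul_div, div_le_iff₀ hpi]
    linarith
  have h3 : 0 ≤ 2 / Real.pi * Real.arccos (Real.cos (Real.pi * s)) := by positivity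
  rw [tri, abs_le]
  constructor <;> linarith

theorem cos_eq_zero_of_tri_eq_zero {s : ℝ} (h : tri s = 0) : Real.cos (Real.pi * s) = 0 := by
  have hpi := Real.pi_pos
  have h1 : Real.arccos (Real.cos (Real.pi * s)) = Real.pi / 2 := by
    unfold tri at h
    field_simp at h
    linarith
  exact Real.arccos_eq_pi_div_two.1 h1

/-- Zeros of the wave are zeros of cos(πs), and after a shift by a quarter period they are zeros of
sin(πs). So the closed planar curve with these two coordinates misses the origin. -/
theorem tri_ne_zero_or (s : ℝ) : tri s ≠ 0 ∨ tri (s - 1 / 2) ≠ 0 := by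
  by_contra! h
  have h1 := cos_eq_zero_of_tri_eq_zero h.1
  have h2 := cos_eq_zero_of_tri_eq_zero h.2
  rw [show Real.pi * (s - 1 / 2) = Real.pi * s - Real.pi / 2 by ring, Real.cos_sub_pi_div_two] at h2
  have := Real.sin_sq_add_cos_sq (Real.pi * s)
  rw [h1, h2] at this
  norm_num at this

theorem exists_tri_eq (s : ℝ) : ∃ k : ℤ, |(k : ℝ)| ≤ |s| + 1 ∧ tri s = 1 - 2 * |s - 2 * k| := by
  have h := abs_sub_round (s / 2)
  refine ⟨round (s / 2), ?_, ?_⟩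
  · rw [abs_le] at *
    have := abs_le.1 (le_refl |s|)
    constructor <;> linarith [abs_nonneg s]
  · have h1 : |s - 2 * round (s / 2)| ≤ 1 := by
      rw [abs_le] at *
      constructor <;> linarith
    have h2 : Real.cos (Real.pi * s) = Real.cos (Real.pi * |s - 2 * round (s / 2)|) := by
      rw [← Real.cos_abs (Real.pi * |_|), abs_mul, abs_abs, ← abs_mul, Real.cos_abs,
        ← Real.cos_sub_int_mul_two_pi (Real.pi * s) (round (s / 2))]
      congr 1
      ring
    have hpi := Real.pi_pos
    rw [tri, h2, Real.arccos_cos (by positivity) (mul_le_of_le_one_right hpi.le h1)]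
    field_simp

/-- The right side involves no division: as long as `Φ / T` is bounded, only finitely many `k`
occur, so the product has finitely many affine branches in terms of `Φ` and `T`. -/
theorem exists_mul_tri_eq {T : ℝ} (hT : 0 < T) (Φ : ℝ) :
    ∃ k : ℤ, |(k : ℝ)| ≤ |Φ / T| + 1 ∧ T * tri (Φ / T) = T - 2 * |Φ - 2 * k * T| := by
  obtain ⟨k, hk, h⟩ := exists_tri_eq (Φ / T)
  refine ⟨k, hk, ?_⟩
  have h1 : Φ - 2 * k * T = T * (Φ / T - 2 * k) := by field_simp
  rw [h, h1, abs_mul, abs_of_pos hT]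
  ring

end TriangleWave

/-! ### Finitely many chambers, and PL functions with prescribed zero set. -/

section Arrangement

variable {V : Type*} [NormedAddCommGroup V] [NormedSpace ℝ V] {H : Set (V →ₗ[ℝ] ℝ)}

/-- Finitely many general points meet all open stars. -/
theorem exists_finite_gen [FiniteDimensional ℝ V] (hH : H.Finite) (h0 : ∀ l ∈ H, l ≠ 0) :
    ∃ Z ⊆ Gen H, Z.Finite ∧ ∀ y, ∃ z ∈ Z, z ∈ Star H y := by
  have : Finite H := hH
  let σ : V → H → SignType := fun y l => SignType.sign ((l : V →ₗ[ℝ] ℝ) y)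
  -- One general point is chosen for each sign vector that occurs.
  obtain ⟨Z, hZ, hbij⟩ := Set.exists_subset_bijOn (Gen H) σ
  refine ⟨Z, hZ, Set.Finite.of_finite_image (Set.toFinite (σ '' Z)) hbij.injOn, fun y => ?_⟩
  obtain ⟨z', hz', hzg⟩ := exists_mem_gen hH h0 (isOpen_star hH y) ⟨y, mem_star_self y⟩
  obtain ⟨z, hz, he⟩ := hbij.surjOn ⟨z', hzg, rfl⟩
  refine ⟨z, hz, fun l hl hy => ?_⟩
  have h1 := hz' l hl hy
  have h2 : SignType.sign (l z) = SignType.sign (l z') := congrFun he ⟨l, hl⟩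
  rw [← sign_eq_one_iff, sign_mul] at h1 ⊢
  rwa [h2]

theorem mem_star_iff_of_gen {y z : V} (hz : z ∈ Gen H) :
    z ∈ Star H y ↔ ∀ l ∈ H, 0 ≤ l y * l z := by
  constructor
  · intro h l hl
    by_cases h0 : l y = 0
    · simp [h0]
    · exact (h l hl h0).le
  · intro h l hl h0
    exact (h l hl).lt_of_ne' (mul_ne_zero h0 (hz l hl))

/-- No form vanishes at a general `z`, so the strict inequalities may be weakened, and the set is
the closed chamber of `z`. Finitely many such sets cover the space and serve as the pieces for
pasting. -/
theorem isClosed_setOf_mem_star [FiniteDimensional ℝ V] {z : V} (hz : z ∈ Gen H) :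
    IsClosed {y | z ∈ Star H y} := by
  simp only [mem_star_iff_of_gen hz, Set.ofPred_forall]
  exact isClosed_biInter fun l _ =>
    isClosed_le continuous_const (l.continuous_of_finiteDimensional.mul continuous_const)

/-- A nonnegative piecewise linear function that vanishes exactly on a finite union of cones. -/
theorem exists_gauge [FiniteDimensional ℝ V] (hH : H.Finite) {E : Type*} [NormedAddCommGroup E]
    [NormedSpace ℝ E] {X : Set E} {g : X → V} (hg : IsFinAffine g) {𝒯 : Set (Set V)}
    (h𝒯 : 𝒯.Finite) (hcut : ∀ C ∈ 𝒯, CutBy H C) :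
    ∃ t : V → ℝ, Continuous t ∧ (∀ y, 0 ≤ t y) ∧ (∀ y, t y = 0 ↔ ∃ C ∈ 𝒯, y ∈ C) ∧
      IsFinAffine fun x => t (g x) := by
  induction 𝒯, h𝒯 using Set.Finite.induction_on with
  | empty => exact ⟨fun _ => 1, continuous_const, by simp, by simp, IsFinAffine.const 1⟩
  | @insert C 𝒯 _ _ ih =>
    obtain ⟨t, htc, ht0, ht, hta⟩ := ih fun C hC => hcut C (Set.mem_insert_of_mem _ hC)
    obtain ⟨H', hH', rfl⟩ := hcut C (Set.mem_insert _ _)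
    let K := (hH.subset hH').toFinset
    have hK : ∀ l, l ∈ K ↔ l ∈ H' := fun l => (hH.subset hH').mem_toFinset
    let τ : V → ℝ := fun y => ∑ l ∈ K, max 0 (-l y)
    have hτ0 : ∀ y, 0 ≤ τ y := fun y => Finset.sum_nonneg fun l _ => le_max_left _ _
    have hτ : ∀ y, τ y = 0 ↔ ∀ l ∈ H', 0 ≤ l y := fun y => by
      rw [Finset.sum_eq_zero_iff_of_nonneg fun l _ => le_max_left _ _]
      simp [hK]
    refine ⟨fun y => min (t y) (τ y), htc.min ?_, fun y => le_min (ht0 y) (hτ0 y), fun y => ?_,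
      hta.min ?_⟩
    · refine continuous_finsetSum _ fun l _ => ?_
      exact continuous_const.max l.continuous_of_finiteDimensional.neg
    · rw [Set.exists_mem_insert, ← ht, Set.mem_ofPred_eq, ← hτ]
      change min (t y) (τ y) = 0 ↔ _
      constructor
      · intro h
        rcases min_choice (t y) (τ y) with h' | h' <;> rw [h'] at h
        exacts [Or.inr h, Or.inl h]
      · rintro (h | h) <;> rw [h]
        exacts [min_eq_right (ht0 y), min_eq_left (hτ0 y)]
    · exact IsFinAffine.sum _ fun l _ => (IsFinAffine.const 0).max (hg.comp_linear l).neg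

end Arrangement

/-! ### The tubular neighbourhood in Euclidean space. -/

section Tube

theorem continuous_collar : Continuous fun q : ℝ × ℝ => collar q.1 q.2 := by
  unfold collar
  refine Continuous.if_le ?_ ?_ continuous_const continuous_fst ?_
  · fun_prop
  · fun_prop
  · rintro ⟨t, x⟩ (rfl : 0 = t)
    simp only [neg_zero]
    have h : max 0 (min 0 (x / 2)) = 0 := max_eq_left (min_le_left _ _)
    rw [h]; ring

theorem clamp_sub_le {t x y : ℝ} (hxy : x ≤ y) :
    max (-t) (min t y) - max (-t) (min t x) ≤ y - x := by
  rcases max_choice (-t) (min t y) with h | h <;> rw [h]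
  · linarith [le_max_left (-t) (min t x)]
  · rcases min_choice t x with h' | h'
    · linarith [le_max_right (-t) (min t x), min_le_left t y]
    · linarith [le_max_right (-t) (min t x), min_le_right t y]

theorem clamp_mono {t x y : ℝ} (hxy : x ≤ y) : max (-t) (min t x) ≤ max (-t) (min t y) :=
  max_le_max le_rfl (min_le_min le_rfl hxy)

/-- The term added to or subtracted from `x` is a truncation of `x / 2`, hence monotone with slope
at most one half, and neither sign destroys strict monotonicity. -/
theorem collar_strictMono (t : ℝ) : StrictMono (collar t) := by
  intro x y hxy
  have h1 : x / 2 ≤ y / 2 := by linarith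
  unfold collar
  split_ifs with ht
  · linarith [clamp_mono (t := t) h1]
  · have := clamp_sub_le (t := -t) h1
    rw [neg_neg] at this
    linarith

theorem abs_collar_le {t x : ℝ} (ht : |t| ≤ 1 / 2) (hx : |x| ≤ 1) : |collar t x| ≤ 1 + t := by
  rw [abs_le] at ht hx ⊢
  have h1 := (collar_strictMono t).monotone hx.1
  have h2 := (collar_strictMono t).monotone hx.2
  have h3 : collar t 1 = 1 + t ∧ collar t (-1) = -(1 + t) := by
    unfold collar
    split_ifs with h0
    · constructor
      · rw [min_eq_left (by linarith), max_eq_right (by linarith)]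
      · rw [min_eq_right (by linarith), max_eq_left (by linarith)]; ring
    · constructor
      · rw [min_eq_left (by linarith), max_eq_right (by linarith)]; ring
      · rw [min_eq_right (by linarith), max_eq_left (by linarith)]; ring
  constructor <;> linarith [h3.1, h3.2]

theorem abs_collar_eq {t x : ℝ} (ht : |t| ≤ 1 / 2) (hx : |x| = 1) : |collar t x| = 1 + t := by
  rw [abs_le] at ht
  unfold collar
  rcases (abs_eq zero_le_one).1 hx with rfl | rfl <;> split_ifs with h0
  · rw [min_eq_left (by linarith), max_eq_right (by linarith), abs_of_nonneg (by linarith)]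
  · rw [min_eq_left (by linarith), max_eq_right (by linarith), abs_of_nonneg (by linarith)]; ring
  · rw [min_eq_right (by linarith), max_eq_left (by linarith), abs_of_nonpos (by linarith)]; ring
  · rw [min_eq_right (by linarith), max_eq_left (by linarith), abs_of_nonpos (by linarith)]; ring

/-- The sup norm of the first coordinates is `1 + a 0 / 2`, which recovers the collar parameter.
Strict monotonicity of `collar` in each coordinate then recovers the point of the sphere. -/
theorem tubeInclusion_injective {m : ℕ} : Function.Injective (tubeInclusion (m := m)) := by
  rintro ⟨⟨a, x⟩, ha, hx⟩ ⟨⟨b, y⟩, hb, hy⟩ h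
  rw [tubeInclusion, tubeInclusion, Fin.snoc_inj] at h
  obtain ⟨h1, h2⟩ := h
  simp only at h1 h2
  have bound : ∀ a : Fin 2 → ℝ, a ∈ Disc 2 → |a 0 / 2| ≤ 1 / 2 := fun a ha => by
    have := (norm_le_pi_norm a 0).trans (mem_closedBall_zero_iff.1 ha)
    rw [Real.norm_eq_abs] at this
    rw [abs_div, abs_two]
    linarith
  have key : ∀ a x (_ : a ∈ Disc 2) (_ : x ∈ Sphere m),
      ‖fun i => collar (a 0 / 2) (x i)‖ = 1 + a 0 / 2 := by
    intro a x ha hx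
    have hb := bound a ha
    rw [Sphere, mem_sphere_zero_iff_norm] at hx
    have hpos : 0 ≤ 1 + a 0 / 2 := by rw [abs_le] at hb; linarith
    refine le_antisymm ((pi_norm_le_iff_of_nonneg hpos).2 fun i =>
      abs_collar_le hb ((norm_le_pi_norm x i).trans_eq hx)) ?_
    obtain ⟨i, hi⟩ : ∃ i, |x i| = 1 := by
      obtain ⟨i, hi⟩ := Finite.exists_max fun i => ‖x i‖
      refine ⟨i, le_antisymm ((norm_le_pi_norm x i).trans_eq hx) ?_⟩
      rw [← hx]
      exact (pi_norm_le_iff_of_nonneg (norm_nonneg _)).2 hi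
    rw [← abs_collar_eq hb hi]
    exact norm_le_pi_norm (fun i => collar (a 0 / 2) (x i)) i
  have h0 : a 0 = b 0 := by
    have := key a x ha hx
    rw [h1, key b y hb hy] at this
    linarith
  rw [h0] at h1
  have hxy : x = y := funext fun i => (collar_strictMono _).injective (congrFun h1 i)
  have hab : a = b := by
    ext i
    fin_cases i
    exacts [h0, h2]
  subst hxy hab
  rfl

theorem isFinAffine_collar {E : Type*} [NormedAddCommGroup E] [NormedSpace ℝ E] {X : Set E}
    {t x : X → ℝ} (ht : IsFinAffine t) (hx : IsFinAffine x) :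
    IsFinAffine fun z => collar (t z) (x z) := by
  have hx2 : IsFinAffine fun z => x z / 2 := by
    simpa [div_eq_inv_mul] using hx.const_smul (2 : ℝ)⁻¹
  refine IsFinAffine.of_or (hx.add (ht.neg.max (ht.min hx2))) (hx.sub (ht.max (ht.neg.min hx2)))
    fun z => ?_
  unfold collar
  split_ifs
  exacts [Or.inl rfl, Or.inr rfl]

theorem isFinAffine_tubeInclusion {E : Type*} [NormedAddCommGroup E] [NormedSpace ℝ E] {X : Set E}
    {m : ℕ} {g : X → Tube m}
    (hg : IsFinAffine fun x => (g x : (Fin 2 → ℝ) × (Fin (m + 1) → ℝ))) :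
    IsFinAffine fun x => tubeInclusion (g x) := by
  have h1 : ∀ i, IsFinAffine fun x => (g x).1.1 i := fun i =>
    hg.comp_linear ((LinearMap.proj i).comp (LinearMap.fst ℝ _ _))
  have h2 : ∀ i, IsFinAffine fun x => (g x).1.2 i := fun i =>
    hg.comp_linear ((LinearMap.proj i).comp (LinearMap.snd ℝ _ _))
  have h3 : IsFinAffine fun x => (g x).1.1 0 / 2 := by
    simpa [div_eq_inv_mul] using (h1 0).const_smul (2 : ℝ)⁻¹
  refine IsFinAffine.pi fun i => ?_
  induction i using Fin.lastCases with
  | last => simpa [tubeInclusion] using h1 1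
  | cast i => simpa [tubeInclusion] using isFinAffine_collar h3 (h2 i)

theorem continuous_tubeInclusion {m : ℕ} : Continuous (tubeInclusion (m := m)) := by
  refine continuous_pi fun i => ?_
  induction i using Fin.lastCases with
  | last =>
    simp only [tubeInclusion, Fin.snoc_last]
    fun_prop
  | cast i =>
    simp only [tubeInclusion, Fin.snoc_castSucc]
    exact continuous_collar.comp (by fun_prop : Continuous fun q : Tube m => (q.1.1 0 / 2, q.1.2 i))

end Tube

/-! ### Comparing sections and sheets of the covering. -/

open Classical in
/-- The label that tells whether two points are different. -/
noncomputable def diffLabel {M : Type*} (a b : M) : ZMod 2 := if a = b then 0 else 1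

theorem diffLabel_comm {M : Type*} (a b : M) : diffLabel a b = diffLabel b a := by
  by_cases h : a = b
  · rw [h]
  · rw [diffLabel, diffLabel, if_neg h, if_neg (Ne.symm h)]

/-- The pasting lemma at one point, for finitely many pieces: those not containing `x₀` are absent
near it, and the others carry continuous branches. -/
theorem continuousAt_of_finite_closed {M W ι : Type*} [TopologicalSpace M] [TopologicalSpace W]
    {h : M → W} {x₀ : M} {Z : Set ι} (hZ : Z.Finite) {A : ι → Set M} {g : ι → M → W}
    (hA : ∀ z ∈ Z, x₀ ∉ A z → ∀ᶠ x in 𝓝 x₀, x ∉ A z)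
    (hcover : ∀ᶠ x in 𝓝 x₀, ∃ z ∈ Z, x ∈ A z) (hg : ∀ z ∈ Z, x₀ ∈ A z → ContinuousAt (g z) x₀)
    (hgh : ∀ᶠ x in 𝓝 x₀, ∀ z ∈ Z, x ∈ A z → h x = g z x) : ContinuousAt h x₀ := by
  intro O hO
  have h1 : ∀ z ∈ Z, ∀ᶠ x in 𝓝 x₀, x ∈ A z → g z x ∈ O := by
    intro z hz
    by_cases hx : x₀ ∈ A z
    · have h2 := hgh.self_of_nhds z hz hx
      filter_upwards [hg z hz hx (h2 ▸ hO)] with x hx _ using hx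
    · filter_upwards [hA z hz hx] with x h h' using absurd h' h
  change ∀ᶠ x in 𝓝 x₀, h x ∈ O
  filter_upwards [hcover, hgh, (eventually_all_finite hZ).2 h1] with x ⟨z, hz, hxz⟩ h2 h3
  rw [h2 z hz hxz]
  exact h3 z hz hxz

section Lift

variable {V : Type*} [NormedAddCommGroup V] [NormedSpace ℝ V]

/-- A twofold branched covering of the unit sphere with branch set the trace of the cone of a
configuration, together with sections over the complements of the joins. -/
structure SectionData (D : Config V) {M : Type*} [TopologicalSpace M] (f : M → V) where
  /-- the section over the complement of the join with `p` -/
  base : V → M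
  /-- the sections over the complements of the other joins -/
  sect : V → V → M
  norm_map : ∀ x, ‖f x‖ = 1
  continuousOn_base : ContinuousOn base (D.U D.p)
  continuousOn_sect : ∀ q ∈ D.Q, ContinuousOn (sect q) (D.U q)
  map_base : ∀ y ∈ D.U D.p, f (base y) = ‖y‖⁻¹ • y
  map_sect : ∀ q ∈ D.Q, ∀ y ∈ D.U q, f (sect q y) = ‖y‖⁻¹ • y
  injOn : ∀ x, f x ∉ graphCone D.P D.E → ∃ W ∈ 𝓝 x, Set.InjOn f W
  lifts : ∀ K : Set V, IsPreconnected K → ∀ g₁ g₂ : V → M, ContinuousOn g₁ K → ContinuousOn g₂ K →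
    (∀ a ∈ K, f (g₁ a) = f (g₂ a)) → (∀ a ∈ K, f (g₁ a) ∉ graphCone D.P D.E) →
    ∀ a ∈ K, g₁ a = g₂ a → K.EqOn g₁ g₂
  fibre : ∀ x y z, f x = f y → f y = f z → x ≠ y → y ≠ z → x = z
  fibre_branch : ∀ x y, f x = f y → f x ∈ graphCone D.P D.E → x = y

namespace SectionData

theorem graphCone_smul_mem {D : Config V} {y : V} {c : ℝ} (hc : 0 < c)
    (h : c • y ∈ graphCone D.P D.E) : y ∈ graphCone D.P D.E := by
  obtain ⟨s, hs, h⟩ := h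
  refine ⟨s, hs, ?_⟩
  have := smul_mem_coneOf h (inv_nonneg.2 hc.le)
  rwa [inv_smul_smul₀ hc.ne'] at this

variable {D : Config V} {M : Type*} [TopologicalSpace M] {f : M → V} (S : SectionData D f)

include S in
theorem diffLabel_add {a b c : M} (hab : f a = f b) (hbc : f b = f c) :
    diffLabel a b + diffLabel b c = diffLabel a c := by
  by_cases h1 : a = b
  · subst h1
    rw [diffLabel, if_pos rfl, zero_add]
  · by_cases h2 : b = c
    · subst h2; simp [diffLabel, h1]
    · have h3 : (1 : ZMod 2) + 1 = 0 := by decide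
      rw [diffLabel, diffLabel, diffLabel, if_neg h1, if_neg h2,
        if_pos (S.fibre a b c hab hbc h1 h2), h3]

theorem notMem_of_unit {q y : V} (hy : y ∈ D.U q) : ‖y‖⁻¹ • y ∉ graphCone D.P D.E := by
  have hy' : y ∉ graphCone D.P D.E := fun h => hy (graphCone_subset_graphJoin _ _ _ h)
  have h0 : y ≠ 0 := by
    rintro rfl
    exact hy' ⟨∅, Or.inl (Or.inl rfl), zero_mem_coneOf _⟩
  exact fun h => hy' (graphCone_smul_mem (inv_pos.2 (norm_pos_iff.2 h0)) h)

include S in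
theorem diffLabel_const {K : Set V} (hK : IsPreconnected K) {g₁ g₂ : V → M}
    (h₁ : ContinuousOn g₁ K) (h₂ : ContinuousOn g₂ K) (h : ∀ a ∈ K, f (g₁ a) = f (g₂ a))
    (hL : ∀ a ∈ K, f (g₁ a) ∉ graphCone D.P D.E) {a b : V} (ha : a ∈ K) (hb : b ∈ K) :
    diffLabel (g₁ a) (g₂ a) = diffLabel (g₁ b) (g₂ b) := by
  have key := S.lifts K hK g₁ g₂ h₁ h₂ h hL
  by_cases hab : g₁ a = g₂ a
  · rw [diffLabel, diffLabel, if_pos hab, if_pos (key a ha hab hb)]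
  · rw [diffLabel, diffLabel, if_neg hab, if_neg fun h => hab (key b hb h ha)]

/-- The labels that compare the sections with the base section. -/
noncomputable def label (q y : V) : ZMod 2 := diffLabel (S.base y) (S.sect q y)

theorem diffLabel_sect_const {q q' : V} (hq : q ∈ D.Q) (hq' : q' ∈ D.Q) {K : Set V}
    (hK : IsPreconnected K) (h : K ⊆ D.U q) (h' : K ⊆ D.U q') {a b : V} (ha : a ∈ K) (hb : b ∈ K) :
    diffLabel (S.sect q a) (S.sect q' a) = diffLabel (S.sect q b) (S.sect q' b) :=
  S.diffLabel_const hK ((S.continuousOn_sect q hq).mono h) ((S.continuousOn_sect q' hq').mono h')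
    (fun a ha => by rw [S.map_sect q hq a (h ha), S.map_sect q' hq' a (h' ha)])
    (fun a ha => by rw [S.map_sect q hq a (h ha)]; exact notMem_of_unit (h ha)) ha hb

theorem label_add {q q' y : V} (hq : q ∈ D.Q) (hq' : q' ∈ D.Q) (hp : y ∈ D.U D.p) (hy : y ∈ D.U q)
    (hy' : y ∈ D.U q') : S.label q y + S.label q' y = diffLabel (S.sect q y) (S.sect q' y) := by
  rw [label, label, diffLabel_comm (S.base y) (S.sect q y)]
  refine S.diffLabel_add ?_ ?_
  · rw [S.map_base y hp, S.map_sect q hq y hy]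
  · rw [S.map_base y hp, S.map_sect q' hq' y hy']

theorem isLabelling : D.IsLabelling S.label where
  const q hq K hK hp h a ha b hb :=
    S.diffLabel_const hK (S.continuousOn_base.mono hp) ((S.continuousOn_sect q hq).mono h)
      (fun a ha => by rw [S.map_base a (hp ha), S.map_sect q hq a (h ha)])
      (fun a ha => by rw [S.map_base a (hp ha)]; exact notMem_of_unit (hp ha)) ha hb
  const_add q hq q' hq' K hK h h' a ha hap b hb hbp := by
    rw [S.label_add hq hq' hap (h ha) (h' ha), S.label_add hq hq' hbp (h hb) (h' hb)]
    exact S.diffLabel_sect_const hq hq' hK h h' ha hb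

theorem map_sect_apply {q : V} (hq : q ∈ D.Q) {x : M} (hx : f x ∈ D.U q) :
    f (S.sect q (f x)) = f x := by
  rw [S.map_sect q hq _ hx, S.norm_map, inv_one, one_smul]

/-- The label that tells on which sheet a point lies with respect to a section. -/
noncomputable def sheet (q : V) (x : M) : ZMod 2 := diffLabel x (S.sect q (f x))

/-- A point on the section stays on it because `f` is injective near the point; a point off the
section stays off it because `M` is Hausdorff. -/
theorem eventually_sheet_eq [FiniteDimensional ℝ V] [T2Space M] (hf : Continuous f) {q : V}
    (hq : q ∈ D.Q) {x₀ : M} (hx₀ : f x₀ ∈ D.U q) :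
    ∀ᶠ x in 𝓝 x₀, S.sheet q x = S.sheet q x₀ := by
  have hU : ∀ᶠ x in 𝓝 x₀, f x ∈ D.U q :=
    hf.continuousAt.eventually_mem ((D.isOpen_U hq).mem_nhds hx₀)
  have hc : ContinuousAt (fun x => S.sect q (f x)) x₀ :=
    ContinuousAt.comp (f := f) (g := S.sect q)
      ((S.continuousOn_sect q hq).continuousAt ((D.isOpen_U hq).mem_nhds hx₀)) hf.continuousAt
  by_cases h : x₀ = S.sect q (f x₀)
  · obtain ⟨W, hW, hinj⟩ := S.injOn x₀ fun h' => hx₀ (graphCone_subset_graphJoin _ _ _ h')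
    have hW' : W ∈ 𝓝 (S.sect q (f x₀)) := h ▸ hW
    filter_upwards [hU, hW, hc.eventually_mem hW'] with x h1 h2 h3
    have h4 : x = S.sect q (f x) := hinj h2 h3 (S.map_sect_apply hq h1).symm
    rw [sheet, sheet, diffLabel, diffLabel, if_pos h, if_pos h4]
  · have h1 : ∀ᶠ x in 𝓝 x₀, x ≠ S.sect q (f x) :=
      (continuousAt_id.prodMk hc).eventually_mem
        (isClosed_diagonal.isOpen_compl.mem_nhds (x := (x₀, S.sect q (f x₀))) h)
    filter_upwards [h1] with x h1
    rw [sheet, sheet, diffLabel, diffLabel, if_neg h, if_neg h1]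

/-- Each side tells whether `x` is off the sheet that the base section selects in the chamber of
`z`. The comparison of the sections of `q` and `q'`, which does not involve the base section, is
transported from `f x` to `z` inside the star. -/
theorem sheet_add_label {q q' : V} (hq : q ∈ D.Q) (hq' : q' ∈ D.Q) {x : M} (hx : f x ∈ D.U q)
    (hx' : f x ∈ D.U q') {z : V} (hz : z ∈ Star D.H (f x)) (hzg : z ∈ Gen D.H) :
    S.sheet q x + S.label q z = S.sheet q' x + S.label q' z := by
  have h1 : S.sheet q x + S.sheet q' x =
      diffLabel (S.sect q (f x)) (S.sect q' (f x)) := by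
    rw [sheet, sheet, diffLabel_comm x (S.sect q (f x))]
    refine S.diffLabel_add (S.map_sect_apply hq hx) (S.map_sect_apply hq' hx').symm
  have h2 := S.label_add hq hq' (D.thin_p z hzg) (D.thin_q q hq z hzg) (D.thin_q q' hq' z hzg)
  have h3 := S.diffLabel_sect_const hq hq' (convex_star (H := D.H) (f x)).isPreconnected
    (D.star_subset_U hq hx) (D.star_subset_U hq' hx') (mem_star_self _) hz
  rw [← h1, ← h2] at h3
  generalize S.sheet q x = a, S.sheet q' x = b, S.label q z = c, S.label q' z = d at h3 ⊢
  revert a b c d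
  decide

end SectionData

end Lift

/-! ### The fibrewise embedding in the plane. -/

/-- The planar wave of height `T`. -/
noncomputable def wave (T Φ : ℝ) : Fin 2 → ℝ := fun i => T * tri ((Φ - ![0, T / 2] i) / T)

theorem wave_add_int_mul {T : ℝ} (hT : 0 < T) (Φ : ℝ) (n : ℤ) :
    wave T (Φ + n * T) = sg n • wave T Φ := by
  ext i
  have h : (Φ + n * T - ![0, T / 2] i) / T = (Φ - ![0, T / 2] i) / T + n := by
    field_simp; ring
  rw [Pi.smul_apply, wave, wave, h, tri_add_int, smul_eq_mul]
  ring

theorem norm_wave_le {T : ℝ} (hT : 0 ≤ T) (Φ : ℝ) : ‖wave T Φ‖ ≤ T := by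
  refine (pi_norm_le_iff_of_nonneg hT).2 fun i => ?_
  rw [wave, norm_mul, Real.norm_of_nonneg hT, Real.norm_eq_abs]
  exact mul_le_of_le_one_right hT (abs_tri_le _)

theorem wave_ne_zero {T : ℝ} (hT : 0 < T) (Φ : ℝ) : wave T Φ ≠ 0 := by
  intro h
  have h0 := congrFun h 0
  have h1 := congrFun h 1
  simp only [wave, Pi.zero_apply, mul_eq_zero, hT.ne', false_or, Matrix.cons_val_zero,
    Matrix.cons_val_one, Matrix.cons_val_fin_one, sub_zero] at h0 h1
  rw [show (Φ - T / 2) / T = Φ / T - 1 / 2 by field_simp] at h1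
  exact (tri_ne_zero_or (Φ / T)).elim (absurd h0) (absurd h1)

theorem continuousAt_wave {M : Type*} [TopologicalSpace M] {T Φ : M → ℝ} {x : M}
    (hT : ContinuousAt T x) (hΦ : ContinuousAt Φ x) (hx : T x ≠ 0) :
    ContinuousAt (fun x => wave (T x) (Φ x)) x := by
  refine continuousAt_pi.2 fun i => hT.mul ?_
  refine continuous_tri.continuousAt.comp' ((hΦ.sub ?_).div hT hx)
  fin_cases i
  · exact continuousAt_const
  · exact hT.div_const 2

/-- The shift by at most `T` adds one to the bound on the phase and rounding adds another, whence `R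
+ 2`. -/
theorem exists_wave_eq {T Φ R : ℝ} (hT : 0 < T) (hΦ : |Φ| ≤ R * T) (i : Fin 2) :
    ∃ k : ℤ, |(k : ℝ)| ≤ R + 2 ∧
      wave T Φ i = T - 2 * |Φ - ![0, T / 2] i - 2 * k * T| := by
  obtain ⟨k, hk, h⟩ := exists_mul_tri_eq hT (Φ - ![0, T / 2] i)
  refine ⟨k, hk.trans ?_, h⟩
  have h1 : |Φ - ![0, T / 2] i| ≤ (R + 1) * T := by
    have h2 : |![0, T / 2] i| ≤ T := by
      fin_cases i
      · simpa using hT.le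
      · simp only [Fin.mk_one, Matrix.cons_val_one, Matrix.cons_val_fin_one]
        rw [abs_of_pos (by positivity)]
        linarith
    have := abs_sub Φ (![0, T / 2] i)
    linarith
  have h3 : |(Φ - ![0, T / 2] i) / T| ≤ R + 1 := by
    rwa [abs_div, abs_of_pos hT, div_le_iff₀ hT]
  linarith

/-- A twofold branched covering with sections over the complements of the joins embeds fibrewise in
the plane. -/
theorem SectionData.exists_fibrewise_embedding {V : Type*} [NormedAddCommGroup V] [NormedSpace ℝ V]
    [FiniteDimensional ℝ V] {D : Config V} {E : Type*} [NormedAddCommGroup E] [NormedSpace ℝ E]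
    {X : Set E} {f : X → V} (S : SectionData D f) (hf : Continuous f) (hfa : IsFinAffine f) :
    ∃ h : X → Fin 2 → ℝ, Continuous h ∧ IsFinAffine h ∧
      ∀ x x', f x = f x' → h x = h x' → x = x' := by
  classical
  obtain ⟨N, -, hN1, hN2, R, hR⟩ :=
    S.isLabelling.exists_height (D.basis 0 (0, 0)).det (Module.Basis.det_ne_zero _)
  obtain ⟨Z, hZg, hZfin, hZ⟩ := exists_finite_gen D.finite_H D.ne_zero
  have hgauge : ∀ q ∈ D.Q, ∃ t : V → ℝ, Continuous t ∧ (∀ y, 0 ≤ t y) ∧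
      (∀ y, t y = 0 ↔ y ∈ graphJoin D.P D.E q) ∧ IsFinAffine fun x => t (f x) := by
    intro q hq
    obtain ⟨t, h1, h2, h3, h4⟩ := exists_gauge D.finite_H hfa
      ((finite_cells D.P D.E).image fun s => coneOf (insert q s))
      (by rintro _ ⟨s, hs, rfl⟩; exact D.cut_q q hq s hs)
    exact ⟨t, h1, h2, fun y => by rw [h3]; simp [graphJoin], h4⟩
  choose! t htc ht0 ht hta using hgauge
  -- Off the cone, `Φ z y / T y` is the average of the heights of the chamber of `z`, weighted by
  -- the distances `t q y` from the joins.
  let T : V → ℝ := fun y => ∑ q : D.Q, t q y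
  let Φ : V → V → ℝ := fun z y => ∑ q : D.Q, (N q z : ℝ) * t q y
  have hTc : Continuous T := continuous_finsetSum _ fun q _ => htc q q.2
  have hΦc : ∀ z, Continuous (Φ z) := fun z =>
    continuous_finsetSum _ fun q _ => continuous_const.mul (htc q q.2)
  have hT0 : ∀ y, 0 ≤ T y := fun y =>
    Finset.sum_nonneg fun (q : D.Q) _ => ht0 q q.2 y
  have hTΛ : ∀ y, T y = 0 ↔ y ∈ graphCone D.P D.E := by
    intro y
    rw [Finset.sum_eq_zero_iff_of_nonneg fun (q : D.Q) _ => ht0 q q.2 y]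
    constructor
    · exact fun h => D.joins y fun q hq => (ht q hq y).1 (h ⟨q, hq⟩ (Finset.mem_univ _))
    · exact fun h q _ => (ht q q.2 y).2 (graphCone_subset_graphJoin _ _ _ h)
  have hTpos : ∀ y, y ∉ graphCone D.P D.E → 0 < T y := fun y hy =>
    (hT0 y).lt_of_ne' fun h => hy ((hTΛ y).1 h)
  have hUΛ : ∀ q y, y ∈ D.U q → y ∉ graphCone D.P D.E := fun q y hy h =>
    hy (graphCone_subset_graphJoin _ _ _ h)
  have hΦR : ∀ z y, |Φ z y| ≤ R * T y := by
    intro z y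
    refine (Finset.abs_sum_le_sum_abs _ _).trans ?_
    rw [Finset.mul_sum]
    refine Finset.sum_le_sum fun q _ => ?_
    rw [abs_mul, abs_of_nonneg (ht0 q q.2 y)]
    refine mul_le_mul_of_nonneg_right ?_ (ht0 q q.2 y)
    exact_mod_cast hR q z
  -- Here `z` represents a chamber adjacent to `f x`: the integer heights are read off in that
  -- chamber, the weights at `f x` itself. The sign tells whether `x` is on the sheet of the base
  -- section in that chamber.
  let val : V → V → X → Fin 2 → ℝ := fun q z x =>
    sg (S.sheet q x + S.label q z) • wave (T (f x)) (Φ z (f x))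
  have hwd₁ : ∀ q ∈ D.Q, ∀ q' ∈ D.Q, ∀ x, f x ∈ D.U q → f x ∈ D.U q' →
      ∀ z ∈ Star D.H (f x), z ∈ Gen D.H → val q z x = val q' z x := by
    intro q hq q' hq' x hx hx' z hz hzg
    simp only [val, S.sheet_add_label hq hq' hx hx' hz hzg]
  have hwd₂ : ∀ q ∈ D.Q, ∀ x, f x ∈ D.U q → ∀ z ∈ Star D.H (f x), z ∈ Gen D.H →
      ∀ z' ∈ Star D.H (f x), z' ∈ Gen D.H → val q z x = val q z' x := by
    intro q hq x hx z hz hzg z' hz' hzg'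
    -- Between two chambers of the star of `f x`, all heights with nonzero weight change by the same
    -- integer, because their differences are constant there. The other join points have weight zero
    -- at `f x`.
    have h1 : Φ z' (f x) = Φ z (f x) + ((N q z' - N q z : ℤ) : ℝ) * T (f x) := by
      simp only [Φ, T]
      rw [Finset.mul_sum, ← Finset.sum_add_distrib]
      refine Finset.sum_congr rfl fun q' _ => ?_
      by_cases hq' : f x ∈ D.U q'
      · have := hN1 q hq q' q'.2 (f x) hx hq' z hz hzg z' hz' hzg'
        rw [← add_mul, ← Int.cast_add]
        congr 2
        linarith
      · rw [(ht q' q'.2 (f x)).2 (by simpa [Config.U] using hq')]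
        simp
    have h2 := hN2 q hq (f x) hx z hz hzg z' hz' hzg'
    have h3 : S.sheet q x + S.label q z =
        S.sheet q x + S.label q z' + ((N q z' - N q z : ℤ) : ZMod 2) := by
      rw [Int.cast_sub, add_assoc]
      congr 1
      rw [← add_sub_assoc, ← h2, add_sub_cancel_right]
    simp only [val]
    rw [h1, wave_add_int_mul (hTpos _ (hUΛ q _ hx)), h3, sg_add, mul_smul]
  have hpick : ∀ x, f x ∉ graphCone D.P D.E →
      ∃ q ∈ D.Q, f x ∈ D.U q ∧ ∃ z ∈ Star D.H (f x), z ∈ Gen D.H := by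
    intro x hx
    obtain ⟨q, hq, hxq⟩ := D.exists_mem_U_of_notMem hx
    obtain ⟨z, hz, hz'⟩ := hZ (f x)
    exact ⟨q, hq, hxq, z, hz', hZg hz⟩
  choose! qq hqQ hqU zz hzs hzg using hpick
  let h : X → Fin 2 → ℝ := fun x => if f x ∈ graphCone D.P D.E then 0 else val (qq x) (zz x) x
  have hh : ∀ q ∈ D.Q, ∀ x, f x ∈ D.U q → ∀ z ∈ Star D.H (f x), z ∈ Gen D.H →
      h x = val q z x := by
    intro q hq x hx z hz hzg'
    have hxΛ := hUΛ q _ hx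
    simp only [h, if_neg hxΛ]
    rw [hwd₁ _ (hqQ x hxΛ) q hq x (hqU x hxΛ) hx _ (hzs x hxΛ) (hzg x hxΛ)]
    exact hwd₂ q hq x hx _ (hzs x hxΛ) (hzg x hxΛ) z hz hzg'
  have hnorm : ∀ x, ‖h x‖ ≤ T (f x) := by
    intro x
    by_cases hx : f x ∈ graphCone D.P D.E
    · simp only [h, if_pos hx, norm_zero]
      exact hT0 _
    · simp only [h, if_neg hx, val]
      rw [norm_smul, Real.norm_eq_abs, abs_sg, one_mul]
      exact norm_wave_le (hT0 _) _
  refine ⟨h, ?_, ?_, ?_⟩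
  · rw [continuous_iff_continuousAt]
    intro x₀
    by_cases hx₀ : f x₀ ∈ graphCone D.P D.E
    · have h0 : h x₀ = 0 := by simp only [h, if_pos hx₀]
      have h1 : Tendsto (fun x => T (f x)) (𝓝 x₀) (𝓝 0) := by
        have := (hTc.comp hf).tendsto x₀
        rwa [Function.comp_apply, (hTΛ _).2 hx₀] at this
      rw [ContinuousAt, h0]
      exact squeeze_zero_norm hnorm h1
    · obtain ⟨q, hq, hxq⟩ := D.exists_mem_U_of_notMem hx₀
      have hU : ∀ᶠ x in 𝓝 x₀, f x ∈ D.U q :=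
        hf.continuousAt.eventually_mem ((D.isOpen_U hq).mem_nhds hxq)
      refine continuousAt_of_finite_closed hZfin (A := fun z => {x | z ∈ Star D.H (f x)})
        (g := fun z => val q z) (fun z hz hzx => ?_) (Eventually.of_forall fun x => hZ (f x))
        (fun z hz hzx => ?_) ?_
      · exact ((isClosed_setOf_mem_star (hZg hz)).preimage hf).isOpen_compl.mem_nhds hzx
      · have h1 : ContinuousAt (fun x => wave (T (f x)) (Φ z (f x))) x₀ :=
          continuousAt_wave (hTc.comp hf).continuousAt ((hΦc z).comp hf).continuousAt
            (hTpos _ hx₀).ne'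
        refine (h1.const_smul (sg (S.sheet q x₀ + S.label q z))).congr ?_
        filter_upwards [S.eventually_sheet_eq hf hq hxq] with x hx
        simp only [val, hx]
        rfl
      · filter_upwards [hU] with x hx z hz hzx
        exact hh q hq x hx z hzx (hZg hz)
  · refine IsFinAffine.pi fun i => ?_
    -- A branch is fixed by the heights of the join points, which are bounded by `R`, and by the
    -- integer `k` of the wave, so there are finitely many branches.
    let G : (D.Q → Set.Icc (-R) R) × Set.Icc (-(R + 2)) (R + 2) → X → ℝ := fun j x =>
      T (f x) - (2 : ℝ) • |(∑ q : D.Q, (((j.1 q : ℤ) : ℝ)) • t q (f x)) -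
        ((![0, 1 / 2] i : ℝ)) • T (f x) - (2 * ((j.2 : ℤ) : ℝ)) • T (f x)|
    have hTa : IsFinAffine fun x => T (f x) := IsFinAffine.sum _ fun q _ => hta q q.2
    have hG : ∀ j, IsFinAffine (G j) := fun j => by
      refine hTa.sub (IsFinAffine.const_smul (IsFinAffine.abs ?_) _)
      exact ((IsFinAffine.sum _ fun (q : D.Q) _ => (hta q q.2).const_smul _).sub
        (hTa.const_smul _)).sub (hTa.const_smul _)
    refine IsFinAffine.of_finite (fun (j : SignType × ((D.Q → Set.Icc (-R) R) ×
      Set.Icc (-(R + 2)) (R + 2))) x => ((j.1 : ℝ)) • G j.2 x) (fun j => (hG j.2).const_smul _)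
      fun x => ?_
    have hR0 : 0 ≤ R := (abs_nonneg _).trans (hR 0 0)
    by_cases hx : f x ∈ graphCone D.P D.E
    · refine ⟨⟨0, fun _ => ⟨0, by simpa using hR0⟩, ⟨0, by constructor <;> linarith⟩⟩, ?_⟩
      simp only [h, if_pos hx]
      simp
    · obtain ⟨k, hk, hw⟩ := exists_wave_eq (hTpos _ hx) (hΦR (zz x) (f x)) i
      have hk' : k ∈ Set.Icc (-(R + 2)) (R + 2) := by
        rw [abs_le] at hk
        exact ⟨by exact_mod_cast hk.1, by exact_mod_cast hk.2⟩
      have hGx : wave (T (f x)) (Φ (zz x) (f x)) i =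
          G ⟨fun q => ⟨N q (zz x), abs_le.1 (hR q (zz x))⟩, ⟨k, hk'⟩⟩ x := by
        rw [hw]
        have h1 : (![0, T (f x) / 2] i : ℝ) = (![0, 1 / 2] i : ℝ) * T (f x) := by
          fin_cases i
          · simp
          · simp; ring
        simp only [G, Φ, smul_eq_mul, h1]
      have hhx : h x i = sg (S.sheet (qq x) x + S.label (qq x) (zz x)) *
          wave (T (f x)) (Φ (zz x) (f x)) i := by
        simp only [h, if_neg hx, val, Pi.smul_apply, smul_eq_mul]
      rw [hhx, hGx]
      rcases sg_eq_or (S.sheet (qq x) x + S.label (qq x) (zz x)) with hs | hs <;> rw [hs]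
      · exact ⟨⟨1, ⟨fun q => ⟨N q (zz x), abs_le.1 (hR q (zz x))⟩, ⟨k, hk'⟩⟩⟩, by simp⟩
      · exact ⟨⟨-1, ⟨fun q => ⟨N q (zz x), abs_le.1 (hR q (zz x))⟩, ⟨k, hk'⟩⟩⟩, by simp⟩
  · intro x x' hxx' hhx
    by_cases hx : f x ∈ graphCone D.P D.E
    · exact S.fibre_branch x x' hxx' hx
    · by_contra hne
      have h1 := hh _ (hqQ x hx) x (hqU x hx) _ (hzs x hx) (hzg x hx)
      have h2 := hh _ (hqQ x hx) x' (hxx' ▸ hqU x hx) _ (hxx' ▸ hzs x hx) (hzg x hx)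
      -- Two distinct points of a fibre lie on different sheets, so their values are opposite; being
      -- equal as well, they would vanish, but the wave has no zeros.
      have h3 : S.sheet (qq x) x = S.sheet (qq x) x' + 1 := by
        have h4 := S.diffLabel_add (a := x) (b := x') (c := S.sect (qq x) (f x)) hxx'
          (by rw [← hxx', S.map_sect_apply (hqQ x hx) (hqU x hx)])
        rw [diffLabel, if_neg hne] at h4
        rw [SectionData.sheet, SectionData.sheet, ← hxx', ← h4, add_comm]
      have h5 : sg ((1 : ZMod 2)) = -1 := by simp [sg]
      rw [h1, h2] at hhx
      simp only [val, ← hxx', h3] at hhx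
      rw [add_right_comm, sg_add, h5, mul_neg_one, neg_smul, neg_eq_iff_add_eq_zero,
        ← two_smul ℝ] at hhx
      have h6 := (smul_eq_zero.1 ((smul_eq_zero.1 hhx).resolve_left two_ne_zero)).resolve_right
        (wave_ne_zero (hTpos _ hx) _)
      have h7 := abs_sg (S.sheet (qq x) x' + S.label (qq x) (zz x))
      rw [h6, abs_zero] at h7
      exact zero_ne_one h7

/-! ### Sections over the complements of the joins. -/

section Radial

variable {V : Type*} [NormedAddCommGroup V] [NormedSpace ℝ V]

/-- The join is stable under adding nonnegative multiples of `q` and under positive scaling. If `a •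
-q + b • y` with `b > 0` belonged to it, then adding `a • q` and rescaling would put `y` into it. -/
theorem starConvex_compl_graphJoin {P : Finset V} {E : Finset (V × V)} {q : V}
    (hq : ∀ s ∈ cells P E, q ∉ Submodule.span ℝ s) :
    -q ∈ (graphJoin P E q)ᶜ ∧ StarConvex ℝ (-q) (graphJoin P E q)ᶜ := by
  have h1 : -q ∈ (graphJoin P E q)ᶜ := by
    rintro ⟨s, hs, h⟩
    obtain ⟨c, hc, x, hx, h⟩ := mem_coneOf_insert.1 h
    refine hq s hs ((Submodule.smul_mem_iff _ (show -(1 + c) ≠ 0 by linarith)).1 ?_)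
    have : (-(1 + c)) • q = x := by
      calc _ = -q - c • q := by module
        _ = x := by rw [h]; module
    rw [this]
    exact coneOf_subset_span _ hx
  refine ⟨h1, fun y hy a b ha hb hab h => ?_⟩
  rcases hb.eq_or_lt with rfl | hb
  · obtain rfl : a = 1 := by linarith
    exact h1 (by simpa using h)
  · obtain ⟨s, hs, h⟩ := h
    refine hy ⟨s, hs, ?_⟩
    have hqs : q ∈ coneOf (insert q s) := Submodule.subset_span (Set.mem_insert _ _)
    have h2 := smul_mem_coneOf (add_mem_coneOf h (smul_mem_coneOf hqs ha)) (inv_nonneg.2 hb.le)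
    have h3 : a • -q + b • y + a • q = b • y := by module
    rwa [h3, inv_smul_smul₀ hb.ne'] at h2

theorem ne_zero_of_mem_compl_graphJoin {P : Finset V} {E : Finset (V × V)} {q y : V}
    (hy : y ∈ (graphJoin P E q)ᶜ) : y ≠ 0 := by
  rintro rfl
  exact hy ⟨∅, Or.inl (Or.inl rfl), zero_mem_coneOf _⟩

end Radial

theorem exists_radial_section {m : ℕ} {M : Type*} [TopologicalSpace M] {f : M → Sphere m}
    {L : Set (Sphere m)} (hf : IsCoveringMap (Lᶜ.restrictPreimage f))
    (hsurj : ∀ b ∉ L, ∃ x, f x = b) {P : Finset (Fin (m + 1) → ℝ)}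
    {E : Finset ((Fin (m + 1) → ℝ) × (Fin (m + 1) → ℝ))}
    (hL : ∀ y : Sphere m, (y : Fin (m + 1) → ℝ) ∈ graphCone P E ↔ y ∈ L) {q : Fin (m + 1) → ℝ}
    (hq : ∀ s ∈ cells P E, q ∉ Submodule.span ℝ s) (hU : IsOpen (graphJoin P E q)ᶜ) :
    ∃ F : (Fin (m + 1) → ℝ) → M, ContinuousOn F (graphJoin P E q)ᶜ ∧
      ∀ y ∈ (graphJoin P E q)ᶜ, (f (F y) : Fin (m + 1) → ℝ) = ‖y‖⁻¹ • y := by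
  classical
  let π : (Fin (m + 1) → ℝ) → Sphere m := fun y =>
    -- The value at the origin is arbitrary, since the origin lies in every join.
    if h : y = 0 then ⟨fun _ => 1, by simp⟩ else ⟨‖y‖⁻¹ • y, by
      rw [mem_sphere_zero_iff_norm, norm_smul, norm_inv, norm_norm,
        inv_mul_cancel₀ (norm_ne_zero_iff.2 h)]⟩
  have hπ : ∀ y, y ≠ 0 → (π y : Fin (m + 1) → ℝ) = ‖y‖⁻¹ • y := fun y hy => by
    simp only [π, dif_neg hy]
  have hne : ∀ y ∈ (graphJoin P E q)ᶜ, y ≠ 0 := fun y => ne_zero_of_mem_compl_graphJoin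
  have hcont : ContinuousOn π (graphJoin P E q)ᶜ := by
    rw [Topology.IsInducing.subtypeVal.continuousOn_iff]
    have h1 : ContinuousOn (fun y : Fin (m + 1) → ℝ => ‖y‖⁻¹ • y) (graphJoin P E q)ᶜ :=
      (continuous_norm.continuousOn.inv₀ fun y hy => norm_ne_zero_iff.2 (hne y hy)).smul
        continuousOn_id
    exact h1.congr fun y hy => hπ y (hne y hy)
  have hπL : ∀ y ∈ (graphJoin P E q)ᶜ, π y ∉ L := by
    intro y hy h
    rw [← hL, hπ y (hne y hy)] at h
    obtain ⟨s, hs, h⟩ := h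
    refine hy (graphCone_subset_graphJoin _ _ _ ⟨s, hs, ?_⟩)
    have := smul_mem_coneOf h (norm_nonneg y)
    rwa [smul_inv_smul₀ (norm_ne_zero_iff.2 (hne y hy))] at this
  obtain ⟨hmem, hstar⟩ := starConvex_compl_graphJoin hq
  obtain ⟨F, hF, hfF⟩ := exists_section hf hU hmem hstar hcont hπL hsurj
  exact ⟨F, hF, fun y hy => by rw [hfF y hy, hπ y (hne y hy)]⟩

theorem eq_of_encard_le_two {α : Type*} {s : Set α} (hs : s.encard ≤ 2) {x y z : α} (hx : x ∈ s)
    (hy : y ∈ s) (hz : z ∈ s) (hxy : x ≠ y) (hyz : y ≠ z) : x = z := by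
  by_contra hxz
  have h : ({x, y, z} : Set α).encard ≤ 2 := (Set.encard_le_encard (by
    rintro w (rfl | rfl | rfl) <;> assumption)).trans hs
  rw [Set.encard_insert_of_notMem (by simp [hxy, hxz]), Set.encard_pair hyz] at h
  norm_num at h

/-! ### From the branched covering to the embedded lift. -/

variable {E : Type*} [NormedAddCommGroup E] [NormedSpace ℝ E]

theorem finrank_fin_four : Module.finrank ℝ (Fin 4 → ℝ) = 4 := by simp

/-- A configuration whose cone is the cone over the branch set. -/
theorem IsBranchedCovering.exists_config {d : ℕ} {M : Set E} {f : M → Sphere 3}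
    {L : Set (Sphere 3)} (hL : IsBranchedCovering d f L) :
    ∃ D : Config (Fin 4 → ℝ), ∀ y : Sphere 3, (y : Fin 4 → ℝ) ∈ graphCone D.P D.E ↔ y ∈ L := by
  classical
  obtain ⟨K, hK, hC, hKL⟩ := hL.branchSet
  have hseg : ∀ C ∈ K, C.Nonempty → ∃ i : (Fin 4 → ℝ) × (Fin 4 → ℝ), C = segment ℝ i.1 i.2 := by
    intro C hCK hne
    obtain ⟨a, b, h⟩ := exists_eq_segment (hC C hCK).1.1 (hC C hCK).1.convex
      (collinear_iff_finrank_le_one.2 (by have := (hC C hCK).2; omega)) hne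
    exact ⟨(a, b), h⟩
  choose! i hi using hseg
  have hfin : (i '' {C ∈ K | C.Nonempty}).Finite := (hK.subset (Set.sep_subset _ _)).image _
  have hmem : ∀ e, e ∈ hfin.toFinset ↔ ∃ C ∈ K, C.Nonempty ∧ i C = e := fun e => by
    rw [hfin.mem_toFinset]
    exact ⟨fun ⟨C, h1, h2⟩ => ⟨C, h1.1, h1.2, h2⟩, fun ⟨C, h1, h2, h3⟩ => ⟨C, ⟨h1, h2⟩, h3⟩⟩
  have hunit : ∀ e ∈ hfin.toFinset, ∀ x ∈ segment ℝ e.1 e.2, ‖x‖ = 1 := by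
    intro e he x hx
    obtain ⟨C, hCK, hne, rfl⟩ := (hmem e).1 he
    rw [← hi C hCK hne] at hx
    have : x ∈ Subtype.val '' L := hKL ▸ Set.mem_sUnion_of_mem hx hCK
    obtain ⟨y, -, rfl⟩ := this
    exact mem_sphere_zero_iff_norm.1 y.2
  obtain ⟨S, hS⟩ := exists_skeleton finrank_fin_four hfin.toFinset hunit
  obtain ⟨D, rfl⟩ := S.exists_config finrank_fin_four
  refine ⟨D, fun y => ?_⟩
  have hy : ‖(y : Fin 4 → ℝ)‖ = 1 := mem_sphere_zero_iff_norm.1 y.2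
  rw [hS]
  constructor
  · rintro (h | ⟨c, hc, e, he, x, hx, h⟩)
    · rw [h, norm_zero] at hy
      exact absurd hy zero_ne_one
    · have hyx := eq_of_smul_eq_smul_of_norm hy (hunit e he x hx) one_pos hc.le
        (by rw [one_smul, h])
      obtain ⟨C, hCK, hne, rfl⟩ := (hmem e).1 he
      rw [← hi C hCK hne, ← hyx] at hx
      have : (y : Fin 4 → ℝ) ∈ Subtype.val '' L := hKL ▸ Set.mem_sUnion_of_mem hx hCK
      obtain ⟨y', hy', h'⟩ := this
      rwa [← Subtype.ext h']
  · intro hyL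
    have : (y : Fin 4 → ℝ) ∈ ⋃₀ K := hKL ▸ Set.mem_image_of_mem _ hyL
    obtain ⟨C, hCK, hyC⟩ := this
    have hne : C.Nonempty := ⟨_, hyC⟩
    refine Or.inr ⟨1, one_pos, i C, (hmem _).2 ⟨C, hCK, hne, rfl⟩, y, ?_, (one_smul _ _).symm⟩
    rwa [← hi C hCK hne]

theorem IsBranchedCovering.isClosed {m d : ℕ} {M : Set E} {f : M → Sphere m}
    {L : Set (Sphere m)} (hL : IsBranchedCovering d f L) : IsClosed L := by
  obtain ⟨K, hK, hC, hKL⟩ := hL.branchSet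
  have h1 : IsClosed (⋃₀ K) := 
    (hK.isCompact_sUnion fun C h => (hC C h).1.1).isClosed
  rw [hKL] at h1
  have h2 := h1.preimage (continuous_subtype_val (p := fun x => x ∈ Sphere m))
  rwa [Set.preimage_image_eq _ Subtype.val_injective] at h2

theorem IsCompactPolyhedron.exists_bound {M : Set E} (hM : IsCompactPolyhedron M)
    {F : Type*} [NormedAddCommGroup F] {h : M → F} (hc : Continuous h) : ∃ C > 0, ∀ x, ‖h x‖ ≤ C := by
  have : CompactSpace M := isCompact_iff_compactSpace.1 hM.isCompact
  obtain ⟨C, hC0, hC⟩ := (isCompact_range hc).isBounded.exists_pos_norm_le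
  exact ⟨C, hC0, fun x => hC _ ⟨x, rfl⟩⟩

variable [FiniteDimensional ℝ E]

theorem IsBranchedCovering.continuous {m d : ℕ} {M : Set E} {f : M → Sphere m}
    {L : Set (Sphere m)} (hL : IsBranchedCovering d f L) : Continuous f :=
  continuous_induced_rng.2 hL.isPL.continuous

/-- Sections of a simple twofold branched covering of the three-sphere. -/
theorem IsBranchedCovering.nonempty_sectionData {M : Set E} {f : M → Sphere 3}
    {L : Set (Sphere 3)} (hL : IsBranchedCovering 2 f L)
    (hL' : ∀ y ∈ L, (f ⁻¹' {y}).encard + 1 = ((2 : ℕ) : ℕ∞)) {D : Config (Fin 4 → ℝ)}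
    (hD : ∀ y : Sphere 3, (y : Fin 4 → ℝ) ∈ graphCone D.P D.E ↔ y ∈ L) :
    Nonempty (SectionData D fun x => (f x : Fin 4 → ℝ)) := by
  have hsurj : ∀ b ∉ L, ∃ x, f x = b := by
    intro b hb
    have h := hL.degree b hb
    have hne : (f ⁻¹' {b}).Nonempty := by
      rw [← Set.encard_ne_zero, h]
      norm_num
    exact hne
  have hle : ∀ y, (f ⁻¹' {y}).encard ≤ 2 := by
    intro y
    by_cases hy : y ∈ L
    · exact (hL.minimum y hy).le
    · exact (hL.degree y hy).le
  obtain ⟨F₀, hF₀, hfF₀⟩ := exists_radial_section hL.isCoveringMap hsurj hD D.p_notMem_span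
    D.isOpen_U_p
  have hsect : ∀ q ∈ D.Q, ∃ F : (Fin 4 → ℝ) → M, ContinuousOn F (D.U q) ∧
      ∀ y ∈ D.U q, (f (F y) : Fin 4 → ℝ) = ‖y‖⁻¹ • y := fun q hq =>
    exists_radial_section hL.isCoveringMap hsurj hD (D.q_notMem_span q hq) (D.isOpen_U hq)
  have hM : ∀ q : Fin 4 → ℝ, ∃ F : (Fin 4 → ℝ) → M, q ∈ D.Q → ContinuousOn F (D.U q) ∧
      ∀ y ∈ D.U q, (f (F y) : Fin 4 → ℝ) = ‖y‖⁻¹ • y := by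
    intro q
    by_cases hq : q ∈ D.Q
    · obtain ⟨F, hF⟩ := hsect q hq
      exact ⟨F, fun _ => hF⟩
    · exact ⟨F₀, fun h => absurd h hq⟩
  choose F hF using hM
  exact ⟨{
    base := F₀
    sect := F
    norm_map := fun x => mem_sphere_zero_iff_norm.1 (f x).2
    continuousOn_base := hF₀
    continuousOn_sect := fun q hq => (hF q hq).1
    map_base := hfF₀
    map_sect := fun q hq => (hF q hq).2
    injOn := fun x hx => by
      obtain ⟨W, hW, h⟩ := exists_injOn_nhds hL.isCoveringMap hL.continuous hL.isClosed
        (mt (hD (f x)).2 hx)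
      exact ⟨W, hW, fun a ha b hb hab => h ha hb (Subtype.ext hab)⟩
    lifts := fun K hK g₁ g₂ h₁ h₂ h hΛ a ha hag =>
      eqOn_of_lifts hL.isCoveringMap hK h₁ h₂ (fun b hb => Subtype.ext (h b hb))
        (fun b hb => mt (hD _).2 (hΛ b hb)) ha hag
    fibre := fun x y z hxy hyz hne hne' =>
      eq_of_encard_le_two (hle (f y)) (Subtype.ext hxy : f x = f y) (rfl : f y = f y)
        (Subtype.ext hyz.symm : f z = f y) hne hne'
    fibre_branch := fun x y hxy hx => by
      have h1 := hL' _ ((hD _).1 hx)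
      have h2 : (f ⁻¹' {f x}).encard ≤ 1 := by
        have h3 : (f ⁻¹' {f x}).encard + 1 ≤ 1 + 1 := by
          rw [h1]; norm_num
        exact (ENat.add_le_add_iff_right ENat.one_ne_top).1 h3
      exact Set.encard_le_one_iff.1 h2 x y rfl (Subtype.ext hxy.symm : f y = f x) }⟩

/-- A fibrewise embedding in the plane gives an embedded lift. -/
theorem exists_isEmbeddedLift_of_fibrewise {m d : ℕ} {M : Set E} {f : M → Sphere m}
    (hf : IsSimpleBranchedCovering d f) {h : M → Fin 2 → ℝ} (hc : Continuous h)
    (ha : IsFinAffine h) (hinj : ∀ x x', f x = f x' → h x = h x' → x = x') :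
    ∃ g : M → Tube m, IsEmbeddedLift d f g := by
  obtain ⟨L, hL, -⟩ := id hf
  have hM := hL.isPL.isCompactPolyhedron
  obtain ⟨C, hC, hCh⟩ := hM.exists_bound hc
  let g : M → Tube m := fun x => ⟨(C⁻¹ • h x, f x), ⟨by
    rw [mem_closedBall_zero_iff, norm_smul, norm_inv, Real.norm_of_nonneg hC.le,
      inv_mul_le_iff₀ hC, mul_one]
    exact hCh x, (f x).2⟩⟩
  have hgc : Continuous g :=
    ((hc.const_smul C⁻¹).prodMk (continuous_subtype_val.comp hL.continuous)).subtype_mk _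
  have hga : IsFinAffine fun x => (g x : (Fin 2 → ℝ) × (Fin (m + 1) → ℝ)) :=
    (ha.const_smul C⁻¹).prodMk hL.isPL.isFinAffine
  have hginj : Function.Injective g := by
    intro x x' hxx'
    have h1 := congrArg (fun p : Tube m => p.1) hxx'
    obtain ⟨h2, h3⟩ := Prod.ext_iff.1 h1
    exact hinj x x' (Subtype.ext h3) (smul_right_injective _ (inv_ne_zero hC.ne') h2)
  have hpr : pr ∘ g = f := rfl
  refine ⟨g, ⟨⟨?_, Subtype.val_injective.comp hginj⟩,
    ⟨?_, tubeInclusion_injective.comp hginj⟩, hpr ▸ hf⟩, hpr⟩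
  · exact isPL_of_continuous_of_isFinAffine hM (continuous_subtype_val.comp hgc) hga
  · exact isPL_of_continuous_of_isFinAffine hM (continuous_tubeInclusion.comp hgc)
      (isFinAffine_tubeInclusion hga)

end PLBraid

theorem mainTheorem1 {E : Type*} [NormedAddCommGroup E] [NormedSpace ℝ E] [FiniteDimensional ℝ E]
    (M : Set E) (hM : PLBraid.IsClosedPLManifold 3 M)
    (f : M → PLBraid.Sphere 3) (hf : PLBraid.IsSimpleBranchedCovering 2 f) :
    ∃ g : M → PLBraid.Tube 3, PLBraid.IsEmbeddedLift 2 f g := by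
  obtain ⟨L, hL, hL'⟩ := id hf
  obtain ⟨D, hD⟩ := hL.exists_config
  obtain ⟨S⟩ := hL.nonempty_sectionData hL' hD
  obtain ⟨h, hc, ha, hinj⟩ := S.exists_fibrewise_embedding hL.isPL.continuous hL.isPL.isFinAffine
  exact PLBraid.exists_isEmbeddedLift_of_fibrewise hf hc ha fun x x' hxx' =>
    hinj x x' (congrArg Subtype.val hxx')
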